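/- Consider the non-interacting Haldane model on the honeycomb lattice. Let $\vec\ell_{1}=\tfrac12(3,-\sqrt3)$, $\vec\ell_2=\tfrac12(3,\sqrt3)$, let $\Lambda=\mathbb Z\vec\ell_1+\mathbb Z\vec\ell_2$, $\Lambda_L=\Lambda/L\Lambda$, let $\vec G_1,\vec G_2$ be the dual basis, $\vec G_i\cdot\vec\ell_j=2\pi\delta_{ij}$, and put $\mathcal B_L=\{\tfrac{n_1}L\vec G_1+\tfrac{n_2}L\vec G_2: n_i\in\mathbb Z\cap(-\tfrac L2,\tfrac L2]\}$, $\vec\gamma_1=\vec\ell_1-\vec\ell_2$, $\vec\gamma_2=\vec\ell_2$, $\vec\gamma_3=-\vec\ell_1$, $\vec\delta_1=(1,0)$, $\vec\delta_{2}=(-\tfrac12,\tfrac{\sqrt3}2)$, $\vec\delta_3=(-\tfrac12,-\tfrac{\sqrt3}2)$. Let $\psi_{\vec x,\rho}$, $\vec x\in\Lambda_L$, $\rho\in\{1,2\}$, be fermionic annihilation operators on the corresponding Fock space, $\hat\psi_{\vec k,\rho}=\sum_{\vec x\in\Lambda_L}e^{i\vec k\cdot\vec x}\psi_{\vec x,\rho}$,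 and for real parameters $t_1,t_2,\phi,W$ let $$\mathcal H_{0,L}=-t_1\sum_{\vec x}\big[\psi^\dagger_{\vec x,1}(\psi_{\vec x,2}+\psi_{\vec x-\vec\ell_1,2}+\psi_{\vec x-\vec\ell_2,2})+h.c.\big]-t_2\sum_{\vec x}\sum_{\alpha=\pm}\sum_{j=1}^3\big(e^{i\alpha\phi}\psi^\dagger_{\vec x,1}\psi_{\vec x+\alpha\vec\gamma_j,1}+e^{-i\alpha\phi}\psi^\dagger_{\vec x,2}\psi_{\vec x+\alpha\vec\gamma_j,2}\big)+W\sum_{\vec x}(\psi^\dagger_{\vec x,1}\psi_{\vec x,1}-\psi^\dagger_{\vec x,2}\psi_{\vec x,2}),$$ and $\mathcal H_L=\mathcal H_{0,L}-\mu\,\mathcal N_L$, where $\mathcal N_L$ is the number operator and $\mu=3t_2\cos\phi$. The zero-momentum current is $\mathcal J_i=L^{-2}\sum_{\vec k\in\mathcal B_L}\hat\psi^\dagger_{\vec k}\Gamma_i(\vec k)\hat\psi_{\vec k}$ with $\Gamma_{i,11}(\vec k)=-it_2\sum_{j}\sum_{\alpha=\pm}\alpha(\vec\gamma_j)_ie^{i\alpha(\phi-\vec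 k\cdot\vec\gamma_j)}$, $\Gamma_{i,12}(\vec k)=-it_1\sum_j(\vec\delta_j)_ie^{-i\vec k\cdot(\vec\delta_j-\vec\delta_1)}$, $\Gamma_{i,21}(\vec k)=-\Gamma_{i,12}(-\vec k)$, $\Gamma_{i,22}(\vec k)=-\Gamma_{i,11}(-\vec k)$. With $\langle A\rangle_{\beta,L}=\mathrm{Tr}(e^{-\beta\mathcal H_L}A)/\mathrm{Tr}(e^{-\beta\mathcal H_L})$, $A(t)=e^{t\mathcal H_L}Ae^{-t\mathcal H_L}$, $T$ the time ordering (decreasing times) and $p_{0,\beta}=\tfrac{2\pi}\beta\lfloor\tfrac{\beta p_0}{2\pi}\rfloor$, let $$\hat K_{ij}(p_0)=\lim_{\beta\to\infty}\lim_{L\to\infty}\frac1{\beta L^2}\int_0^\beta dt\int_0^\beta ds\,e^{-ip_{0,\beta}(t-s)}\big[\langle T(\mathcal J_i(t)\mathcal J_j(s))\rangle_{\beta,L}-\langle\mathcal J_i\rangle_{\beta,L}\langle\mathcal J_j\rangle_{\beta,L}\big],\qquad \sigma_{ij}=\frac1{|\vec\ell_1\times\vec\ell_2|}\lim_{p_0\to0^-}\frac{\hat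 K_{ij}(p_0)-\hat K_{ij}(0)}{p_0}.$$ **Theorem.** Let $t_1,t_2>0$, $t_2/t_1<1/3$, $\phi\in(0,\pi)$, and suppose that $W$ lies on the critical line $m_-=0$, where $m_-=m(\vec k_F^-)$, $m(\vec k)=W-2t_2\sin\phi\sum_{j=1}^3\sin(\vec k\cdot\vec\gamma_j)$, $\vec k_F^-=\tfrac{2\pi}3(1,-\tfrac1{\sqrt3})$; that is, $W=3\sqrt3\,t_2\sin\phi$. Then all the above limits exist for $(i,j)=(1,2)$ and the Kubo transverse conductivity is $\sigma_{12}=\dfrac1{4\pi}$. -/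

import Mathlib

/-! The non-interacting Haldane model on the honeycomb lattice and its Kubo conductivity. -/

namespace Haldane

noncomputable section

open Filter Topology Matrix

/-! ### Fermions on a finite set of modes

The fermionic Fock space over a finite, linearly ordered set `ι` of modes has the occupation number
basis `|S⟩`, `S ⊆ ι`; operators on it are complex matrices indexed by `Finset ι`. -/

section Fock

variable {ι : Type} [Fintype ι] [LinearOrder ι]

/-- Operators on the fermionic Fock space over `ι`. -/
abbrev FockOp (ι : Type) : Type := Matrix (Finset ι) (Finset ι) ℂ

/-- The annihilation operator of the mode `s`:
`ψ_s |T⟩ = (-1)^{#{r ∈ T, r < s}} |T \ {s}⟩` if `s ∈ T`, and `ψ_s |T⟩ = 0` otherwise. -/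
def annihilation (s : ι) : FockOp ι :=
  Matrix.of fun S T =>
    if s ∈ T ∧ S = T.erase s then (-1 : ℂ) ^ (T.filter (fun r => r < s)).card else 0

/-- The creation operator of the mode `s`, the adjoint of the annihilation operator. -/
def creation (s : ι) : FockOp ι := (annihilation s)ᴴ

/-- The Gibbs expectation `Tr(e^{-βH} A) / Tr(e^{-βH})`. -/
def gibbs (β : ℝ) (H A : FockOp ι) : ℂ :=
  Matrix.trace (NormedSpace.exp (-(β : ℂ) • H) * A) /
    Matrix.trace (NormedSpace.exp (-(β : ℂ) • H))

/-- Imaginary time evolution `A(t) = e^{tH} A e^{-tH}`. -/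
def evolve (H A : FockOp ι) (t : ℝ) : FockOp ι :=
  NormedSpace.exp ((t : ℂ) • H) * A * NormedSpace.exp (-(t : ℂ) • H)

/-- Time ordered product (decreasing time order) of two operators that are of even degree in the
fermions: `T(A(t) B(s))`. -/
def timeOrdered (H A B : FockOp ι) (t s : ℝ) : FockOp ι :=
  if s < t then evolve H A t * evolve H B s else evolve H B s * evolve H A t

end Fock

/-! ### The lattice -/

/-- The basis vector `ℓ₁ = (3, -√3)/2` of the triangular lattice `Λ`. -/
def ell₁ : Fin 2 → ℝ := ![3 / 2, -(√3 / 2)]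

/-- The basis vector `ℓ₂ = (3, √3)/2` of the triangular lattice `Λ`. -/
def ell₂ : Fin 2 → ℝ := ![3 / 2, √3 / 2]

/-- The dual basis vector `G₁`, characterized by `G₁ · ℓⱼ = 2π δ₁ⱼ`. -/
def G₁ : Fin 2 → ℝ := ![2 * Real.pi / 3, -(2 * Real.pi / √3)]

/-- The dual basis vector `G₂`, characterized by `G₂ · ℓⱼ = 2π δ₂ⱼ`. -/
def G₂ : Fin 2 → ℝ := ![2 * Real.pi / 3, 2 * Real.pi / √3]

theorem G_dot_ell : G₁ ⬝ᵥ ell₁ = 2 * Real.pi ∧ G₁ ⬝ᵥ ell₂ = 0 ∧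
    G₂ ⬝ᵥ ell₁ = 0 ∧ G₂ ⬝ᵥ ell₂ = 2 * Real.pi := by
  have h : √3 ≠ 0 := by positivity
  refine ⟨?_, ?_, ?_, ?_⟩ <;>
    simp [G₁, G₂, ell₁, ell₂, dotProduct, Fin.sum_univ_two] <;> field_simp <;> ring

/-- The nearest-neighbour vectors `δ₁, δ₂, δ₃`. -/
def delta : Fin 3 → Fin 2 → ℝ := ![![1, 0], ![-1 / 2, √3 / 2], ![-1 / 2, -(√3 / 2)]]

/-- The next-to-nearest-neighbour vectors `γ₁ = ℓ₁ - ℓ₂`, `γ₂ = ℓ₂`, `γ₃ = -ℓ₁`. -/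
def gam : Fin 3 → Fin 2 → ℝ := ![ell₁ - ell₂, ell₂, -ell₁]

/-- The area `|ℓ₁ × ℓ₂|` of the unit cell. -/
def cellArea : ℝ := |ell₁ 0 * ell₂ 1 - ell₁ 1 * ell₂ 0|

theorem cellArea_eq : cellArea = 3 * √3 / 2 := by
  have h : ell₁ 0 * ell₂ 1 - ell₁ 1 * ell₂ 0 = 3 * √3 / 2 := by
    simp [ell₁, ell₂]; ring
  rw [cellArea, h, abs_of_nonneg (by positivity)]

/-! ### The model -/

/-- Parameters: hopping strengths `t₁, t₂`, magnetic phase `φ`, staggered potential `W`. -/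
structure Params where
  t₁ : ℝ
  t₂ : ℝ
  φ : ℝ
  W : ℝ

/-- `m(k) = W - 2 t₂ sin φ ∑ⱼ sin(k · γⱼ)`. -/
def mass (P : Params) (k : Fin 2 → ℝ) : ℝ :=
  P.W - 2 * P.t₂ * (∑ j, Real.sin (k ⬝ᵥ gam j)) * Real.sin P.φ

/-- The Fermi point `k_F^- = (2π/3) (1, -1/√3)`. -/
def kFminus : Fin 2 → ℝ := ![2 * Real.pi / 3, -(2 * Real.pi / 3 * (1 / √3))]

/-- The mass `m_- = m(k_F^-)`. -/
def massMinus (P : Params) : ℝ := mass P kFminus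

theorem massMinus_eq (P : Params) : massMinus P = P.W - 3 * √3 * P.t₂ * Real.sin P.φ := by
  have h : √3 ≠ 0 := by positivity
  have hs : Real.sin (2 * Real.pi / 3) = √3 / 2 := by
    rw [show 2 * Real.pi / 3 = Real.pi - Real.pi / 3 by ring, Real.sin_pi_sub, Real.sin_pi_div_three]
  have e0 : kFminus ⬝ᵥ gam 0 = 2 * Real.pi / 3 := by
    simp [kFminus, gam, ell₁, ell₂, dotProduct, Fin.sum_univ_two]; field_simp; ring
  have e1 : kFminus ⬝ᵥ gam 1 = 2 * Real.pi / 3 := by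
    simp [kFminus, gam, ell₁, ell₂, dotProduct, Fin.sum_univ_two]; field_simp; ring
  have e2 : kFminus ⬝ᵥ gam 2 = 2 * Real.pi / 3 - 2 * Real.pi := by
    simp [kFminus, gam, ell₁, ell₂, dotProduct, Fin.sum_univ_two]; field_simp; ring
  rw [massMinus, mass, Fin.sum_univ_three, e0, e1, e2, Real.sin_sub_two_pi, hs]
  ring

/-- The chemical potential `μ = 3 t₂ cos φ`, the energy of the Fermi points. -/
def chemPot (P : Params) : ℝ := 3 * P.t₂ * Real.cos P.φ

section Finite

variable (P : Params) (L : ℕ) [NeZero L]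

/-- The discrete torus `Λ_L = Λ / LΛ`; the pair `(n₁, n₂)` stands for `n₁ ℓ₁ + n₂ ℓ₂`. -/
abbrev Torus (L : ℕ) : Type := Fin L × Fin L

/-- The fermionic modes: pairs (site of `Λ_L`, sublattice index), in lexicographic order. The
sublattice labels `1, 2` are written `0, 1`. -/
abbrev Mode (L : ℕ) : Type := Fin L ×ₗ Fin L ×ₗ Fin 2

/-- The annihilation operator `ψ_{x,ρ}`. -/
def psi (x : Torus L) (ρ : Fin 2) : FockOp (Mode L) :=
  annihilation (toLex (x.1, toLex (x.2, ρ)))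

/-- The creation operator `ψ†_{x,ρ}`. -/
def psiDag (x : Torus L) (ρ : Fin 2) : FockOp (Mode L) :=
  creation (toLex (x.1, toLex (x.2, ρ)))

/-- The vectors `γ₁ = ℓ₁ - ℓ₂`, `γ₂ = ℓ₂`, `γ₃ = -ℓ₁` as elements of the discrete torus. -/
def gamT : Fin 3 → Torus L := ![(1, -1), (0, 1), (-1, 0)]

/-- Nearest-neighbour hopping from black to white sites. -/
def hopNN : FockOp (Mode L) :=
  ∑ x : Torus L, psiDag L x 0 * (psi L x 1 + psi L (x - (1, 0)) 1 + psi L (x - (0, 1)) 1)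

/-- Next-to-nearest-neighbour hopping, with the phases of the dipolar magnetic field. -/
def hopNNN : FockOp (Mode L) :=
  ∑ x : Torus L, ∑ j : Fin 3,
    (Complex.exp (Complex.I * P.φ) • (psiDag L x 0 * psi L (x + gamT L j) 0)
      + Complex.exp (-(Complex.I * P.φ)) • (psiDag L x 0 * psi L (x - gamT L j) 0)
      + Complex.exp (-(Complex.I * P.φ)) • (psiDag L x 1 * psi L (x + gamT L j) 1)
      + Complex.exp (Complex.I * P.φ) • (psiDag L x 1 * psi L (x - gamT L j) 1))

/-- The Haldane Hamiltonian with periodic boundary conditions. -/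
def hamiltonian₀ : FockOp (Mode L) :=
  -(P.t₁ : ℂ) • (hopNN L + (hopNN L)ᴴ) - (P.t₂ : ℂ) • hopNNN P L
    + (P.W : ℂ) • ∑ x : Torus L, (psiDag L x 0 * psi L x 0 - psiDag L x 1 * psi L x 1)

/-- The total number operator. -/
def number : FockOp (Mode L) := ∑ x : Torus L, ∑ ρ : Fin 2, psiDag L x ρ * psi L x ρ

/-- The non-interacting grand-canonical Hamiltonian `H₀ - μ N`. -/
def hamiltonian : FockOp (Mode L) := hamiltonian₀ P L - (chemPot P : ℂ) • number L

/-- The position vector in `ℝ²` of a point of the torus. -/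
def position (x : Torus L) : Fin 2 → ℝ := (x.1.val : ℝ) • ell₁ + (x.2.val : ℝ) • ell₂

/-- The integers in `(-L/2, L/2]`. -/
def zoneIndex (L : ℕ) : Finset ℤ :=
  (Finset.Icc (-(L : ℤ)) (L : ℤ)).filter fun n => -(L : ℤ) < 2 * n ∧ 2 * n ≤ (L : ℤ)

/-- The momentum `k = (n₁/L) G₁ + (n₂/L) G₂`; the discretized Brillouin zone consists of these `k`
with `n₁, n₂ ∈ (-L/2, L/2]`. -/
def momentum (L : ℕ) (n : ℤ × ℤ) : Fin 2 → ℝ :=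
  ((n.1 : ℝ) / L) • G₁ + ((n.2 : ℝ) / L) • G₂

/-- `ψ̂_{k,ρ} = ∑ₓ e^{ik·x} ψ_{x,ρ}`. -/
def psiHat (k : Fin 2 → ℝ) (ρ : Fin 2) : FockOp (Mode L) :=
  ∑ x : Torus L, Complex.exp (Complex.I * ((k ⬝ᵥ position L x : ℝ) : ℂ)) • psi L x ρ

/-- The diagonal entry `Γ₁₁(k)` of the bare vertex function at zero momentum transfer,
`i`-th component. -/
def vertex₁₁ (i : Fin 2) (k : Fin 2 → ℝ) : ℂ :=
  -Complex.I * P.t₂ * ∑ j : Fin 3,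
    ((gam j i : ℂ) * Complex.exp (Complex.I * ((P.φ - k ⬝ᵥ gam j : ℝ) : ℂ))
      - (gam j i : ℂ) * Complex.exp (-(Complex.I * ((P.φ - k ⬝ᵥ gam j : ℝ) : ℂ))))

/-- The off-diagonal entry `Γ₁₂(k)` of the bare vertex function at zero momentum transfer,
`i`-th component. -/
def vertex₁₂ (i : Fin 2) (k : Fin 2 → ℝ) : ℂ :=
  -Complex.I * P.t₁ * ∑ j : Fin 3,
    (delta j i : ℂ) * Complex.exp (-(Complex.I * ((k ⬝ᵥ (delta j - delta 0) : ℝ) : ℂ)))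

/-- The bare vertex function `Γ(k)` at zero momentum transfer, `i`-th component. -/
def vertex (i : Fin 2) (k : Fin 2 → ℝ) : Matrix (Fin 2) (Fin 2) ℂ :=
  !![vertex₁₁ P i k, vertex₁₂ P i k; -vertex₁₂ P i (-k), -vertex₁₁ P i (-k)]

/-- The `i`-th component of the lattice current operator at zero momentum,
`J_i = L⁻² ∑_k ψ̂†_k Γ_i(k) ψ̂_k`. -/
def current (i : Fin 2) : FockOp (Mode L) :=
  (1 / (L : ℂ) ^ 2) • ∑ n ∈ zoneIndex L ×ˢ zoneIndex L, ∑ ρ : Fin 2, ∑ ρ' : Fin 2,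
    vertex P i (momentum L n) ρ ρ' •
      ((psiHat L (momentum L n) ρ)ᴴ * psiHat L (momentum L n) ρ')

/-- The Matsubara frequency `p_{0,β} = (2π/β) ⌊β p₀ / 2π⌋`. -/
def matsubara (β p₀ : ℝ) : ℝ := 2 * Real.pi / β * (⌊β * p₀ / (2 * Real.pi)⌋ : ℝ)

/-- The Euclidean current-current correlation at inverse temperature `β` and side `L`. -/
def correlation (i j : Fin 2) (β p₀ : ℝ) : ℂ :=
  1 / ((β : ℂ) * (L : ℂ) ^ 2) * ∫ t in (0 : ℝ)..β, ∫ s in (0 : ℝ)..β,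
    Complex.exp (-(Complex.I * (matsubara β p₀ : ℂ) * ((t - s : ℝ) : ℂ))) *
      (gibbs β (hamiltonian P L) (timeOrdered (hamiltonian P L) (current P L i) (current P L j) t s)
        - gibbs β (hamiltonian P L) (current P L i) * gibbs β (hamiltonian P L) (current P L j))

end Finite

/-- `K̂(p₀)` is the current-current correlation in the thermodynamic and zero-temperature limits
(first `L → ∞`, then `β → ∞`), both of which exist. -/
def IsLimitCorrelation (P : Params) (i j : Fin 2) (K : ℝ → ℂ) : Prop :=
  ∃ Kβ : ℝ → ℝ → ℂ,
    (∀ β : ℝ, 0 < β → ∀ p₀ : ℝ,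
      Tendsto (fun n : ℕ => correlation P (n + 1) i j β p₀) atTop (𝓝 (Kβ β p₀))) ∧
    ∀ p₀ : ℝ, Tendsto (fun β : ℝ => Kβ β p₀) atTop (𝓝 (K p₀))

/-- The Kubo conductivity `σ_{ij}` exists and equals `σ`: the limiting correlation `K̂_{ij}` exists,
and its left derivative at `p₀ = 0`, divided by the area of the unit cell, is `σ`. The indices
`1, 2` are written `0, 1`. -/
def HasKuboConductivity (P : Params) (i j : Fin 2) (σ : ℂ) : Prop :=
  ∃ K : ℝ → ℂ, IsLimitCorrelation P i j K ∧
    Tendsto (fun p₀ : ℝ => 1 / (cellArea : ℂ) * ((K p₀ - K 0) / (p₀ : ℂ))) (𝓝[<] 0) (𝓝 σ)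

end

end Haldane

/-! ### Canonical anticommutation relations -/

namespace Haldane

open Filter Topology Matrix

section FockCAR

variable {ι : Type} [Fintype ι] [LinearOrder ι]

/-! The system is quasi-free and translation invariant, so the many-body problem collapses to a 2×2
Bloch problem. The KMS property and the anticommutation relations give Wick's rule for quadratic
observables (`IsCAR.connected`), and plane waves make the Hamiltonian and the currents block
diagonal (`hamiltonian_eq`, `current_eq`). The correlation becomes a Riemann sum over the Brillouin
torus of a function that is continuous at positive temperature, even where the bands touch; hence
the limit L → ∞ is an integral (`tendsto_correlation`).

In the coordinates x = k·ℓ₁, y = k·ℓ₂, the reflection k₁ ↦ -k₁ is (x, y) ↦ (-y, -x). It transposes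
the Bloch Hamiltonian and the second current vertex, and transposes the first one up to a sign.
Since transposition reverses imaginary time, only the part odd in the frequency ω survives
integration. For a two-level Hamiltonian e₀ + X with X² = E² this part is proportional to Tr(X[Γ₁,
Γ₂]), which is a Berry curvature numerator q (`oddFiber_eq`). Write f = 1 + e^{ix} + e^{iy}. Since
|f| ≤ 3 and t₂/t₁ < 1/3, the Fermi level lies strictly between the bands off the gapless point
(`abs_blochShift_lt_gap`), and the Fermi functions tend to 1 and 0. The conductivity is then -1/2 ·
1/(4π² · cell area) times the total flux ∫ q/E³. The closing of the gap does no harm: q = O(E²), and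
1/E is bounded by a multiple of |u|^{-1/2}|v|^{-1/2} in the displacement (u, v) from the gapless
point, so one integrable majorant serves all the limits (`exists_curvature_majorant`).

The flux equals -3√3π by Stokes' theorem (`integral_curvature`). On the critical line the mass m is
nonnegative everywhere, so the connection -t₁² Im(f̄ df)/(E(E + m)) is regular off the gapless
point; at the other zero of f one has m = E > 0. Removing a thin horizontal strip around the gapless
point leaves only the fluxes through the two edges of the strip. Since t₁²|f|² = E² - m², the
connection is -(1 - m/E) d arg f. The terms containing m/E are bounded and have equal limits from
the two sides, while the integral of d arg f along a horizontal loop is 2π or 0 according to whether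
|1 + e^{iy}| is below or above 1 (`tendsto_integral_fluxY_sub`). At a zero of f with m ≠ 0 the
factor 1 - m/E would be 0 or 2; at the massless one the effective value is 1, and this is why the
conductivity is half a quantum. -/

theorem annihilation_apply (s : ι) (S T : Finset ι) :
    annihilation s S T =
      if s ∈ T ∧ S = T.erase s then (-1 : ℂ) ^ (T.filter (fun r => r < s)).card else 0 := rfl

theorem creation_apply (s : ι) (S T : Finset ι) :
    creation s S T =
      if s ∉ T ∧ S = insert s T then (-1 : ℂ) ^ (T.filter (fun r => r < s)).card else 0 := by
  rw [creation, conjTranspose_apply, annihilation_apply]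
  have h : (s ∈ S ∧ T = S.erase s) ↔ (s ∉ T ∧ S = insert s T) := by
    constructor
    · rintro ⟨h, rfl⟩
      simp [Finset.insert_erase h]
    · rintro ⟨h, rfl⟩
      simp [Finset.erase_insert h]
  by_cases hc : s ∉ T ∧ S = insert s T
  · rw [if_pos hc, if_pos (h.2 hc)]
    obtain ⟨hs, rfl⟩ := hc
    rw [Finset.filter_insert, if_neg (lt_irrefl s)]
    simp
  · rw [if_neg hc, if_neg (mt h.1 hc)]
    simp

/-- Each column of the annihilation matrix has at most one nonzero entry, so right multiplication
involves no sum. With this the anticommutation relations become a comparison of signs. -/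
theorem mul_annihilation_apply (M : FockOp ι) (s : ι) (S T : Finset ι) :
    (M * annihilation s) S T =
      if s ∈ T then M S (T.erase s) * (-1 : ℂ) ^ (T.filter (fun r => r < s)).card else 0 := by
  rw [Matrix.mul_apply, Finset.sum_eq_single (T.erase s)]
  · rw [annihilation_apply]; simp
  · intro U _ hU
    rw [annihilation_apply, if_neg (fun h => hU h.2), mul_zero]
  · simp

theorem mul_creation_apply (M : FockOp ι) (s : ι) (S T : Finset ι) :
    (M * creation s) S T =
      if s ∉ T then M S (insert s T) * (-1 : ℂ) ^ (T.filter (fun r => r < s)).card else 0 := by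
  rw [Matrix.mul_apply, Finset.sum_eq_single (insert s T)]
  · rw [creation_apply]; simp
  · intro U _ hU
    rw [creation_apply, if_neg (fun h => hU h.2), mul_zero]
  · simp

/-- Adding the mode r flips the sign attached to s exactly when r precedes s. This is the only
source of anticommutation. -/
theorem neg_one_pow_card_filter_insert {r s : ι} {T : Finset ι} (h : r ∉ T) :
    (-1 : ℂ) ^ ((insert r T).filter (fun q => q < s)).card =
      (if r < s then -1 else 1) * (-1 : ℂ) ^ (T.filter (fun q => q < s)).card := by
  rw [Finset.filter_insert]
  split_ifs
  · rw [Finset.card_insert_of_notMem (by simp [h]), pow_succ]; ring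
  · ring

theorem neg_one_pow_card_filter_erase {r s : ι} {T : Finset ι} (h : r ∈ T) :
    (-1 : ℂ) ^ ((T.erase r).filter (fun q => q < s)).card =
      (if r < s then -1 else 1) * (-1 : ℂ) ^ (T.filter (fun q => q < s)).card := by
  conv_rhs => rw [← Finset.insert_erase h, neg_one_pow_card_filter_insert (Finset.notMem_erase r T)]
  split_ifs <;> ring

/-- For r ≠ s exactly one of r < s and s < r holds, so exactly one of the two products picks up an
extra sign and they cancel. For r = s just one product is nonzero on a given state, and its sign is
squared. -/
theorem annihilation_mul_creation_add (r s : ι) :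
    annihilation r * creation s + creation s * annihilation r = if r = s then 1 else 0 := by
  ext S T
  rw [Matrix.add_apply, mul_annihilation_apply, mul_creation_apply, annihilation_apply,
    creation_apply]
  by_cases hrs : r = s
  · subst hrs
    rw [if_pos rfl, Matrix.one_apply]
    by_cases hT : r ∈ T
    · simp only [hT, not_true_eq_false, if_false, if_true, zero_add, Finset.notMem_erase,
        not_false_eq_true, true_and, Finset.insert_erase hT]
      rw [neg_one_pow_card_filter_erase hT, if_neg (lt_irrefl r)]
      split_ifs
      · rw [one_mul, ← mul_pow]; norm_num
      · ring
    · simp only [hT, not_false_eq_true, if_true, if_false, add_zero, Finset.mem_insert, true_or,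
        true_and, Finset.erase_insert hT]
      rw [neg_one_pow_card_filter_insert hT, if_neg (lt_irrefl r)]
      split_ifs
      · rw [one_mul, ← mul_pow]; norm_num
      · ring
  · have hsr : s ≠ r := Ne.symm hrs
    rw [if_neg hrs, Matrix.zero_apply]
    by_cases hr : r ∈ T
    · by_cases hs : s ∈ T
      · simp [hs, hr, hsr]
      · have e : (insert s T).erase r = insert s (T.erase r) := Finset.erase_insert_of_ne hsr
        simp only [hs, hr, hrs, hsr, e, not_false_eq_true, if_true, Finset.mem_insert, or_true,
          true_and, Finset.mem_erase, and_false, not_false_eq_true]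
        rw [neg_one_pow_card_filter_insert hs, neg_one_pow_card_filter_erase hr]
        rcases lt_or_gt_of_ne hrs with h | h
        · rw [if_pos h, if_neg (not_lt.2 h.le)]; split_ifs <;> ring
        · rw [if_pos h, if_neg (not_lt.2 h.le)]; split_ifs <;> ring
    · simp [hr, hrs]

theorem annihilation_mul_annihilation_add (r s : ι) :
    annihilation r * annihilation s + annihilation s * annihilation r = 0 := by
  ext S T
  rw [Matrix.add_apply, mul_annihilation_apply, mul_annihilation_apply, annihilation_apply,
    annihilation_apply, Matrix.zero_apply]
  by_cases hrs : r = s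
  · subst hrs; simp
  · have hsr : s ≠ r := Ne.symm hrs
    by_cases hr : r ∈ T
    · by_cases hs : s ∈ T
      · simp only [hs, hr, hrs, hsr, if_true, Finset.mem_erase, ne_eq, not_false_eq_true,
          true_and, Finset.erase_right_comm (a := s) (b := r)]
        rw [neg_one_pow_card_filter_erase hs, neg_one_pow_card_filter_erase hr]
        rcases lt_or_gt_of_ne hrs with h | h
        · rw [if_pos h, if_neg (not_lt.2 h.le)]; split_ifs <;> ring
        · rw [if_pos h, if_neg (not_lt.2 h.le)]; split_ifs <;> ring
      · simp [hs]
    · simp [hr]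

/-- A finite family of operators on the Fock space satisfying the canonical anticommutation
relations. -/
structure IsCAR {κ : Type} [DecidableEq κ] (a : κ → FockOp ι) : Prop where
  mul_conjTranspose_add : ∀ p q, a p * (a q)ᴴ + (a q)ᴴ * a p = if p = q then 1 else 0
  mul_add_mul : ∀ p q, a p * a q + a q * a p = 0

theorem isCAR_annihilation : IsCAR (annihilation : ι → FockOp ι) :=
  ⟨annihilation_mul_creation_add, annihilation_mul_annihilation_add⟩

namespace IsCAR

variable {κ : Type} [DecidableEq κ] {a : κ → FockOp ι}

theorem mul_conjTranspose (ha : IsCAR a) (p q : κ) :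
    a p * (a q)ᴴ = (if p = q then 1 else 0) - (a q)ᴴ * a p :=
  eq_sub_of_add_eq (ha.mul_conjTranspose_add p q)

theorem mul_comm_neg (ha : IsCAR a) (p q : κ) : a p * a q = -(a q * a p) :=
  eq_neg_of_add_eq_zero_left (ha.mul_add_mul p q)

theorem conjTranspose_mul_comm_neg (ha : IsCAR a) (p q : κ) :
    (a p)ᴴ * (a q)ᴴ = -((a q)ᴴ * (a p)ᴴ) := by
  rw [← conjTranspose_mul, ← conjTranspose_mul, ha.mul_comm_neg q p, conjTranspose_neg]

/-- Linear change of modes: a matrix with orthonormal columns preserves the anticommutation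
relations. -/
theorem linearCombination {κ' : Type} [DecidableEq κ'] [Fintype κ] (ha : IsCAR a)
    (U : Matrix κ κ' ℂ) (hU : Uᴴ * U = 1) :
    IsCAR (fun α => ∑ p, star (U p α) • a p) := by
  constructor
  · intro α β
    have h1 : ∀ p q, (star (U p α) • a p) * (U q β • (a q)ᴴ)
        + (U q β • (a q)ᴴ) * (star (U p α) • a p)
        = if p = q then (star (U p α) * U q β) • (1 : FockOp ι) else 0 := by
      intro p q
      rw [smul_mul_smul_comm, smul_mul_smul_comm, mul_comm (U q β), ← smul_add,
        ha.mul_conjTranspose_add]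
      split_ifs <;> simp
    simp only [conjTranspose_sum, conjTranspose_smul, star_star]
    rw [Finset.sum_mul_sum, Finset.sum_mul_sum, Finset.sum_comm (s := Finset.univ) (t := Finset.univ)
      (f := fun i j => (U i β • (a i)ᴴ) * (star (U j α) • a j)), ← Finset.sum_add_distrib]
    simp only [← Finset.sum_add_distrib, h1, Finset.sum_ite_eq, Finset.mem_univ, if_true]
    rw [← Finset.sum_smul]
    have h2 := congrFun (congrFun hU α) β
    rw [Matrix.mul_apply] at h2
    simp only [conjTranspose_apply] at h2
    rw [h2, Matrix.one_apply]
    split_ifs <;> simp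
  · intro α β
    have h1 : ∀ p q, (star (U p α) • a p) * (star (U q β) • a q)
        + (star (U q β) • a q) * (star (U p α) • a p) = 0 := by
      intro p q
      rw [smul_mul_smul_comm, smul_mul_smul_comm, mul_comm (star (U q β)), ← smul_add,
        ha.mul_add_mul, smul_zero]
    rw [Finset.sum_mul_sum, Finset.sum_mul_sum, Finset.sum_comm (s := Finset.univ) (t := Finset.univ)
      (f := fun i j => (star (U i β) • a i) * (star (U j α) • a j)), ← Finset.sum_add_distrib]
    simp only [← Finset.sum_add_distrib, h1, Finset.sum_const_zero]

end IsCAR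

end FockCAR

/-! ### Matrix exponentials and intertwiners -/

section Exp

variable {n : Type*} [Fintype n] [DecidableEq n]

open scoped Matrix.Norms.Operator in
-- The relation passes to all powers, hence to the exponential series term by term. All commutation
-- of exponentials with fermionic operators rests on this.
theorem exp_mul_of_intertwine {X Y C : Matrix n n ℂ} (h : X * C = C * Y) :
    NormedSpace.exp X * C = C * NormedSpace.exp Y := by
  have hp : ∀ k : ℕ, X ^ k * C = C * Y ^ k := by
    intro k
    induction k with
    | zero => simp
    | succ k ih => rw [pow_succ, mul_assoc, h, ← mul_assoc, ih, mul_assoc, ← pow_succ]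
  have h1 := (NormedSpace.exp_series_hasSum_exp' (𝕂 := ℂ) X).mul_right C
  have h2 := (NormedSpace.exp_series_hasSum_exp' (𝕂 := ℂ) Y).mul_left C
  have h3 : (fun k : ℕ => (((k.factorial : ℂ))⁻¹ • X ^ k) * C)
      = fun k : ℕ => C * (((k.factorial : ℂ))⁻¹ • Y ^ k) := by
    funext k
    rw [smul_mul_assoc, mul_smul_comm, hp]
  rw [h3] at h1
  exact h1.unique h2

theorem exp_smul_one (c : ℂ) :
    NormedSpace.exp (c • (1 : Matrix n n ℂ)) = Complex.exp c • (1 : Matrix n n ℂ) := by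
  rw [Matrix.smul_one_eq_diagonal, Matrix.exp_diagonal, Matrix.smul_one_eq_diagonal]
  congr 1
  ext i
  rw [Pi.coe_exp, Complex.exp_eq_exp_ℂ]

theorem exp_add_smul_one (X : Matrix n n ℂ) (c : ℂ) :
    NormedSpace.exp (X + c • 1) = Complex.exp c • NormedSpace.exp X := by
  rw [Matrix.exp_add_of_commute _ _ ((Commute.one_right X).smul_right c), exp_smul_one,
    mul_smul_comm, mul_one]

/-- An operator shifting the "energy" `X` by `c` shifts exponentials of `X` multiplicatively. -/
theorem exp_smul_mul_of_shift {X C : Matrix n n ℂ} {c : ℂ} (h : X * C = C * (X + c • 1)) (t : ℂ) :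
    NormedSpace.exp (t • X) * C = Complex.exp (t * c) • (C * NormedSpace.exp (t • X)) := by
  have h' : (t • X) * C = C * (t • X + (t * c) • 1) := by
    rw [smul_mul_assoc, h, ← mul_smul_comm, smul_add, smul_smul]
  rw [exp_mul_of_intertwine h', exp_add_smul_one, mul_smul_comm]

theorem exp_mul_exp_neg (X : Matrix n n ℂ) : NormedSpace.exp X * NormedSpace.exp (-X) = 1 := by
  rw [← Matrix.exp_add_of_commute _ _ (Commute.neg_right (Commute.refl X)), add_neg_cancel,
    NormedSpace.exp_zero]

open scoped ComplexOrder in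
-- The exponential is B*B with B = exp(X/2), so a vanishing trace would force B = 0, contradicting
-- the invertibility of B.
theorem trace_exp_ne_zero [Nonempty n] {X : Matrix n n ℂ} (hX : X.IsHermitian) :
    Matrix.trace (NormedSpace.exp X) ≠ 0 := by
  have h2 : NormedSpace.exp X =
      (NormedSpace.exp ((1 / 2 : ℂ) • X))ᴴ * NormedSpace.exp ((1 / 2 : ℂ) • X) := by
    rw [← Matrix.exp_conjTranspose, conjTranspose_smul, hX.eq,
      show star (1 / 2 : ℂ) = 1 / 2 by simp,
      ← Matrix.exp_add_of_commute _ _ (Commute.refl _), ← add_smul]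
    norm_num
  intro h
  rw [h2] at h
  have h3 := trace_conjTranspose_mul_self_eq_zero_iff.1 h
  have h4 := exp_mul_exp_neg ((1 / 2 : ℂ) • X)
  rw [h3, zero_mul] at h4
  exact zero_ne_one h4

end Exp

/-! ### Thermal expectations -/

section Thermal

variable {ι : Type} [Fintype ι] [LinearOrder ι]

theorem gibbs_add (β : ℝ) (H A B : FockOp ι) :
    gibbs β H (A + B) = gibbs β H A + gibbs β H B := by
  simp only [gibbs, mul_add, trace_add, add_div]

theorem gibbs_smul (β : ℝ) (H A : FockOp ι) (c : ℂ) :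
    gibbs β H (c • A) = c * gibbs β H A := by
  simp only [gibbs, mul_smul_comm, trace_smul, smul_eq_mul, mul_div_assoc]

theorem gibbs_sub (β : ℝ) (H A B : FockOp ι) :
    gibbs β H (A - B) = gibbs β H A - gibbs β H B := by
  simp only [gibbs, mul_sub, trace_sub, sub_div]

theorem gibbs_sum {κ : Type} (s : Finset κ) (β : ℝ) (H : FockOp ι) (A : κ → FockOp ι) :
    gibbs β H (∑ k ∈ s, A k) = ∑ k ∈ s, gibbs β H (A k) := by
  simp only [gibbs, Finset.mul_sum, trace_sum, Finset.sum_div]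

theorem gibbs_one {β : ℝ} {H : FockOp ι} (hH : H.IsHermitian) : gibbs β H 1 = 1 := by
  rw [gibbs, mul_one, div_self]
  refine trace_exp_ne_zero ?_
  rw [Matrix.IsHermitian, conjTranspose_smul, hH.eq]
  simp

/-- The KMS condition for an operator of definite energy. -/
theorem gibbs_mul_comm_of_shift {H C : FockOp ι} {c : ℂ} (h : H * C = C * (H + c • 1)) (β : ℝ)
    (X : FockOp ι) : gibbs β H (C * X) = Complex.exp (-(β * c)) * gibbs β H (X * C) := by
  rw [gibbs, ← mul_assoc, exp_smul_mul_of_shift h, smul_mul_assoc, trace_smul, mul_assoc,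
    trace_mul_comm C, mul_assoc, smul_eq_mul, gibbs, mul_div_assoc, neg_mul]

variable {κ : Type} [DecidableEq κ] [Fintype κ] {a : κ → FockOp ι}

/-- The second quantization `∑ M_{pq} a†_p a_q` of a one-particle operator. -/
noncomputable def quad (a : κ → FockOp ι) (M : Matrix κ κ ℂ) : FockOp ι :=
  ∑ p, ∑ q, M p q • ((a p)ᴴ * a q)

theorem quad_add (a : κ → FockOp ι) (M N : Matrix κ κ ℂ) :
    quad a (M + N) = quad a M + quad a N := by
  simp only [quad, Matrix.add_apply, add_smul, Finset.sum_add_distrib]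

theorem quad_smul (a : κ → FockOp ι) (c : ℂ) (M : Matrix κ κ ℂ) :
    quad a (c • M) = c • quad a M := by
  simp only [quad, Matrix.smul_apply, smul_assoc, Finset.smul_sum]

theorem quad_sub (a : κ → FockOp ι) (M N : Matrix κ κ ℂ) :
    quad a (M - N) = quad a M - quad a N := by
  simp only [quad, Matrix.sub_apply, sub_smul, Finset.sum_sub_distrib]

theorem quad_conjTranspose (a : κ → FockOp ι) (M : Matrix κ κ ℂ) :
    (quad a M)ᴴ = quad a Mᴴ := by
  simp only [quad, conjTranspose_sum, conjTranspose_smul, conjTranspose_mul,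
    conjTranspose_conjTranspose, conjTranspose_apply]
  rw [Finset.sum_comm]

theorem quad_diagonal (a : κ → FockOp ι) (e : κ → ℂ) :
    quad a (diagonal e) = ∑ p, e p • ((a p)ᴴ * a p) := by
  simp only [quad, Matrix.diagonal_apply, ite_smul, zero_smul, Finset.sum_ite_eq,
    Finset.mem_univ, if_true]

theorem _root_.Finset.sum_comm_cycle₃ {α β γ M : Type*} [AddCommMonoid M] (s : Finset α)
    (t : Finset β) (u : Finset γ) (F : α → β → γ → M) :
    ∑ x ∈ s, ∑ y ∈ t, ∑ z ∈ u, F x y z = ∑ y ∈ t, ∑ z ∈ u, ∑ x ∈ s, F x y z := by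
  rw [Finset.sum_comm]
  exact Finset.sum_congr rfl fun y _ => Finset.sum_comm

theorem quad_linearCombination {κ' : Type} [Fintype κ'] [DecidableEq κ'] (a : κ → FockOp ι)
    (U : Matrix κ κ' ℂ) (M : Matrix κ' κ' ℂ) :
    quad (fun α => ∑ p, star (U p α) • a p) M = quad a (U * M * Uᴴ) := by
  have h1 : ∀ α β, M α β • ((∑ p, star (U p α) • a p)ᴴ * ∑ q, star (U q β) • a q)
      = ∑ p, ∑ q, (U p α * M α β * star (U q β)) • ((a p)ᴴ * a q) := by
    intro α β
    simp only [conjTranspose_sum, conjTranspose_smul, star_star, Finset.sum_mul_sum,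
      Finset.smul_sum, smul_mul_smul_comm, smul_smul]
    refine Finset.sum_congr rfl fun p _ => Finset.sum_congr rfl fun q _ => ?_
    congr 1
    ring
  have h2 : ∀ p q, (U * M * Uᴴ) p q • ((a p)ᴴ * a q)
      = ∑ β, ∑ α, (U p α * M α β * star (U q β)) • ((a p)ᴴ * a q) := by
    intro p q
    simp only [Matrix.mul_apply, conjTranspose_apply, Finset.sum_mul, Finset.sum_smul]
  simp only [quad, h1, h2]
  refine Finset.sum_comm.trans (Eq.trans ?_ (Finset.sum_comm_cycle₃ _ _ _
    fun β p q => ∑ α, (U p α * M α β * star (U q β)) • ((a p)ᴴ * a q)))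
  exact Finset.sum_congr rfl fun β _ => Finset.sum_comm_cycle₃ _ _ _ _

namespace IsCAR

/-- Every number operator with p ≠ r commutes with the creation operator of r, and the one with p =
r contributes the energy e r. Creation operators are therefore energy shifts, to which the KMS
identity applies. -/
theorem quad_diagonal_mul_conjTranspose (ha : IsCAR a) (e : κ → ℂ) (r : κ) :
    quad a (diagonal e) * (a r)ᴴ = (a r)ᴴ * (quad a (diagonal e) + e r • 1) := by
  have h : ∀ p, (e p • ((a p)ᴴ * a p)) * (a r)ᴴ
      = (if p = r then e r • (a r)ᴴ else 0) + (a r)ᴴ * (e p • ((a p)ᴴ * a p)) := by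
    intro p
    rw [smul_mul_assoc, mul_assoc, ha.mul_conjTranspose, mul_sub, ← mul_assoc,
      ha.conjTranspose_mul_comm_neg p r, neg_mul, sub_neg_eq_add, smul_add, mul_smul_comm, mul_assoc]
    split_ifs with hp
    · rw [hp, mul_one]
    · rw [mul_zero, smul_zero]
  rw [quad_diagonal, Finset.sum_mul, Finset.sum_congr rfl (fun p _ => h p), Finset.sum_add_distrib,
    Finset.sum_ite_eq' Finset.univ r, if_pos (Finset.mem_univ r), mul_add, Finset.mul_sum,
    mul_smul_comm, mul_one, add_comm]

theorem quad_diagonal_mul (ha : IsCAR a) (e : κ → ℂ) (r : κ) :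
    quad a (diagonal e) * a r = a r * (quad a (diagonal e) + (-e r) • 1) := by
  have h : ∀ p, (e p • ((a p)ᴴ * a p)) * a r
      = (if p = r then -(e r • a r) else 0) + a r * (e p • ((a p)ᴴ * a p)) := by
    intro p
    have h1 : (a p)ᴴ * a r = (if r = p then 1 else 0) - a r * (a p)ᴴ := by
      rw [ha.mul_conjTranspose]; abel
    rw [smul_mul_assoc, mul_assoc, ha.mul_comm_neg p r, mul_neg, ← mul_assoc, h1, sub_mul, neg_sub,
      smul_sub, mul_smul_comm, ← mul_assoc]
    by_cases hp : p = r
    · subst hp; simp; abel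
    · rw [if_neg hp, if_neg (Ne.symm hp)]; simp
  rw [quad_diagonal, Finset.sum_mul, Finset.sum_congr rfl (fun p _ => h p), Finset.sum_add_distrib,
    Finset.sum_ite_eq' Finset.univ r, if_pos (Finset.mem_univ r), mul_add, Finset.mul_sum,
    mul_smul_comm, mul_one, add_comm, neg_smul]

theorem quad_diagonal_mul_pair (ha : IsCAR a) (e : κ → ℂ) (p q : κ) :
    quad a (diagonal e) * ((a p)ᴴ * a q)
      = ((a p)ᴴ * a q) * (quad a (diagonal e) + (e p - e q) • 1) := by
  rw [← mul_assoc, ha.quad_diagonal_mul_conjTranspose, mul_assoc, add_mul, ha.quad_diagonal_mul,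
    smul_mul_assoc, one_mul, mul_assoc]
  congr 1
  rw [mul_add, mul_add, sub_smul, mul_sub, mul_smul_comm, mul_smul_comm, mul_smul_comm, mul_one,
    neg_smul]
  abel

theorem evolve_quad_diagonal (ha : IsCAR a) (e : κ → ℂ) (A : Matrix κ κ ℂ) (t : ℝ) :
    evolve (quad a (diagonal e)) (quad a A) t
      = quad a (Matrix.of fun p q => Complex.exp (t * (e p - e q)) * A p q) := by
  have h : ∀ p q, NormedSpace.exp ((t : ℂ) • quad a (diagonal e)) * ((a p)ᴴ * a q)
        * NormedSpace.exp (-(t : ℂ) • quad a (diagonal e))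
      = Complex.exp (t * (e p - e q)) • ((a p)ᴴ * a q) := by
    intro p q
    rw [exp_smul_mul_of_shift (ha.quad_diagonal_mul_pair e p q), smul_mul_assoc,
      mul_assoc _ (NormedSpace.exp _), neg_smul, exp_mul_exp_neg, mul_one]
  generalize hH : quad a (diagonal e) = H at h ⊢
  rw [evolve, quad, quad]
  simp only [Finset.mul_sum, Finset.sum_mul, mul_smul_comm, smul_mul_assoc, h, Matrix.of_apply,
    smul_smul]
  simp only [mul_comm]

/-- The Fermi function. -/
noncomputable def _root_.Haldane.fermi (β e : ℝ) : ℝ := 1 / (1 + Real.exp (β * e))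

theorem quad_diagonal_isHermitian (a : κ → FockOp ι) (e : κ → ℝ) :
    (quad a (diagonal fun p => (e p : ℂ))).IsHermitian := by
  rw [Matrix.IsHermitian, quad_conjTranspose, diagonal_conjTranspose]
  congr 2
  ext p
  simp

/-- If `G = e^{-βe} (D - G)` then `G = n D` with `n` the Fermi function. -/
theorem _root_.Haldane.eq_fermi_mul {β e : ℝ} {G D : ℂ}
    (h : G = Complex.exp (-(β * e : ℂ)) * (D - G)) : G = fermi β e * D := by
  have h1 : (1 + Complex.exp (β * e)) ≠ 0 := by
    have : (1 + Complex.exp (β * e)) = ((1 + Real.exp (β * e) : ℝ) : ℂ) := by push_cast; rfl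
    rw [this]
    exact_mod_cast (by positivity : (1 + Real.exp (β * e)) ≠ 0)
  have h2 : Complex.exp (β * e) * Complex.exp (-(β * e)) = 1 := by
    rw [← Complex.exp_add]; simp
  rw [fermi]
  push_cast
  field_simp
  linear_combination (Complex.exp (β * e)) * h + (D - G) * h2

variable {e : κ → ℝ}

/-- Moving the creation operator around the trace by KMS and back by anticommutation yields a linear
equation for the expectation, solved by the Fermi function. -/
theorem gibbs_pair (ha : IsCAR a) (e : κ → ℝ) (β : ℝ) (p q : κ) :
    gibbs β (quad a (diagonal fun p => (e p : ℂ))) ((a p)ᴴ * a q)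
      = fermi β (e p) * (if p = q then 1 else 0) := by
  apply eq_fermi_mul
  conv_lhs => rw [gibbs_mul_comm_of_shift (ha.quad_diagonal_mul_conjTranspose _ p),
    ha.mul_conjTranspose, gibbs_sub]
  congr 2
  by_cases h : p = q
  · rw [if_pos h, if_pos h.symm, gibbs_one (quad_diagonal_isHermitian a e)]
  · rw [if_neg h, if_neg (Ne.symm h)]
    simp [gibbs]

theorem gibbs_pair' (ha : IsCAR a) (e : κ → ℝ) (β : ℝ) (p q : κ) :
    gibbs β (quad a (diagonal fun p => (e p : ℂ))) (a q * (a p)ᴴ)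
      = (1 - fermi β (e p)) * (if p = q then 1 else 0) := by
  rw [ha.mul_conjTranspose, gibbs_sub, ha.gibbs_pair]
  by_cases h : p = q
  · rw [if_pos h, if_pos h.symm, gibbs_one (quad_diagonal_isHermitian a e)]
    ring
  · rw [if_neg h, if_neg (Ne.symm h)]
    simp [gibbs]

/-- Wick's rule for the four-point function. -/
theorem gibbs_pair_mul_pair (ha : IsCAR a) (e : κ → ℝ) (β : ℝ) (p q r s : κ) :
    gibbs β (quad a (diagonal fun p => (e p : ℂ))) (((a p)ᴴ * a q) * ((a r)ᴴ * a s))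
      = fermi β (e p) * ((if p = s then (1 - fermi β (e r) : ℂ) * (if r = q then 1 else 0) else 0)
        + (if p = q then (fermi β (e r) : ℂ) * (if r = s then 1 else 0) else 0)) := by
  apply eq_fermi_mul
  -- KMS has moved the creation operator of p to the right end. Carrying it back past three
  -- operators costs a minus sign and produces one contraction with `a s` and one with `a q`.
  have key : (a q * ((a r)ᴴ * a s)) * (a p)ᴴ
      = (if p = s then (1 : ℂ) else 0) • (a q * (a r)ᴴ)
        + (if p = q then (1 : ℂ) else 0) • ((a r)ᴴ * a s)
        - ((a p)ᴴ * a q) * ((a r)ᴴ * a s) := by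
    have e1 : (a q * ((a r)ᴴ * a s)) * (a p)ᴴ
        = (if p = s then (1 : ℂ) else 0) • (a q * (a r)ᴴ)
          + (a q * (a p)ᴴ) * ((a r)ᴴ * a s) := by
      rw [mul_assoc, mul_assoc, ha.mul_conjTranspose s p, mul_sub, ← mul_assoc (a r)ᴴ (a p)ᴴ,
        ha.conjTranspose_mul_comm_neg r p, neg_mul, sub_neg_eq_add, mul_add]
      congr 1
      · by_cases h : p = s
        · rw [if_pos h, if_pos h.symm, mul_one, one_smul]
        · rw [if_neg h, if_neg (Ne.symm h), mul_zero, mul_zero, zero_smul]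
      · simp only [mul_assoc]
    rw [e1, ha.mul_conjTranspose q p, sub_mul, add_sub_assoc]
    congr 2
    by_cases h : p = q
    · rw [if_pos h, if_pos h.symm, one_mul, one_smul]
    · rw [if_neg h, if_neg (Ne.symm h), zero_mul, zero_smul]
  conv_lhs => rw [mul_assoc, gibbs_mul_comm_of_shift (ha.quad_diagonal_mul_conjTranspose _ p), key,
    gibbs_sub, gibbs_add, gibbs_smul, gibbs_smul, ha.gibbs_pair, ha.gibbs_pair']
  congr 3
  · split_ifs <;> simp
  · split_ifs <;> simp

theorem gibbs_quad (ha : IsCAR a) (e : κ → ℝ) (β : ℝ) (A : Matrix κ κ ℂ) :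
    gibbs β (quad a (diagonal fun p => (e p : ℂ))) (quad a A) = ∑ p, A p p * fermi β (e p) := by
  have h := ha.gibbs_pair e β
  generalize quad a (diagonal fun p => (e p : ℂ)) = H at h ⊢
  rw [quad, gibbs_sum]
  refine Finset.sum_congr rfl fun p _ => ?_
  simp only [gibbs_sum, gibbs_smul, h, mul_ite, mul_one, mul_zero, Finset.sum_ite_eq,
    Finset.mem_univ, if_true]

/-- The second summand is the disconnected part, which the truncated correlation subtracts. -/
theorem gibbs_quad_mul_quad (ha : IsCAR a) (e : κ → ℝ) (β : ℝ) (A B : Matrix κ κ ℂ) :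
    gibbs β (quad a (diagonal fun p => (e p : ℂ))) (quad a A * quad a B)
      = (∑ p, ∑ q, A p q * B q p * (fermi β (e p) * (1 - fermi β (e q))))
        + (∑ p, A p p * fermi β (e p)) * ∑ p, B p p * fermi β (e p) := by
  have h1 : quad a A * quad a B = ∑ p, ∑ q, ∑ r, ∑ s,
      (A p q * B r s) • (((a p)ᴴ * a q) * ((a r)ᴴ * a s)) := by
    simp only [quad, Finset.sum_mul_sum, smul_mul_smul_comm]
    exact Finset.sum_congr rfl fun p _ => Finset.sum_comm
  simp only [h1, gibbs_sum, gibbs_smul, ha.gibbs_pair_mul_pair, mul_add, Finset.sum_add_distrib]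
  congr 1
  · refine Finset.sum_congr rfl fun p _ => Finset.sum_congr rfl fun q _ => ?_
    simp only [mul_ite, mul_one, mul_zero, Finset.sum_ite_eq, Finset.sum_ite_eq', Finset.mem_univ,
      if_true]
  · rw [Finset.sum_mul]
    refine Finset.sum_congr rfl fun p _ => ?_
    rw [Finset.sum_comm, Finset.mul_sum]
    refine Finset.sum_congr rfl fun r _ => ?_
    have h2 : ∀ q, (∑ s, A p q * B r s * (fermi β (e p) *
        (if p = q then (fermi β (e r) : ℂ) * (if r = s then 1 else 0) else 0)))
        = if p = q then A p q * B r r * (fermi β (e p) * fermi β (e r)) else 0 := by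
      intro q
      by_cases h : p = q
      · simp only [h, if_true, mul_ite, mul_one, mul_zero, Finset.sum_ite_eq, Finset.mem_univ]
      · simp only [h, if_false, mul_zero, Finset.sum_const_zero]
    simp only [h2, Finset.sum_ite_eq, Finset.mem_univ, if_true]
    ring

end IsCAR

end Thermal

/-! ### Wick's rule for density-like observables, in matrix form -/

section Bubble

variable {κ : Type} [Fintype κ] [DecidableEq κ]

/-- The one-particle Fermi-Dirac density matrix `(1 + e^{βh})⁻¹`. -/
noncomputable def fermiMatrix (β : ℝ) (h : Matrix κ κ ℂ) : Matrix κ κ ℂ :=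
  (1 + NormedSpace.exp ((β : ℂ) • h))⁻¹

/-- The propagator of a hole. -/
noncomputable def holeProp (β : ℝ) (h : Matrix κ κ ℂ) (τ : ℝ) : Matrix κ κ ℂ :=
  NormedSpace.exp (((-τ : ℝ) : ℂ) • h) * (1 - fermiMatrix β h)

/-- The propagator of a particle. -/
noncomputable def partProp (β : ℝ) (h : Matrix κ κ ℂ) (τ : ℝ) : Matrix κ κ ℂ :=
  NormedSpace.exp ((τ : ℂ) • h) * fermiMatrix β h

/-- The one-loop contribution to a two-point function of one-particle observables. -/
noncomputable def bubble (β : ℝ) (h A B : Matrix κ κ ℂ) (τ : ℝ) : ℂ :=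
  Matrix.trace (A * holeProp β h τ * B * partProp β h τ)

theorem exp_smul_diagonal (e : κ → ℝ) (c : ℝ) :
    NormedSpace.exp ((c : ℂ) • diagonal fun p => (e p : ℂ))
      = diagonal fun p => ((Real.exp (c * e p) : ℝ) : ℂ) := by
  rw [← diagonal_smul, exp_diagonal]
  congr 1
  ext p
  rw [Pi.coe_exp, ← Complex.exp_eq_exp_ℂ]
  simp

theorem fermiMatrix_diagonal (β : ℝ) (e : κ → ℝ) :
    fermiMatrix β (diagonal fun p => (e p : ℂ)) = diagonal fun p => ((fermi β (e p) : ℝ) : ℂ) := by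
  rw [fermiMatrix, exp_smul_diagonal]
  apply inv_eq_right_inv
  rw [← diagonal_one, diagonal_add, diagonal_mul_diagonal]
  congr 1
  ext p
  have : (1 + Real.exp (β * e p)) ≠ 0 := by positivity
  rw [fermi]
  norm_cast
  field_simp

theorem bubble_diagonal (β : ℝ) (e : κ → ℝ) (A B : Matrix κ κ ℂ) (τ : ℝ) :
    bubble β (diagonal fun p => (e p : ℂ)) A B τ
      = ∑ p, ∑ q, A p q * B q p * (Complex.exp (τ * (e p - e q)) *
          (fermi β (e p) * (1 - fermi β (e q)))) := by
  rw [bubble, holeProp, partProp, fermiMatrix_diagonal, exp_smul_diagonal, exp_smul_diagonal,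
    ← diagonal_one, diagonal_sub, diagonal_mul_diagonal, diagonal_mul_diagonal, trace]
  refine Finset.sum_congr rfl fun p _ => ?_
  rw [diag_apply, mul_diagonal, Matrix.mul_apply, Finset.sum_mul]
  refine Finset.sum_congr rfl fun q _ => ?_
  rw [mul_diagonal]
  have : Complex.exp (τ * (e p - e q)) = Complex.exp (-τ * e q) * Complex.exp (τ * e p) := by
    rw [← Complex.exp_add]; congr 1; ring
  rw [this]
  push_cast
  ring

theorem exp_smul_conj {U : Matrix κ κ ℂ} (hU : Uᴴ * U = 1) (X : Matrix κ κ ℂ) (c : ℂ) :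
    NormedSpace.exp (c • (U * X * Uᴴ)) = U * NormedSpace.exp (c • X) * Uᴴ := by
  have hU' : U * Uᴴ = 1 := mul_eq_one_comm.1 hU
  rw [← exp_mul_of_intertwine (X := c • (U * X * Uᴴ)), mul_assoc (NormedSpace.exp _), hU', mul_one]
  rw [smul_mul_assoc, mul_assoc _ Uᴴ, hU, mul_one, mul_smul_comm]

theorem fermiMatrix_conj {U : Matrix κ κ ℂ} (hU : Uᴴ * U = 1) (β : ℝ) (h : Matrix κ κ ℂ) :
    fermiMatrix β (U * h * Uᴴ) = U * fermiMatrix β h * Uᴴ := by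
  have hU' : U * Uᴴ = 1 := mul_eq_one_comm.1 hU
  have h1 : 1 + U * NormedSpace.exp ((β : ℂ) • h) * Uᴴ
      = U * (1 + NormedSpace.exp ((β : ℂ) • h)) * Uᴴ := by
    rw [mul_add, add_mul, mul_one, hU']
  rw [fermiMatrix, exp_smul_conj hU, h1, fermiMatrix, Matrix.mul_inv_rev, Matrix.mul_inv_rev,
    inv_eq_right_inv hU, inv_eq_right_inv hU', mul_assoc]

/-- Basis independence of the bubble: it carries Wick's rule from diagonal to arbitrary Hermitian
one-particle Hamiltonians. -/
theorem bubble_conj {U : Matrix κ κ ℂ} (hU : Uᴴ * U = 1) (β : ℝ) (h A B : Matrix κ κ ℂ) (τ : ℝ) :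
    bubble β (U * h * Uᴴ) (U * A * Uᴴ) (U * B * Uᴴ) τ = bubble β h A B τ := by
  have hU' : U * Uᴴ = 1 := mul_eq_one_comm.1 hU
  have key : ∀ X Y : Matrix κ κ ℂ, (U * X * Uᴴ) * (U * Y * Uᴴ) = U * (X * Y) * Uᴴ := by
    intro X Y
    rw [mul_assoc (U * X), ← mul_assoc Uᴴ, ← mul_assoc Uᴴ, hU, one_mul]
    simp only [mul_assoc]
  have h1 : 1 - U * fermiMatrix β h * Uᴴ = U * (1 - fermiMatrix β h) * Uᴴ := by
    rw [mul_sub, sub_mul, mul_one, hU']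
  rw [bubble, holeProp, partProp, fermiMatrix_conj hU, exp_smul_conj hU, exp_smul_conj hU, h1]
  simp only [key]
  rw [trace_mul_comm, ← mul_assoc, hU, one_mul]
  rfl

variable {ι : Type} [Fintype ι] [LinearOrder ι] {a : κ → FockOp ι}

theorem IsCAR.connected_diagonal (ha : IsCAR a) (e : κ → ℝ) (A B : Matrix κ κ ℂ) (β t s : ℝ) :
    gibbs β (quad a (diagonal fun p => (e p : ℂ)))
        (evolve (quad a (diagonal fun p => (e p : ℂ))) (quad a A) t
          * evolve (quad a (diagonal fun p => (e p : ℂ))) (quad a B) s)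
      - gibbs β (quad a (diagonal fun p => (e p : ℂ))) (quad a A)
        * gibbs β (quad a (diagonal fun p => (e p : ℂ))) (quad a B)
      = bubble β (diagonal fun p => (e p : ℂ)) A B (t - s) := by
  rw [ha.evolve_quad_diagonal, ha.evolve_quad_diagonal, ha.gibbs_quad_mul_quad, ha.gibbs_quad,
    ha.gibbs_quad, bubble_diagonal]
  simp only [Matrix.of_apply, sub_self, mul_zero, Complex.exp_zero, one_mul]
  rw [add_sub_cancel_right]
  refine Finset.sum_congr rfl fun p _ => Finset.sum_congr rfl fun q _ => ?_
  have : Complex.exp ((t - s : ℝ) * (e p - e q))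
      = Complex.exp (t * (e p - e q)) * Complex.exp (s * (e q - e p)) := by
    rw [← Complex.exp_add]; congr 1; push_cast; ring
  rw [this]
  ring

/-- Wick's rule: the connected thermal two-point function of two quadratic observables. -/
theorem IsCAR.connected (ha : IsCAR a) {h : Matrix κ κ ℂ} (hh : h.IsHermitian)
    (A B : Matrix κ κ ℂ) (β t s : ℝ) :
    gibbs β (quad a h) (evolve (quad a h) (quad a A) t * evolve (quad a h) (quad a B) s)
      - gibbs β (quad a h) (quad a A) * gibbs β (quad a h) (quad a B)
      = bubble β h A B (t - s) := by
  set U : Matrix κ κ ℂ := (hh.eigenvectorUnitary : Matrix κ κ ℂ) with hUdef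
  have hU : Uᴴ * U = 1 := Unitary.coe_star_mul_self hh.eigenvectorUnitary
  have hU' : U * Uᴴ = 1 := mul_eq_one_comm.1 hU
  have hspec : h = U * (diagonal fun p => (hh.eigenvalues p : ℂ)) * Uᴴ := by
    conv_lhs => rw [hh.spectral_theorem, Unitary.conjStarAlgAut_apply]
    rfl
  have hconj : ∀ X : Matrix κ κ ℂ, X = U * (Uᴴ * X * U) * Uᴴ := by
    intro X
    rw [mul_assoc Uᴴ, ← mul_assoc U, hU', one_mul, mul_assoc, hU', mul_one]
  have hb := ha.linearCombination U hU
  have := hb.connected_diagonal hh.eigenvalues (Uᴴ * A * U) (Uᴴ * B * U) β t s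
  rw [quad_linearCombination, quad_linearCombination, quad_linearCombination, ← hspec, ← hconj,
    ← hconj] at this
  rw [this, ← bubble_conj hU, ← hspec, ← hconj, ← hconj]

theorem isUnit_det_one_add_exp {h : Matrix κ κ ℂ} (hh : h.IsHermitian) (β : ℝ) :
    IsUnit (1 + NormedSpace.exp ((β : ℂ) • h)).det := by
  set U : Matrix κ κ ℂ := (hh.eigenvectorUnitary : Matrix κ κ ℂ) with hUdef
  have hU : Uᴴ * U = 1 := Unitary.coe_star_mul_self hh.eigenvectorUnitary
  have hU' : U * Uᴴ = 1 := mul_eq_one_comm.1 hU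
  have hspec : h = U * (diagonal fun p => (hh.eigenvalues p : ℂ)) * Uᴴ := by
    conv_lhs => rw [hh.spectral_theorem, Unitary.conjStarAlgAut_apply]
    rfl
  have h1 : 1 + NormedSpace.exp ((β : ℂ) • h) = U * (1 + NormedSpace.exp ((β : ℂ) •
      diagonal fun p => (hh.eigenvalues p : ℂ))) * Uᴴ := by
    conv_lhs => rw [hspec, exp_smul_conj hU]
    rw [mul_add, add_mul, mul_one, hU']
  rw [h1, exp_smul_diagonal, ← diagonal_one, diagonal_add, det_mul_right_comm, hU', one_mul,
    det_diagonal, isUnit_iff_ne_zero, Finset.prod_ne_zero_iff]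
  intro p _
  exact_mod_cast (by positivity : (1 + Real.exp (β * hh.eigenvalues p)) ≠ 0)

theorem exp_mul_fermiMatrix {h : Matrix κ κ ℂ} (hh : h.IsHermitian) (β : ℝ) :
    NormedSpace.exp ((β : ℂ) • h) * fermiMatrix β h = 1 - fermiMatrix β h := by
  have := Matrix.mul_nonsing_inv _ (isUnit_det_one_add_exp hh β)
  rw [fermiMatrix]
  rw [add_mul, one_mul] at this
  exact eq_sub_of_add_eq' this

theorem exp_smul_mul_exp_smul (h : Matrix κ κ ℂ) (x y : ℂ) :
    NormedSpace.exp (x • h) * NormedSpace.exp (y • h) = NormedSpace.exp ((x + y) • h) := by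
  rw [add_smul, Matrix.exp_add_of_commute _ _ (((Commute.refl h).smul_left x).smul_right y)]

/-- The Kubo-Martin-Schwinger relation between the two propagators. -/
theorem partProp_eq_holeProp {h : Matrix κ κ ℂ} (hh : h.IsHermitian) (β τ : ℝ) :
    partProp β h τ = holeProp β h (β - τ) := by
  rw [partProp, holeProp, ← exp_mul_fermiMatrix hh, ← mul_assoc, exp_smul_mul_exp_smul]
  congr 3
  push_cast
  ring

theorem holeProp_eq_partProp {h : Matrix κ κ ℂ} (hh : h.IsHermitian) (β τ : ℝ) :
    holeProp β h τ = partProp β h (β - τ) := by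
  rw [partProp_eq_holeProp hh, sub_sub_cancel]

/-- The KMS relation exchanges particle and hole propagators under τ ↦ β - τ; cyclicity of the trace
does the rest. This is what lets both time orderings be described by one function of τ on [0, β]. -/
theorem bubble_swap {h : Matrix κ κ ℂ} (hh : h.IsHermitian) (A B : Matrix κ κ ℂ) (β τ : ℝ) :
    bubble β h B A τ = bubble β h A B (β - τ) := by
  rw [bubble, bubble, ← partProp_eq_holeProp hh, ← holeProp_eq_partProp hh, mul_assoc,
    trace_mul_comm, ← mul_assoc]

theorem fermiMatrix_transpose (β : ℝ) (h : Matrix κ κ ℂ) :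
    fermiMatrix β hᵀ = (fermiMatrix β h)ᵀ := by
  rw [fermiMatrix, fermiMatrix, transpose_nonsing_inv, transpose_add, transpose_one,
    ← exp_transpose, transpose_smul]

/-- Both factors are functions of h. The commutation is needed because transposition reverses the
order of the factors of a propagator. -/
theorem fermiMatrix_mul_exp {h : Matrix κ κ ℂ} (hh : h.IsHermitian) (β : ℝ) (c : ℂ) :
    fermiMatrix β h * NormedSpace.exp (c • h) = NormedSpace.exp (c • h) * fermiMatrix β h := by
  have h1 : (1 + NormedSpace.exp ((β : ℂ) • h)) * NormedSpace.exp (c • h)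
      = NormedSpace.exp (c • h) * (1 + NormedSpace.exp ((β : ℂ) • h)) := by
    rw [add_mul, mul_add, exp_smul_mul_exp_smul, exp_smul_mul_exp_smul, add_comm (β : ℂ), one_mul,
      mul_one]
  have h2 := Matrix.mul_nonsing_inv _ (isUnit_det_one_add_exp hh β)
  have h3 := Matrix.nonsing_inv_mul _ (isUnit_det_one_add_exp hh β)
  rw [← fermiMatrix] at h2 h3
  calc fermiMatrix β h * NormedSpace.exp (c • h)
      = fermiMatrix β h * NormedSpace.exp (c • h)
        * ((1 + NormedSpace.exp ((β : ℂ) • h)) * fermiMatrix β h) := by rw [h2, mul_one]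
    _ = fermiMatrix β h * (NormedSpace.exp (c • h)
        * (1 + NormedSpace.exp ((β : ℂ) • h))) * fermiMatrix β h := by simp only [mul_assoc]
    _ = _ := by rw [← h1, ← mul_assoc, h3, one_mul]

theorem partProp_transpose {h : Matrix κ κ ℂ} (hh : h.IsHermitian) (β τ : ℝ) :
    partProp β hᵀ τ = (partProp β h τ)ᵀ := by
  rw [partProp, partProp, fermiMatrix_transpose, ← transpose_smul, exp_transpose,
    ← transpose_mul, fermiMatrix_mul_exp hh]

/-- Transposing all one-particle operators reverses the time. -/
theorem bubble_transpose {h : Matrix κ κ ℂ} (hh : h.IsHermitian) (A B : Matrix κ κ ℂ) (β τ : ℝ) :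
    bubble β hᵀ Aᵀ Bᵀ τ = bubble β h A B (β - τ) := by
  rw [← bubble_swap hh, bubble, bubble, holeProp_eq_partProp hh.transpose, partProp_transpose hh,
    partProp_transpose hh, ← holeProp_eq_partProp hh, ← transpose_mul, ← transpose_mul,
    ← transpose_mul, trace_transpose]
  rw [← mul_assoc, ← mul_assoc, mul_assoc, mul_assoc, trace_mul_comm, ← mul_assoc]

end Bubble

/-! ### The imaginary-time integral -/

section TimeIntegral

variable {κ : Type} [Fintype κ] [DecidableEq κ]

open scoped Matrix.Norms.Operator in
theorem continuous_matrix_exp {n : Type*} [Fintype n] [DecidableEq n] :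
    Continuous (NormedSpace.exp : Matrix n n ℂ → Matrix n n ℂ) :=
  NormedSpace.exp_continuous

theorem continuous_fermiMatrix {X : Type*} [TopologicalSpace X] (β : ℝ) {h : X → Matrix κ κ ℂ}
    (hc : Continuous h) (hh : ∀ x, (h x).IsHermitian) :
    Continuous fun x => fermiMatrix β (h x) := by
  have h1 : Continuous fun x => 1 + NormedSpace.exp ((β : ℂ) • h x) :=
    continuous_const.add (continuous_matrix_exp.comp (hc.const_smul (β : ℂ)))
  simp only [fermiMatrix, Matrix.inv_def, Ring.inverse_eq_inv']
  exact (h1.matrix_det.inv₀ fun x => (isUnit_det_one_add_exp (hh x) β).ne_zero).smul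
    h1.matrix_adjugate

theorem continuous_bubble {X : Type*} [TopologicalSpace X] (β : ℝ) {h A B : X → Matrix κ κ ℂ}
    {τ : X → ℝ} (hc : Continuous h) (hh : ∀ x, (h x).IsHermitian) (hA : Continuous A)
    (hB : Continuous B) (hτ : Continuous τ) :
    Continuous fun x => bubble β (h x) (A x) (B x) (τ x) := by
  have h1 := continuous_fermiMatrix β hc hh
  have h2 : Continuous fun x => NormedSpace.exp (((-τ x : ℝ) : ℂ) • h x) :=
    continuous_matrix_exp.comp ((Complex.continuous_ofReal.comp hτ.neg).smul hc)
  have h3 : Continuous fun x => NormedSpace.exp ((τ x : ℂ) • h x) :=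
    continuous_matrix_exp.comp ((Complex.continuous_ofReal.comp hτ).smul hc)
  exact (((hA.mul (h2.mul (continuous_const.sub h1))).mul hB).mul (h3.mul h1)).matrix_trace

/-- The Fourier transform of the bubble at frequency `ω`. -/
noncomputable def bubbleHat (β ω : ℝ) (h A B : Matrix κ κ ℂ) : ℂ :=
  ∫ τ in (0 : ℝ)..β, Complex.exp (-(Complex.I * ω * τ)) * bubble β h A B τ

/-- The bubble is expressed through matrix exponentials and an inverse, not through eigenvectors, so
at finite β it stays continuous where the two bands touch. The convergence of Riemann sums relies on
this. -/
theorem continuous_bubbleHat {X : Type*} [TopologicalSpace X] (β ω : ℝ)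
    {h A B : X → Matrix κ κ ℂ} (hc : Continuous h) (hh : ∀ x, (h x).IsHermitian)
    (hA : Continuous A) (hB : Continuous B) :
    Continuous fun x => bubbleHat β ω (h x) (A x) (B x) := by
  refine intervalIntegral.continuous_parametric_intervalIntegral_of_continuous' ?_ 0 β
  refine Continuous.mul (by fun_prop) ?_
  exact continuous_bubble β (hc.comp continuous_fst) (fun x => hh _) (hA.comp continuous_fst)
    (hB.comp continuous_fst) continuous_snd

/-- The square integral of a `β`-periodic function of the difference of two times. -/
theorem integral_integral_periodized {β : ℝ} (hβ : 0 < β) {g : ℝ → ℂ} (hg : Continuous g) :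
    ∫ t in (0 : ℝ)..β, ∫ s in (0 : ℝ)..β, (if s < t then g (t - s) else g (t - s + β))
      = β * ∫ τ in (0 : ℝ)..β, g τ := by
  have key : ∀ t ∈ Set.uIcc 0 β, ∫ s in (0 : ℝ)..β, (if s < t then g (t - s) else g (t - s + β))
      = ∫ τ in (0 : ℝ)..β, g τ := by
    intro t ht
    rw [Set.uIcc_of_le hβ.le] at ht
    have e1 : ∀ s ∈ Set.uIoo 0 t, (if s < t then g (t - s) else g (t - s + β)) = g (t - s) := by
      intro s hs
      rw [Set.uIoo_of_le ht.1] at hs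
      rw [if_pos hs.2]
    have e2 : ∀ s ∈ Set.uIoo t β,
        (if s < t then g (t - s) else g (t - s + β)) = g (t + β - s) := by
      intro s hs
      rw [Set.uIoo_of_le ht.2] at hs
      rw [if_neg (not_lt.2 hs.1.le)]
      congr 1
      ring
    have i1 : IntervalIntegrable (fun s => if s < t then g (t - s) else g (t - s + β))
        MeasureTheory.volume 0 t :=
      (intervalIntegrable_congr_uIoo e1).2
        (Continuous.intervalIntegrable (by fun_prop) _ _)
    have i2 : IntervalIntegrable (fun s => if s < t then g (t - s) else g (t - s + β))
        MeasureTheory.volume t β :=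
      (intervalIntegrable_congr_uIoo e2).2
        (Continuous.intervalIntegrable (by fun_prop) _ _)
    rw [← intervalIntegral.integral_add_adjacent_intervals i1 i2,
      intervalIntegral.integral_congr_uIoo e1, intervalIntegral.integral_congr_uIoo e2,
      intervalIntegral.integral_comp_sub_left, intervalIntegral.integral_comp_sub_left]
    rw [sub_self, sub_zero, add_sub_cancel_right, add_sub_cancel_left,
      intervalIntegral.integral_add_adjacent_intervals (hg.intervalIntegrable _ _)
        (hg.intervalIntegrable _ _)]
  rw [intervalIntegral.integral_congr key, intervalIntegral.integral_const, sub_zero,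
    Complex.real_smul]

variable {ι : Type} [Fintype ι] [LinearOrder ι] {a : κ → FockOp ι}

theorem IsCAR.integral_timeOrdered (ha : IsCAR a) {h : Matrix κ κ ℂ} (hh : h.IsHermitian)
    (A B : Matrix κ κ ℂ) {β ω : ℝ} (hβ : 0 < β)
    (hω : Complex.exp (-(Complex.I * ω * β)) = 1) :
    ∫ t in (0 : ℝ)..β, ∫ s in (0 : ℝ)..β, Complex.exp (-(Complex.I * ω * ((t - s : ℝ) : ℂ))) *
      (gibbs β (quad a h) (timeOrdered (quad a h) (quad a A) (quad a B) t s)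
        - gibbs β (quad a h) (quad a A) * gibbs β (quad a h) (quad a B))
      = β * bubbleHat β ω h A B := by
  have hg : Continuous fun τ : ℝ => Complex.exp (-(Complex.I * ω * τ)) * bubble β h A B τ :=
    Continuous.mul (by fun_prop) (continuous_bubble β continuous_const (fun _ => hh)
      continuous_const continuous_const continuous_id)
  rw [bubbleHat, ← integral_integral_periodized hβ hg]
  congr 1
  ext t
  congr 1
  ext s
  rw [timeOrdered]
  split_ifs with hst
  · rw [ha.connected hh]
  -- In the opposite time order the bubble is evaluated at t - s + β, and the phase may be shifted
  -- by β because ω is a Matsubara frequency.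
  · rw [mul_comm (gibbs β (quad a h) (quad a A)), ha.connected hh, bubble_swap hh]
    have : Complex.exp (-(Complex.I * ω * ((t - s + β : ℝ) : ℂ)))
        = Complex.exp (-(Complex.I * ω * ((t - s : ℝ) : ℂ))) := by
      rw [← mul_one (Complex.exp (-(Complex.I * ω * ((t - s : ℝ) : ℂ)))), ← hω, ← Complex.exp_add]
      congr 1
      push_cast
      ring
    rw [this]
    congr 2
    ring

/-! ### Block diagonal one-particle operators -/

variable {o : Type} [Fintype o] [DecidableEq o]

open scoped Matrix.Norms.Operator in
theorem exp_smul_blockDiagonal (h : o → Matrix κ κ ℂ) (c : ℂ) :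
    NormedSpace.exp (c • blockDiagonal h) = blockDiagonal fun k => NormedSpace.exp (c • h k) := by
  rw [← blockDiagonal_smul, exp_blockDiagonal]
  congr 1
  funext k
  exact Pi.coe_exp _ k

theorem fermiMatrix_blockDiagonal {h : o → Matrix κ κ ℂ} (hh : ∀ k, (h k).IsHermitian) (β : ℝ) :
    fermiMatrix β (blockDiagonal h) = blockDiagonal fun k => fermiMatrix β (h k) := by
  rw [fermiMatrix, exp_smul_blockDiagonal, ← blockDiagonal_one, ← blockDiagonal_add]
  apply inv_eq_right_inv
  rw [← blockDiagonal_mul, ← blockDiagonal_one]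
  congr 1
  ext1 k
  exact Matrix.mul_nonsing_inv _ (isUnit_det_one_add_exp (hh k) β)

theorem bubble_blockDiagonal {h : o → Matrix κ κ ℂ} (hh : ∀ k, (h k).IsHermitian)
    (A B : o → Matrix κ κ ℂ) (β τ : ℝ) :
    bubble β (blockDiagonal h) (blockDiagonal A) (blockDiagonal B) τ
      = ∑ k, bubble β (h k) (A k) (B k) τ := by
  rw [bubble, holeProp, partProp, fermiMatrix_blockDiagonal hh, exp_smul_blockDiagonal,
    exp_smul_blockDiagonal, ← blockDiagonal_one, ← blockDiagonal_sub]
  simp only [← blockDiagonal_mul]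
  rw [trace_blockDiagonal]
  rfl

theorem bubbleHat_blockDiagonal {h : o → Matrix κ κ ℂ} (hh : ∀ k, (h k).IsHermitian)
    (A B : o → Matrix κ κ ℂ) (β ω : ℝ) :
    bubbleHat β ω (blockDiagonal h) (blockDiagonal A) (blockDiagonal B)
      = ∑ k, bubbleHat β ω (h k) (A k) (B k) := by
  simp only [bubbleHat, bubble_blockDiagonal hh, Finset.mul_sum]
  rw [intervalIntegral.integral_finsetSum]
  intro k _
  refine Continuous.intervalIntegrable ?_ _ _
  exact Continuous.mul (by fun_prop) (continuous_bubble β continuous_const (fun _ => hh k)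
      continuous_const continuous_const continuous_id)

end TimeIntegral

/-! ### Characters of the discrete torus -/

section Characters

/-- The character `e^{2πi j / L}`. -/
noncomputable def rootPhase (L : ℕ) (j : ℤ) : ℂ := Complex.exp (2 * Real.pi * Complex.I * j / L)

variable (L : ℕ) [NeZero L]

theorem rootPhase_add (i j : ℤ) : rootPhase L (i + j) = rootPhase L i * rootPhase L j := by
  rw [rootPhase, rootPhase, rootPhase, ← Complex.exp_add]
  congr 1
  push_cast
  ring

theorem rootPhase_zero : rootPhase L 0 = 1 := by simp [rootPhase]

theorem rootPhase_neg (j : ℤ) : rootPhase L (-j) = star (rootPhase L j) := by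
  rw [rootPhase, rootPhase, Complex.star_def, ← Complex.exp_conj]
  congr 1
  simp [map_ofNat]

theorem rootPhase_mul_star (j : ℤ) : rootPhase L j * star (rootPhase L j) = 1 := by
  rw [← rootPhase_neg, ← rootPhase_add, add_neg_cancel, rootPhase_zero]

theorem rootPhase_eq_one_iff (j : ℤ) : rootPhase L j = 1 ↔ (L : ℤ) ∣ j := by
  have hL : (L : ℂ) ≠ 0 := Nat.cast_ne_zero.2 (NeZero.ne L)
  have hpi : (2 * Real.pi * Complex.I : ℂ) ≠ 0 := Complex.two_pi_I_ne_zero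
  rw [rootPhase, Complex.exp_eq_one_iff]
  constructor
  · rintro ⟨n, hn⟩
    refine ⟨n, ?_⟩
    field_simp at hn
    have : (j : ℂ) = (L : ℂ) * n := by linear_combination hn
    exact_mod_cast this
  · rintro ⟨n, rfl⟩
    refine ⟨n, ?_⟩
    push_cast
    field_simp

theorem rootPhase_mul_emod (n m : ℤ) : rootPhase L (n * (m % L)) = rootPhase L (n * m) := by
  have h : n * m = n * (m % L) + L * (n * (m / L)) := by
    conv_lhs => rw [← Int.emod_add_mul_ediv m L]
    ring
  rw [h, rootPhase_add, (rootPhase_eq_one_iff L _).2 (dvd_mul_right _ _), mul_one]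

theorem rootPhase_natMul (j : ℤ) (i : ℕ) : rootPhase L (i * j) = rootPhase L j ^ i := by
  induction i with
  | zero => simp [rootPhase_zero]
  | succ i ih => rw [pow_succ, ← ih, ← rootPhase_add]; congr 1; push_cast; ring

theorem sum_range_rootPhase (j : ℤ) :
    ∑ i ∈ Finset.range L, rootPhase L (i * j) = if (L : ℤ) ∣ j then (L : ℂ) else 0 := by
  simp only [rootPhase_natMul]
  split_ifs with h
  · simp [(rootPhase_eq_one_iff L j).2 h]
  · have h1 : rootPhase L j ≠ 1 := fun h' => h ((rootPhase_eq_one_iff L j).1 h')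
    rw [geom_sum_eq h1, ← rootPhase_natMul, (rootPhase_eq_one_iff L _).2 (dvd_mul_right _ _),
      sub_self, zero_div]

/-- The zone `(-L/2, L/2]` is a complete system of residues modulo `L`. -/
theorem sum_zoneIndex {M : Type*} [AddCommMonoid M] {f : ℤ → M} (hf : ∀ n, f (n + L) = f n) :
    ∑ n ∈ zoneIndex L, f n = ∑ i ∈ Finset.range L, f i := by
  have hL := Nat.pos_of_ne_zero (NeZero.ne L)
  refine Finset.sum_nbij' (fun n => (if n < 0 then n + L else n).toNat)
    (fun i => if 2 * i ≤ L then (i : ℤ) else i - L) ?_ ?_ ?_ ?_ ?_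
  · intro n hn
    simp only [zoneIndex, Finset.mem_filter, Finset.mem_Icc, Finset.mem_range] at hn ⊢
    split_ifs <;> omega
  · intro i hi
    simp only [zoneIndex, Finset.mem_filter, Finset.mem_Icc, Finset.mem_range] at hi ⊢
    split_ifs <;> omega
  · intro n hn
    simp only [zoneIndex, Finset.mem_filter, Finset.mem_Icc] at hn
    split_ifs <;> omega
  · intro i hi
    simp only [Finset.mem_range] at hi
    split_ifs <;> omega
  · intro n hn
    simp only [zoneIndex, Finset.mem_filter, Finset.mem_Icc] at hn
    split_ifs with h
    · rw [Int.toNat_of_nonneg (by omega), hf]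
    · rw [Int.toNat_of_nonneg (by omega)]

theorem sum_zoneIndex_rootPhase (j : ℤ) :
    ∑ n ∈ zoneIndex L, rootPhase L (n * j) = if (L : ℤ) ∣ j then (L : ℂ) else 0 := by
  rw [sum_zoneIndex, sum_range_rootPhase]
  intro n
  rw [add_mul, rootPhase_add, (rootPhase_eq_one_iff L _).2 (dvd_mul_right _ _), mul_one]

theorem sum_fin_rootPhase (j : ℤ) :
    ∑ x : Fin L, rootPhase L (j * (x.val : ℤ)) = if (L : ℤ) ∣ j then (L : ℂ) else 0 := by
  rw [← sum_range_rootPhase, Finset.sum_range]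
  simp only [mul_comm]

/-- The plane wave `e^{ik·x}` of momentum `k = (n₁/L) G₁ + (n₂/L) G₂` on the discrete torus. -/
noncomputable def planeWave (n : ℤ × ℤ) (x : Torus L) : ℂ :=
  rootPhase L (n.1 * (x.1.val : ℤ)) * rootPhase L (n.2 * (x.2.val : ℤ))

theorem momentum_dot_position (n : ℤ × ℤ) (x : Torus L) :
    momentum L n ⬝ᵥ position L x = 2 * Real.pi * (n.1 * x.1.val + n.2 * x.2.val) / L := by
  obtain ⟨h1, h2, h3, h4⟩ := G_dot_ell
  rw [momentum, position, add_dotProduct, dotProduct_add, dotProduct_add, smul_dotProduct,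
    smul_dotProduct, smul_dotProduct, smul_dotProduct, dotProduct_smul, dotProduct_smul,
    dotProduct_smul, dotProduct_smul, h1, h2, h3, h4]
  simp only [smul_eq_mul]
  ring

theorem exp_momentum_dot_position (n : ℤ × ℤ) (x : Torus L) :
    Complex.exp (Complex.I * ((momentum L n ⬝ᵥ position L x : ℝ) : ℂ)) = planeWave L n x := by
  rw [momentum_dot_position, planeWave, rootPhase, rootPhase, ← Complex.exp_add]
  congr 1
  push_cast
  ring

theorem planeWave_add (n : ℤ × ℤ) (x y : Torus L) :
    planeWave L n (x + y) = planeWave L n x * planeWave L n y := by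
  have h : ∀ (m : ℤ) (a b : Fin L), rootPhase L (m * ((a + b).val : ℤ))
      = rootPhase L (m * (a.val : ℤ)) * rootPhase L (m * (b.val : ℤ)) := by
    intro m a b
    rw [Fin.val_add, Int.natCast_mod, rootPhase_mul_emod, ← rootPhase_add]
    congr 1
    push_cast
    ring
  rw [planeWave, planeWave, planeWave, Prod.fst_add, Prod.snd_add, h, h]
  ring

theorem planeWave_mul_star (n : ℤ × ℤ) (x : Torus L) :
    planeWave L n x * star (planeWave L n x) = 1 := by
  rw [planeWave, star_mul']
  have h1 := rootPhase_mul_star L (n.1 * (x.1.val : ℤ))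
  have h2 := rootPhase_mul_star L (n.2 * (x.2.val : ℤ))
  linear_combination h1 * (rootPhase L (n.2 * (x.2.val : ℤ)) * star (rootPhase L (n.2 * (x.2.val : ℤ)))) + h2

theorem planeWave_zero (n : ℤ × ℤ) : planeWave L n 0 = 1 := by
  simp [planeWave, rootPhase_zero]

theorem planeWave_neg (n : ℤ × ℤ) (x : Torus L) :
    planeWave L n (-x) = star (planeWave L n x) := by
  have h := planeWave_add L n (-x) x
  rw [neg_add_cancel, planeWave_zero] at h
  have h2 := planeWave_mul_star L n x
  linear_combination -(star (planeWave L n x)) * h + (-(planeWave L n (-x))) * h2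

theorem planeWave_one_zero (n : ℤ × ℤ) : planeWave L n (1, 0) = rootPhase L n.1 := by
  simp only [planeWave, Fin.val_zero, Nat.cast_zero, mul_zero, rootPhase_zero, mul_one]
  rw [Fin.val_one', Int.natCast_mod, rootPhase_mul_emod]
  simp

theorem planeWave_zero_one (n : ℤ × ℤ) : planeWave L n (0, 1) = rootPhase L n.2 := by
  simp only [planeWave, Fin.val_zero, Nat.cast_zero, mul_zero, rootPhase_zero, one_mul]
  rw [Fin.val_one', Int.natCast_mod, rootPhase_mul_emod]
  simp

/-- Completeness of the plane waves: two geometric sums of roots of unity, where coordinates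
differing by less than L in absolute value are congruent modulo L only if equal. -/
theorem sum_zone_planeWave (x y : Torus L) :
    ∑ n ∈ zoneIndex L ×ˢ zoneIndex L, star (planeWave L n x) * planeWave L n y
      = if x = y then (L : ℂ) ^ 2 else 0 := by
  have h1 : ∀ n : ℤ × ℤ, star (planeWave L n x) * planeWave L n y
      = rootPhase L (n.1 * ((y.1.val : ℤ) - x.1.val)) * rootPhase L (n.2 * ((y.2.val : ℤ) - x.2.val)) := by
    intro n
    rw [planeWave, planeWave, star_mul', ← rootPhase_neg, ← rootPhase_neg, mul_mul_mul_comm,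
      ← rootPhase_add, ← rootPhase_add]
    congr 2 <;> ring
  have h2 : ∀ a b : Fin L, (L : ℤ) ∣ ((b.val : ℤ) - a.val) ↔ a = b := by
    intro a b
    constructor
    · intro h
      have h3 := Int.eq_zero_of_abs_lt_dvd h (by rw [abs_lt]; omega)
      ext
      omega
    · rintro rfl
      simp
  simp only [h1]
  rw [Finset.sum_product, ← Finset.sum_mul_sum _ _
    (fun i => rootPhase L (i * ((y.1.val : ℤ) - x.1.val)))
    (fun j => rootPhase L (j * ((y.2.val : ℤ) - x.2.val))), sum_zoneIndex_rootPhase,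
    sum_zoneIndex_rootPhase]
  simp only [h2, Prod.ext_iff]
  by_cases ha : x.1 = y.1 <;> by_cases hb : x.2 = y.2 <;> simp [ha, hb, sq]

/-- Orthogonality of the plane waves. Membership in the zone matters: it contains one representative
of each residue class, so congruent momenta coincide. -/
theorem sum_torus_planeWave {n m : ℤ × ℤ} (hn : n ∈ zoneIndex L ×ˢ zoneIndex L)
    (hm : m ∈ zoneIndex L ×ˢ zoneIndex L) :
    ∑ x : Torus L, planeWave L n x * star (planeWave L m x)
      = if n = m then (L : ℂ) ^ 2 else 0 := by
  have h1 : ∀ x : Torus L, planeWave L n x * star (planeWave L m x)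
      = rootPhase L ((n.1 - m.1) * (x.1.val : ℤ)) * rootPhase L ((n.2 - m.2) * (x.2.val : ℤ)) := by
    intro x
    rw [planeWave, planeWave, star_mul', ← rootPhase_neg, ← rootPhase_neg, mul_mul_mul_comm,
      ← rootPhase_add, ← rootPhase_add]
    congr 2 <;> ring
  have h2 : ∀ a ∈ zoneIndex L, ∀ b ∈ zoneIndex L, ((L : ℤ) ∣ a - b ↔ a = b) := by
    intro a ha b hb
    simp only [zoneIndex, Finset.mem_filter, Finset.mem_Icc] at ha hb
    constructor
    · intro h
      have h3 := Int.eq_zero_of_abs_lt_dvd h (by rw [abs_lt]; omega)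
      omega
    · rintro rfl
      simp
  rw [Finset.mem_product] at hn hm
  simp only [h1]
  rw [Fintype.sum_prod_type, ← Finset.sum_mul_sum _ _
    (fun i : Fin L => rootPhase L ((n.1 - m.1) * (i.val : ℤ)))
    (fun j : Fin L => rootPhase L ((n.2 - m.2) * (j.val : ℤ))), sum_fin_rootPhase,
    sum_fin_rootPhase]
  simp only [h2 _ hn.1 _ hm.1, h2 _ hn.2 _ hm.2, Prod.ext_iff]
  by_cases ha : n.1 = m.1 <;> by_cases hb : n.2 = m.2 <;> simp [ha, hb, sq]

end Characters

/-! ### Momentum space modes -/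

section Modes

variable (L : ℕ) [NeZero L]

/-- The annihilation operators in position space. -/
noncomputable def posMode (p : Torus L × Fin 2) : FockOp (Mode L) := psi L p.1 p.2

theorem isCAR_posMode : IsCAR (posMode L) := by
  have hinj : ∀ p q : Torus L × Fin 2,
      (toLex (p.1.1, toLex (p.1.2, p.2)) : Mode L) = toLex (q.1.1, toLex (q.1.2, q.2)) ↔ p = q := by
    intro p q
    simp only [EmbeddingLike.apply_eq_iff_eq, Prod.ext_iff, and_assoc]
  constructor
  · intro p q
    have := isCAR_annihilation.mul_conjTranspose_add (ι := Mode L)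
      (toLex (p.1.1, toLex (p.1.2, p.2))) (toLex (q.1.1, toLex (q.1.2, q.2)))
    simp only [hinj] at this
    exact this
  · intro p q
    exact isCAR_annihilation.mul_add_mul (ι := Mode L) _ _

/-- The discretized Brillouin zone. -/
abbrev Zone : Type := {n : ℤ × ℤ // n ∈ zoneIndex L ×ˢ zoneIndex L}

/-- The unitary matrix of the lattice Fourier transform. -/
noncomputable def fourierMatrix : Matrix (Torus L × Fin 2) (Fin 2 × Zone L) ℂ :=
  Matrix.of fun p q => if p.2 = q.1 then star (planeWave L q.2.1 p.1) / L else 0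

/-- The normalized annihilation operators in momentum space. -/
noncomputable def momMode (q : Fin 2 × Zone L) : FockOp (Mode L) :=
  ∑ p, star (fourierMatrix L p q) • posMode L p

theorem fourierMatrix_isometry : (fourierMatrix L)ᴴ * fourierMatrix L = 1 := by
  have hL : (L : ℂ) ≠ 0 := Nat.cast_ne_zero.2 (NeZero.ne L)
  ext q q'
  rw [Matrix.mul_apply, Fintype.sum_prod_type]
  have h1 : ∀ x : Torus L, ∑ ρ : Fin 2, (fourierMatrix L)ᴴ q (x, ρ) * fourierMatrix L (x, ρ) q'
      = (if q.1 = q'.1 then 1 / (L : ℂ) ^ 2 else 0)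
        * (planeWave L q.2.1 x * star (planeWave L q'.2.1 x)) := by
    intro x
    simp only [conjTranspose_apply, fourierMatrix, Matrix.of_apply]
    rw [Finset.sum_eq_single q.1]
    · simp only [if_true]
      split_ifs
      · simp; field_simp
      · simp
    · intro ρ _ hρ
      simp [hρ]
    · simp
  simp only [h1, ← Finset.mul_sum]
  rw [sum_torus_planeWave L q.2.2 q'.2.2, Matrix.one_apply]
  have h2 : q = q' ↔ q.1 = q'.1 ∧ q.2.1 = q'.2.1 := by
    rw [Prod.ext_iff, Subtype.ext_iff]
  simp only [h2]
  by_cases ha : q.1 = q'.1 <;> by_cases hb : q.2.1 = q'.2.1 <;> simp [ha, hb, hL]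

theorem isCAR_momMode : IsCAR (momMode L) :=
  (isCAR_posMode L).linearCombination _ (fourierMatrix_isometry L)

theorem momMode_eq (ρ : Fin 2) (n : Zone L) :
    momMode L (ρ, n) = (1 / (L : ℂ)) • psiHat L (momentum L n.1) ρ := by
  rw [momMode, Fintype.sum_prod_type, psiHat, Finset.smul_sum]
  refine Finset.sum_congr rfl fun x _ => ?_
  rw [Finset.sum_eq_single ρ]
  · rw [exp_momentum_dot_position, fourierMatrix, Matrix.of_apply, if_pos rfl, smul_smul]
    congr 1
    simp
    field_simp
  · intro σ _ hσ
    simp [fourierMatrix, hσ]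
  · simp

theorem quad_blockDiagonal {ι κ o : Type} [Fintype ι] [LinearOrder ι] [Fintype κ] [DecidableEq κ]
    [Fintype o] [DecidableEq o] (a : κ × o → FockOp ι) (M : o → Matrix κ κ ℂ) :
    quad a (blockDiagonal M) = ∑ k, ∑ p, ∑ q, M k p q • ((a (p, k))ᴴ * a (q, k)) := by
  simp only [quad, Fintype.sum_prod_type, blockDiagonal_apply, ite_smul, zero_smul]
  rw [Finset.sum_comm]
  simp

/-- Translation-invariant hopping operators are diagonal in momentum space. -/
theorem hop_eq (g : Torus L) (ρ ρ' : Fin 2) :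
    ∑ x : Torus L, psiDag L x ρ * psi L (x + g) ρ'
      = quad (momMode L) (blockDiagonal fun n : Zone L =>
          star (planeWave L n.1 g) • Matrix.single ρ ρ' (1 : ℂ)) := by
  have hL : (L : ℂ) ≠ 0 := Nat.cast_ne_zero.2 (NeZero.ne L)
  rw [quad_blockDiagonal]
  have h1 : ∀ n : Zone L, (∑ p, ∑ q, (star (planeWave L n.1 g) • Matrix.single ρ ρ' (1 : ℂ)) p q •
      ((momMode L (p, n))ᴴ * momMode L (q, n)))
      = ∑ x : Torus L, ∑ y : Torus L, (1 / (L : ℂ) ^ 2 * (star (planeWave L n.1 (x + g)) *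
          planeWave L n.1 y)) • (psiDag L x ρ * psi L y ρ') := by
    intro n
    rw [Finset.sum_eq_single ρ, Finset.sum_eq_single ρ']
    · rw [momMode_eq, momMode_eq, psiHat, psiHat, conjTranspose_smul, conjTranspose_sum,
        smul_mul_smul_comm, Finset.sum_mul_sum, Finset.smul_sum, Finset.smul_sum]
      refine Finset.sum_congr rfl fun x _ => ?_
      rw [Finset.smul_sum, Finset.smul_sum]
      refine Finset.sum_congr rfl fun y _ => ?_
      rw [conjTranspose_smul, smul_mul_smul_comm, exp_momentum_dot_position,
        exp_momentum_dot_position, smul_smul, smul_smul, planeWave_add, star_mul']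
      congr 1
      simp
      ring
    · intro q _ hq
      simp [Matrix.single_apply, hq.symm]
    · simp
    · intro p _ hp
      simp [Matrix.single_apply, hp.symm]
    · simp
  simp only [h1]
  rw [Finset.sum_comm_cycle₃]
  refine Finset.sum_congr rfl fun x _ => ?_
  -- Completeness of the plane waves in n leaves only the site y = x + g.
  rw [Finset.sum_eq_single (x + g)]
  · rw [← Finset.sum_smul, ← Finset.mul_sum, Finset.sum_coe_sort (zoneIndex L ×ˢ zoneIndex L)
      (fun n => star (planeWave L n (x + g)) * planeWave L n (x + g)), sum_zone_planeWave, if_pos rfl,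
      one_div, inv_mul_cancel₀ (pow_ne_zero 2 hL), one_smul]
  · intro y _ hy
    rw [← Finset.sum_smul, ← Finset.mul_sum, Finset.sum_coe_sort (zoneIndex L ×ˢ zoneIndex L)
      (fun n => star (planeWave L n (x + g)) * planeWave L n y), sum_zone_planeWave,
      if_neg hy.symm, mul_zero, zero_smul]
  · simp

end Modes

/-! ### The Bloch Hamiltonian -/

section Bloch

variable (P : Params)

/-- The band-symmetric part of the Bloch Hamiltonian, as a function of `x = k·ℓ₁`, `y = k·ℓ₂`. -/
noncomputable def blochShift (x y : ℝ) : ℝ :=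
  -2 * P.t₂ * Real.cos P.φ * (Real.cos (x - y) + Real.cos y + Real.cos x) - chemPot P

/-- The mass term of the Bloch Hamiltonian. -/
noncomputable def blochMass (x y : ℝ) : ℝ :=
  P.W - 2 * P.t₂ * Real.sin P.φ * (Real.sin (x - y) + Real.sin y - Real.sin x)

/-- The structure factor `1 + e^{ix} + e^{iy}` of the honeycomb lattice. -/
noncomputable def latticeSum (x y : ℝ) : ℂ :=
  1 + Complex.exp (Complex.I * x) + Complex.exp (Complex.I * y)

/-- The Bloch Hamiltonian. -/
noncomputable def bloch (x y : ℝ) : Matrix (Fin 2) (Fin 2) ℂ :=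
  !![((blochShift P x y + blochMass P x y : ℝ) : ℂ), -P.t₁ * latticeSum x y;
    -P.t₁ * star (latticeSum x y), ((blochShift P x y - blochMass P x y : ℝ) : ℂ)]

/-- The first component of the current vertex. -/
noncomputable def vertexX (x y : ℝ) : Matrix (Fin 2) (Fin 2) ℂ :=
  !![((3 * P.t₂ * (Real.sin (P.φ - y) - Real.sin (P.φ + x)) : ℝ) : ℂ),
      -(Complex.I * P.t₁) *
        (1 - Complex.exp (Complex.I * x) / 2 - Complex.exp (Complex.I * y) / 2);
    Complex.I * P.t₁ *
        (1 - Complex.exp (-(Complex.I * x)) / 2 - Complex.exp (-(Complex.I * y)) / 2),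
      ((-(3 * P.t₂ * (Real.sin (P.φ + y) - Real.sin (P.φ - x))) : ℝ) : ℂ)]

/-- The second component of the current vertex. -/
noncomputable def vertexY (x y : ℝ) : Matrix (Fin 2) (Fin 2) ℂ :=
  !![((√3 * P.t₂ * (-2 * Real.sin (P.φ - x + y) + Real.sin (P.φ - y) + Real.sin (P.φ + x)) : ℝ) : ℂ),
      -(Complex.I * P.t₁) *
        ((√3 / 2 : ℝ) * (Complex.exp (Complex.I * x) - Complex.exp (Complex.I * y)));
    Complex.I * P.t₁ *
        ((√3 / 2 : ℝ) * (Complex.exp (-(Complex.I * x)) - Complex.exp (-(Complex.I * y)))),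
      ((-(√3 * P.t₂ * (-2 * Real.sin (P.φ + x - y) + Real.sin (P.φ + y) + Real.sin (P.φ - x))) : ℝ) : ℂ)]

theorem star_latticeSum (x y : ℝ) :
    star (latticeSum x y) = 1 + Complex.exp (-(Complex.I * x)) + Complex.exp (-(Complex.I * y)) := by
  simp [latticeSum, ← Complex.exp_conj]

theorem bloch_isHermitian (x y : ℝ) : (bloch P x y).IsHermitian := by
  ext i j
  fin_cases i <;> fin_cases j <;> simp [bloch]

theorem continuous_bloch : Continuous fun p : ℝ × ℝ => bloch P p.1 p.2 := by
  refine continuous_matrix fun i j => ?_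
  fin_cases i <;> fin_cases j <;>
    simp [bloch, blochShift, blochMass, latticeSum] <;> fun_prop

theorem continuous_vertexX : Continuous fun p : ℝ × ℝ => vertexX P p.1 p.2 := by
  refine continuous_matrix fun i j => ?_
  fin_cases i <;> fin_cases j <;> simp [vertexX] <;> fun_prop

theorem continuous_vertexY : Continuous fun p : ℝ × ℝ => vertexY P p.1 p.2 := by
  refine continuous_matrix fun i j => ?_
  fin_cases i <;> fin_cases j <;> simp [vertexY] <;> fun_prop

/-- The map reverses k₁ and fixes k₂. It preserves the mass and the band-symmetric part and
conjugates the structure factor. With the two vertex identities below, which differ by a sign, this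
symmetry removes the frequency-even part of the mixed correlation. -/
theorem bloch_reflect (x y : ℝ) : bloch P (-y) (-x) = (bloch P x y)ᵀ := by
  have e0 : blochShift P (-y) (-x) = blochShift P x y := by
    simp only [blochShift, Real.cos_neg]
    rw [show -y - -x = x - y by ring]
    ring
  have e1 : blochMass P (-y) (-x) = blochMass P x y := by
    simp only [blochMass, Real.sin_neg]
    rw [show -y - -x = x - y by ring]
    ring
  have e2 : latticeSum (-y) (-x) = star (latticeSum x y) := by
    rw [star_latticeSum, latticeSum]
    push_cast
    simp only [mul_neg]
    ring
  rw [bloch, bloch, e0, e1, e2, star_star]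
  ext i j
  fin_cases i <;> fin_cases j <;> simp

theorem vertexX_reflect (x y : ℝ) : vertexX P (-y) (-x) = -(vertexX P x y)ᵀ := by
  ext i j
  fin_cases i <;> fin_cases j <;> simp [vertexX] <;> ring_nf <;> simp

theorem vertexY_reflect (x y : ℝ) : vertexY P (-y) (-x) = (vertexY P x y)ᵀ := by
  ext i j
  fin_cases i <;> fin_cases j <;> simp [vertexY] <;> ring_nf <;> simp

theorem vertex_eq (n : ℤ × ℤ) (L : ℕ) :
    vertex P 0 (momentum L n) = vertexX P (2 * Real.pi * n.1 / L) (2 * Real.pi * n.2 / L) ∧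
    vertex P 1 (momentum L n) = vertexY P (2 * Real.pi * n.1 / L) (2 * Real.pi * n.2 / L) := by
  set k := momentum L n with hk
  set x := 2 * Real.pi * n.1 / L with hx
  set y := 2 * Real.pi * n.2 / L with hy
  obtain ⟨h1, h2, h3, h4⟩ := G_dot_ell
  have k1 : k ⬝ᵥ ell₁ = x := by
    rw [hk, momentum, add_dotProduct, smul_dotProduct, smul_dotProduct, h1, h3, hx]
    simp; ring
  have k2 : k ⬝ᵥ ell₂ = y := by
    rw [hk, momentum, add_dotProduct, smul_dotProduct, smul_dotProduct, h2, h4, hy]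
    simp; ring
  have g0 : k ⬝ᵥ gam 0 = x - y := by simp [gam, dotProduct_sub, k1, k2]
  have g1 : k ⬝ᵥ gam 1 = y := by simp [gam, k2]
  have g2 : k ⬝ᵥ gam 2 = -x := by simp [gam, dotProduct_neg, k1]
  have d1 : delta 1 - delta 0 = -ell₁ := by
    ext i; fin_cases i <;> simp [delta, ell₁]; norm_num
  have d2 : delta 2 - delta 0 = -ell₂ := by
    ext i; fin_cases i <;> simp [delta, ell₂]; norm_num
  have sinexp : ∀ t : ℝ, Complex.exp (Complex.I * t) - Complex.exp (-(Complex.I * t))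
      = 2 * Complex.I * (Real.sin t : ℝ) := by
    intro t
    rw [Complex.ofReal_sin, Complex.sin]
    ring_nf
    rw [Complex.I_sq]
    ring
  have key : ∀ (i : Fin 2) (k : Fin 2 → ℝ), vertex₁₁ P i k
      = ((2 * P.t₂ * ∑ j : Fin 3, gam j i * Real.sin (P.φ - k ⬝ᵥ gam j) : ℝ) : ℂ) := by
    intro i k
    simp only [vertex₁₁, ← mul_sub, sinexp]
    push_cast
    rw [Finset.mul_sum, Finset.mul_sum]
    refine Finset.sum_congr rfl fun j _ => ?_
    ring_nf
    rw [Complex.I_sq]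
    ring
  have v12 : ∀ (i : Fin 2) (k : Fin 2 → ℝ) (x y : ℝ), k ⬝ᵥ ell₁ = x → k ⬝ᵥ ell₂ = y →
      vertex₁₂ P i k = -Complex.I * P.t₁ * (delta 0 i + delta 1 i * Complex.exp (Complex.I * x)
        + delta 2 i * Complex.exp (Complex.I * y)) := by
    intro i k x y h1 h2
    simp only [vertex₁₂, Fin.sum_univ_three, d1, d2, sub_self, dotProduct_zero, dotProduct_neg,
      h1, h2, Complex.ofReal_zero, mul_zero, neg_zero, Complex.exp_zero, mul_one,
      Complex.ofReal_neg, mul_neg, neg_neg]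
  have n1 : -k ⬝ᵥ ell₁ = -x := by rw [neg_dotProduct, k1]
  have n2 : -k ⬝ᵥ ell₂ = -y := by rw [neg_dotProduct, k2]
  constructor
  · ext i j
    fin_cases i <;> fin_cases j
    · simp only [vertex, vertexX, key, Fin.sum_univ_three, g0, g1, g2]
      simp [gam, ell₁, ell₂]
      ring_nf
    · simp [vertex, vertexX, v12 _ k x y k1 k2, delta]
      ring_nf
      simp
    · simp [vertex, vertexX, v12 _ (-k) (-x) (-y) n1 n2, delta]
      ring_nf
      simp
    · simp only [vertex, vertexX, key, Fin.sum_univ_three, neg_dotProduct, g0, g1, g2]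
      simp [gam, ell₁, ell₂]
      ring_nf
  · ext i j
    fin_cases i <;> fin_cases j
    · simp only [vertex, vertexY, key, Fin.sum_univ_three, g0, g1, g2]
      simp [gam, ell₁, ell₂]
      ring_nf
    · simp [vertex, vertexY, v12 _ k x y k1 k2, delta]
      ring_nf
      simp
    · simp [vertex, vertexY, v12 _ (-k) (-x) (-y) n1 n2, delta]
      ring_nf
      simp
    · simp only [vertex, vertexY, key, Fin.sum_univ_three, neg_dotProduct, g0, g1, g2]
      simp [gam, ell₁, ell₂]
      ring_nf

end Bloch

/-! ### The Hamiltonian and the currents in momentum space; the correlation as a sum over the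
Brillouin zone. -/

section Hamiltonian

variable (P : Params) (L : ℕ) [NeZero L]

/-- The coordinates `k·ℓ₁`, `k·ℓ₂` of a momentum of the discretized Brillouin zone. -/
noncomputable def angle (L : ℕ) (n : ℤ) : ℝ := 2 * Real.pi * n / L

theorem rootPhase_eq (n : ℤ) : rootPhase L n = Complex.exp (Complex.I * (angle L n : ℝ)) := by
  rw [rootPhase, angle]
  congr 1
  push_cast
  ring

theorem star_rootPhase_eq (n : ℤ) :
    star (rootPhase L n) = Complex.exp (-(Complex.I * (angle L n : ℝ))) := by
  rw [rootPhase_eq, Complex.star_def, ← Complex.exp_conj]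
  simp

/-- The prefactor L⁻² is absorbed by the two factors 1/L that normalize the momentum modes. -/
theorem current_eq (i : Fin 2) :
    current P L i = quad (momMode L) (blockDiagonal fun n : Zone L => vertex P i (momentum L n.1)) := by
  rw [quad_blockDiagonal, current, Finset.smul_sum]
  rw [← Finset.sum_coe_sort (zoneIndex L ×ˢ zoneIndex L)]
  refine Finset.sum_congr rfl fun n _ => ?_
  rw [Finset.smul_sum]
  refine Finset.sum_congr rfl fun ρ _ => ?_
  rw [Finset.smul_sum]
  refine Finset.sum_congr rfl fun ρ' _ => ?_
  rw [momMode_eq, momMode_eq, conjTranspose_smul, smul_mul_smul_comm, smul_smul, smul_smul]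
  congr 1
  simp
  ring

theorem quad_momMode_add (M N : Zone L → Matrix (Fin 2) (Fin 2) ℂ) :
    quad (momMode L) (blockDiagonal M) + quad (momMode L) (blockDiagonal N)
      = quad (momMode L) (blockDiagonal fun n => M n + N n) := by
  rw [← quad_add, ← blockDiagonal_add]; rfl

theorem quad_momMode_sub (M N : Zone L → Matrix (Fin 2) (Fin 2) ℂ) :
    quad (momMode L) (blockDiagonal M) - quad (momMode L) (blockDiagonal N)
      = quad (momMode L) (blockDiagonal fun n => M n - N n) := by
  rw [← quad_sub, ← blockDiagonal_sub]; rfl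

theorem quad_momMode_smul (c : ℂ) (M : Zone L → Matrix (Fin 2) (Fin 2) ℂ) :
    c • quad (momMode L) (blockDiagonal M)
      = quad (momMode L) (blockDiagonal fun n => c • M n) := by
  rw [← quad_smul, ← blockDiagonal_smul]; rfl

theorem hamiltonian_eq :
    hamiltonian P L = quad (momMode L)
      (blockDiagonal fun n : Zone L => bloch P (angle L n.1.1) (angle L n.1.2)) := by
  have h0 : ∀ ρ ρ' : Fin 2, ∑ x : Torus L, psiDag L x ρ * psi L x ρ'
      = quad (momMode L) (blockDiagonal fun _ : Zone L => Matrix.single ρ ρ' (1 : ℂ)) := by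
    intro ρ ρ'
    have := hop_eq L 0 ρ ρ'
    simpa only [add_zero, planeWave_zero, star_one, one_smul] using this
  have hs : ∀ (g : Torus L) (ρ ρ' : Fin 2), ∑ x : Torus L, psiDag L x ρ * psi L (x - g) ρ'
      = quad (momMode L) (blockDiagonal fun n : Zone L =>
          planeWave L n.1 g • Matrix.single ρ ρ' (1 : ℂ)) := by
    intro g ρ ρ'
    simp only [sub_eq_add_neg, hop_eq, planeWave_neg, star_star]
  have hg : ∀ n : Zone L, planeWave L n.1 (gamT L 0) = rootPhase L n.1.1 * star (rootPhase L n.1.2) ∧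
      planeWave L n.1 (gamT L 1) = rootPhase L n.1.2 ∧
      planeWave L n.1 (gamT L 2) = star (rootPhase L n.1.1) := by
    intro n
    refine ⟨?_, ?_, ?_⟩
    · have : gamT L 0 = (1, 0) + -(0, 1) := by simp [gamT]
      rw [this, planeWave_add, planeWave_neg, planeWave_one_zero, planeWave_zero_one]
    · have : gamT L 1 = (0, 1) := by simp [gamT]
      rw [this, planeWave_zero_one]
    · have : gamT L 2 = -(1, 0) := by simp [gamT]
      rw [this, planeWave_neg, planeWave_one_zero]
  have hNN : hopNN L = quad (momMode L) (blockDiagonal fun n : Zone L =>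
      latticeSum (angle L n.1.1) (angle L n.1.2) • Matrix.single 0 1 (1 : ℂ)) := by
    simp only [hopNN, mul_add, Finset.sum_add_distrib, h0, hs, quad_momMode_add,
      planeWave_one_zero, planeWave_zero_one, latticeSum, add_smul, one_smul, rootPhase_eq]
  have hNNN : hopNNN P L = quad (momMode L) (blockDiagonal fun n : Zone L =>
      !![((2 * (Real.cos (P.φ - (angle L n.1.1 - angle L n.1.2)) + Real.cos (P.φ - angle L n.1.2)
            + Real.cos (P.φ + angle L n.1.1)) : ℝ) : ℂ), 0;
        0, ((2 * (Real.cos (P.φ + (angle L n.1.1 - angle L n.1.2)) + Real.cos (P.φ + angle L n.1.2)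
            + Real.cos (P.φ - angle L n.1.1)) : ℝ) : ℂ)]) := by
    rw [hopNNN, Finset.sum_comm, Fin.sum_univ_three]
    simp only [Finset.sum_add_distrib, ← Finset.smul_sum, hop_eq, hs, quad_momMode_add,
      quad_momMode_smul, hg]
    congr 2
    funext n
    simp only [star_mul', star_star]
    simp only [star_rootPhase_eq]
    simp only [rootPhase_eq]
    ext i j
    fin_cases i <;> fin_cases j
    · simp [Complex.cos, ← Complex.exp_add]
      ring_nf
    · simp
    · simp
    · simp [Complex.cos, ← Complex.exp_add]
      ring_nf
  have hN : number L = quad (momMode L) (blockDiagonal fun _ : Zone L =>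
      Matrix.single 0 0 (1 : ℂ) + Matrix.single 1 1 (1 : ℂ)) := by
    simp only [number, Fin.sum_univ_two, Finset.sum_add_distrib, h0, quad_momMode_add]
  have hNNs : (hopNN L)ᴴ = quad (momMode L) (blockDiagonal fun n : Zone L =>
      star (latticeSum (angle L n.1.1) (angle L n.1.2)) • Matrix.single 1 0 (1 : ℂ)) := by
    rw [hNN, quad_conjTranspose, blockDiagonal_conjTranspose]
    simp only [conjTranspose_smul, conjTranspose_single, star_one]
  rw [hamiltonian, hamiltonian₀, hNNs, hNN, hNNN, hN]
  simp only [Finset.sum_sub_distrib, h0, quad_momMode_add, quad_momMode_smul, quad_momMode_sub]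
  congr 2
  funext n
  ext i j
  fin_cases i <;> fin_cases j
  · simp [bloch, blochShift, blochMass, Complex.cos_sub, Complex.cos_add, Complex.sin_sub]
    ring
  · simp [bloch]
  · simp [bloch]
  · simp [bloch, blochShift, blochMass, Complex.cos_sub, Complex.cos_add, Complex.sin_sub]
    ring

/-- The Fourier transformed current-current bubble at one momentum. -/
noncomputable def fiber (β ω x y : ℝ) : ℂ :=
  bubbleHat β ω (bloch P x y) (vertexX P x y) (vertexY P x y)

theorem matsubara_phase {β : ℝ} (hβ : 0 < β) (p₀ : ℝ) :
    Complex.exp (-(Complex.I * (matsubara β p₀ : ℝ) * β)) = 1 := by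
  rw [Complex.exp_eq_one_iff]
  refine ⟨-⌊β * p₀ / (2 * Real.pi)⌋, ?_⟩
  have : (β : ℂ) ≠ 0 := by exact_mod_cast hβ.ne'
  rw [matsubara]
  push_cast
  field_simp

theorem correlation_eq {β : ℝ} (hβ : 0 < β) (p₀ : ℝ) :
    correlation P L 0 1 β p₀ = 1 / (L : ℂ) ^ 2 * ∑ n ∈ zoneIndex L ×ˢ zoneIndex L,
      fiber P β (matsubara β p₀) (angle L n.1) (angle L n.2) := by
  have hv := fun n : Zone L => vertex_eq P n.1 L
  have hβ' : (β : ℂ) ≠ 0 := by exact_mod_cast hβ.ne'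
  rw [correlation, hamiltonian_eq, current_eq, current_eq,
    (isCAR_momMode L).integral_timeOrdered _ _ _ hβ (matsubara_phase hβ p₀),
    bubbleHat_blockDiagonal fun n : Zone L => bloch_isHermitian P _ _]
  · simp only [hv]
    rw [← Finset.sum_coe_sort (zoneIndex L ×ˢ zoneIndex L)]
    simp only [fiber, angle]
    field_simp
  · rw [Matrix.IsHermitian, blockDiagonal_conjTranspose]
    congr 1
    funext n
    exact bloch_isHermitian P _ _

end Hamiltonian

/-! ### Riemann sums -/

section Riemann

/-- A Riemann sum is exactly the integral of a step function, so that its convergence becomes a case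
of dominated convergence. -/
theorem integral_floor_step (L : ℕ) [NeZero L] (g : ℝ → ℂ) :
    ∫ s in (0 : ℝ)..1, g (⌊L * s⌋₊ / L) = 1 / (L : ℂ) * ∑ i ∈ Finset.range L, g (i / L) := by
  have hL : (0 : ℝ) < L := Nat.cast_pos.2 (Nat.pos_of_ne_zero (NeZero.ne L))
  have hcell : ∀ i : ℕ, ∀ s ∈ Set.uIoo ((i : ℝ) / L) (((i + 1 : ℕ) : ℝ) / L),
      g (⌊L * s⌋₊ / L) = g (i / L) := by
    intro i s hs
    rw [Set.uIoo_of_le (by gcongr; simp), Set.mem_Ioo, div_lt_iff₀ hL, lt_div_iff₀ hL] at hs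
    have : ⌊L * s⌋₊ = i := by
      rw [Nat.floor_eq_iff (by nlinarith [(Nat.cast_nonneg i : (0 : ℝ) ≤ i)])]
      push_cast at hs
      constructor <;> nlinarith
    rw [this]
  have hint : ∀ i < L, IntervalIntegrable (fun s => g (⌊L * s⌋₊ / L)) MeasureTheory.volume
      ((i : ℝ) / L) (((i + 1 : ℕ) : ℝ) / L) := by
    intro i _
    exact (intervalIntegrable_congr_uIoo (hcell i)).2 intervalIntegrable_const
  have h := intervalIntegral.sum_integral_adjacent_intervals (a := fun i : ℕ => (i : ℝ) / L) hint
  rw [Nat.cast_zero, zero_div, div_self hL.ne'] at h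
  rw [← h, Finset.mul_sum]
  refine Finset.sum_congr rfl fun i _ => ?_
  rw [intervalIntegral.integral_congr_uIoo (hcell i), intervalIntegral.integral_const,
    ← sub_div, Nat.cast_succ, add_sub_cancel_left, Complex.real_smul]
  push_cast
  rfl

theorem tendsto_floor_div (s : ℝ) (hs : 0 ≤ s) :
    Tendsto (fun n : ℕ => ((⌊((n + 1 : ℕ) : ℝ) * s⌋₊ : ℕ) : ℝ) / ((n + 1 : ℕ) : ℝ)) atTop (𝓝 s) := by
  have h := (tendsto_nat_floor_mul_div_atTop hs).comp
    (tendsto_natCast_atTop_atTop.comp (tendsto_add_atTop_nat 1))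
  refine h.congr fun n => ?_
  simp only [Function.comp_apply]
  rw [mul_comm]

theorem floor_div_mem_Icc (n : ℕ) {s : ℝ} (hs : s ∈ Set.Icc (0 : ℝ) 1) :
    ((⌊((n + 1 : ℕ) : ℝ) * s⌋₊ : ℕ) : ℝ) / ((n + 1 : ℕ) : ℝ) ∈ Set.Icc (0 : ℝ) 1 := by
  have hL : (0 : ℝ) < ((n + 1 : ℕ) : ℝ) := by positivity
  refine ⟨by positivity, ?_⟩
  rw [div_le_one hL]
  calc ((⌊((n + 1 : ℕ) : ℝ) * s⌋₊ : ℕ) : ℝ) ≤ ((n + 1 : ℕ) : ℝ) * s :=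
        Nat.floor_le (mul_nonneg hL.le hs.1)
    _ ≤ ((n + 1 : ℕ) : ℝ) * 1 := by gcongr; exact hs.2
    _ = _ := mul_one _

/-- Convergence of two-dimensional Riemann sums of a continuous function. -/
theorem tendsto_riemannSum {F : ℝ → ℝ → ℂ} (hF : Continuous fun p : ℝ × ℝ => F p.1 p.2) :
    Tendsto (fun n : ℕ => 1 / ((n + 1 : ℕ) : ℂ) ^ 2 * ∑ i ∈ Finset.range (n + 1),
        ∑ j ∈ Finset.range (n + 1), F (i / (n + 1 : ℕ)) (j / (n + 1 : ℕ))) atTop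
      (𝓝 (∫ s in (0 : ℝ)..1, ∫ t in (0 : ℝ)..1, F s t)) := by
  obtain ⟨M, hM⟩ := ((isCompact_Icc (a := (0 : ℝ)) (b := 1)).prod
    (isCompact_Icc (a := (0 : ℝ)) (b := 1))).exists_bound_of_continuousOn hF.continuousOn
  have hM' : ∀ s ∈ Set.Icc (0 : ℝ) 1, ∀ t ∈ Set.Icc (0 : ℝ) 1, ‖F s t‖ ≤ M :=
    fun s hs t ht => hM (s, t) ⟨hs, ht⟩
  set φ : ℕ → ℝ → ℝ := fun n s => ((⌊((n + 1 : ℕ) : ℝ) * s⌋₊ : ℕ) : ℝ) / ((n + 1 : ℕ) : ℝ) with hφ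
  have hφm : ∀ n, Measurable (φ n) := by
    intro n
    simp only [hφ]
    fun_prop
  have hstep : ∀ n : ℕ, 1 / ((n + 1 : ℕ) : ℂ) ^ 2 * ∑ i ∈ Finset.range (n + 1),
      ∑ j ∈ Finset.range (n + 1), F (i / (n + 1 : ℕ)) (j / (n + 1 : ℕ))
      = ∫ s in (0 : ℝ)..1, ∫ t in (0 : ℝ)..1, F (φ n s) (φ n t) := by
    intro n
    simp only [hφ]
    rw [integral_floor_step (n + 1)
      (fun s => ∫ t in (0 : ℝ)..1, F s (((⌊((n + 1 : ℕ) : ℝ) * t⌋₊ : ℕ) : ℝ) / ((n + 1 : ℕ) : ℝ)))]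
    have h1 : ∀ s, ∫ t in (0 : ℝ)..1, F s (((⌊((n + 1 : ℕ) : ℝ) * t⌋₊ : ℕ) : ℝ) / ((n + 1 : ℕ) : ℝ))
        = 1 / ((n + 1 : ℕ) : ℂ) * ∑ j ∈ Finset.range (n + 1), F s (j / (n + 1 : ℕ)) :=
      fun s => integral_floor_step (n + 1) (F s)
    simp only [h1]
    rw [← Finset.mul_sum, ← mul_assoc]
    congr 1
    rw [div_mul_div_comm, one_mul, sq]
  have hmem : ∀ {s : ℝ}, s ∈ Set.uIoc (0 : ℝ) 1 → s ∈ Set.Icc (0 : ℝ) 1 := by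
    intro s hs
    rw [Set.uIoc_of_le zero_le_one] at hs
    exact ⟨hs.1.le, hs.2⟩
  simp only [hstep]
  refine intervalIntegral.tendsto_integral_filter_of_dominated_convergence (fun _ => M) ?_ ?_ ?_ ?_
  · refine Eventually.of_forall fun n => ?_
    have : (fun s => ∫ t in (0 : ℝ)..1, F (φ n s) (φ n t)) = fun s =>
        1 / ((n + 1 : ℕ) : ℂ) * ∑ j ∈ Finset.range (n + 1), F (φ n s) (j / (n + 1 : ℕ)) := by
      funext s
      exact integral_floor_step (n + 1) (fun t => F (φ n s) t)
    rw [this]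
    refine Measurable.aestronglyMeasurable ?_
    refine Measurable.const_mul (Finset.measurable_fun_sum _ fun j _ => ?_) _
    exact hF.measurable.comp ((hφm n).prodMk measurable_const)
  · refine Eventually.of_forall fun n => Eventually.of_forall fun s hs => ?_
    refine (intervalIntegral.norm_integral_le_of_norm_le_const (C := M) fun t ht => ?_).trans ?_
    · exact hM' _ (floor_div_mem_Icc n (hmem hs)) _ (floor_div_mem_Icc n (hmem ht))
    · simp
  · exact intervalIntegrable_const
  · refine Eventually.of_forall fun s hs => ?_
    refine intervalIntegral.tendsto_integral_filter_of_dominated_convergence (fun _ => M) ?_ ?_ ?_ ?_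
    · refine Eventually.of_forall fun n => Measurable.aestronglyMeasurable ?_
      exact hF.measurable.comp (measurable_const.prodMk (hφm n))
    · refine Eventually.of_forall fun n => Eventually.of_forall fun t ht => ?_
      exact hM' _ (floor_div_mem_Icc n (hmem hs)) _ (floor_div_mem_Icc n (hmem ht))
    · exact intervalIntegrable_const
    · refine Eventually.of_forall fun t ht => ?_
      exact (hF.tendsto (s, t)).comp ((tendsto_floor_div s (hmem hs).1).prodMk_nhds
        (tendsto_floor_div t (hmem ht).1))

end Riemann

/-! ### Integration of doubly periodic functions -/

section Periodic

/-- The integral over a period cell with corner `(a, b)`. -/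
noncomputable def cellIntegral (a b : ℝ) (f : ℝ → ℝ → ℂ) : ℂ :=
  ∫ x in a..(a + 2 * Real.pi), ∫ y in b..(b + 2 * Real.pi), f x y

theorem cellIntegral_eq {f : ℝ → ℝ → ℂ} (h1 : ∀ y, Function.Periodic (fun x => f x y) (2 * Real.pi))
    (h2 : ∀ x, Function.Periodic (f x) (2 * Real.pi)) (a b a' b' : ℝ) :
    cellIntegral a b f = cellIntegral a' b' f := by
  have e : ∀ x, ∫ y in b..(b + 2 * Real.pi), f x y = ∫ y in b'..(b' + 2 * Real.pi), f x y :=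
    fun x => (h2 x).intervalIntegral_add_eq b b'
  simp only [cellIntegral, e]
  refine Function.Periodic.intervalIntegral_add_eq (fun x => ?_) a a'
  have := fun y => h1 y x
  simp only at this
  simp only [this]

theorem integrableOn_uIoc_prod_uIoc {f : ℝ × ℝ → ℂ} (hf : Continuous f) (a b c d : ℝ) :
    MeasureTheory.IntegrableOn f (Set.uIoc a b ×ˢ Set.uIoc c d) :=
  (hf.continuousOn.integrableOn_compact (isCompact_uIcc.prod isCompact_uIcc)).mono_set
    (Set.prod_mono Set.uIoc_subset_uIcc Set.uIoc_subset_uIcc)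

/-- The reflection combines two sign changes with an exchange of the coordinates: Fubini handles the
exchange, and periodicity restores the displaced cell. -/
theorem cellIntegral_reflect {f : ℝ → ℝ → ℂ} (hf : Continuous fun p : ℝ × ℝ => f p.1 p.2)
    (h1 : ∀ y, Function.Periodic (fun x => f x y) (2 * Real.pi))
    (h2 : ∀ x, Function.Periodic (f x) (2 * Real.pi)) (a b : ℝ) :
    cellIntegral a b (fun x y => f (-y) (-x)) = cellIntegral a b f := by
  have e1 : ∀ x, ∫ y in b..(b + 2 * Real.pi), f (-y) (-x)
      = ∫ y in (-(b + 2 * Real.pi))..(-(b + 2 * Real.pi) + 2 * Real.pi), f y (-x) := by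
    intro x
    rw [intervalIntegral.integral_comp_neg (fun y => f y (-x))]
    congr 1
    ring
  have e2 : ∫ x in a..(a + 2 * Real.pi), ∫ y in b..(b + 2 * Real.pi), f (-y) (-x)
      = ∫ x in (-(a + 2 * Real.pi))..(-(a + 2 * Real.pi) + 2 * Real.pi),
        ∫ y in (-(b + 2 * Real.pi))..(-(b + 2 * Real.pi) + 2 * Real.pi), f y x := by
    simp only [e1]
    rw [intervalIntegral.integral_comp_neg (fun x =>
      ∫ y in (-(b + 2 * Real.pi))..(-(b + 2 * Real.pi) + 2 * Real.pi), f y x)]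
    congr 1
    ring
  rw [cellIntegral, e2, MeasureTheory.intervalIntegral_intervalIntegral_swap]
  · exact cellIntegral_eq h1 h2 _ _ _ _
  · exact integrableOn_uIoc_prod_uIoc (f := Function.uncurry fun x y => f y x)
      (hf.comp continuous_swap) _ _ _ _

theorem cellIntegral_zero (f : ℝ → ℝ → ℂ) :
    ∫ s in (0 : ℝ)..1, ∫ t in (0 : ℝ)..1, f (2 * Real.pi * s) (2 * Real.pi * t)
      = 1 / (4 * (Real.pi : ℂ) ^ 2) * cellIntegral 0 0 f := by
  have h2 : (2 * Real.pi) ≠ 0 := by positivity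
  have e1 : ∀ x, ∫ t in (0 : ℝ)..1, f x (2 * Real.pi * t)
      = (2 * Real.pi)⁻¹ • ∫ y in (0 : ℝ)..(2 * Real.pi), f x y := by
    intro x
    rw [intervalIntegral.integral_comp_mul_left (fun y => f x y) h2, mul_zero, mul_one]
  simp only [e1]
  rw [intervalIntegral.integral_comp_mul_left
    (fun x => (2 * Real.pi)⁻¹ • ∫ y in (0 : ℝ)..(2 * Real.pi), f x y) h2, mul_zero, mul_one,
    intervalIntegral.integral_smul, cellIntegral, zero_add, smul_smul, Complex.real_smul]
  congr 1
  push_cast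
  field_simp
  norm_num

end Periodic

/-! ### Reflection symmetry of the fiber and the thermodynamic limit. -/

section Fiber

variable (P : Params)

/-- Transposition sends τ to β - τ, which at a Matsubara frequency is the same as ω ↦ -ω. The
overall sign comes from the one observable that is odd under the reflection. -/
theorem bubbleHat_reflect {κ : Type} [Fintype κ] [DecidableEq κ] {h : Matrix κ κ ℂ}
    (hh : h.IsHermitian) (A B : Matrix κ κ ℂ) {β ω : ℝ}
    (hω : Complex.exp (-(Complex.I * ω * β)) = 1) :
    bubbleHat β ω hᵀ (-Aᵀ) Bᵀ = -bubbleHat β (-ω) h A B := by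
  have e1 : ∀ τ : ℝ, Complex.exp (-(Complex.I * ω * τ)) * bubble β hᵀ (-Aᵀ) Bᵀ τ
      = -(Complex.exp (-(Complex.I * (-ω : ℝ) * (β - τ : ℝ))) * bubble β h A B (β - τ)) := by
    intro τ
    have e2 : bubble β hᵀ (-Aᵀ) Bᵀ τ = -bubble β hᵀ Aᵀ Bᵀ τ := by
      simp only [bubble, neg_mul, trace_neg]
    have e3 : Complex.exp (-(Complex.I * (-ω : ℝ) * (β - τ : ℝ)))
        = Complex.exp (-(Complex.I * ω * τ)) := by
      rw [← mul_one (Complex.exp (-(Complex.I * (-ω : ℝ) * (β - τ : ℝ)))), ← hω, ← Complex.exp_add]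
      congr 1
      push_cast
      ring
    rw [e2, bubble_transpose hh, e3, mul_neg]
  simp only [bubbleHat, e1]
  rw [intervalIntegral.integral_neg, intervalIntegral.integral_comp_sub_left
    (fun τ => Complex.exp (-(Complex.I * (-ω : ℝ) * τ)) * bubble β h A B τ), sub_self, sub_zero]

theorem fiber_reflect {β ω : ℝ} (hω : Complex.exp (-(Complex.I * ω * β)) = 1) (x y : ℝ) :
    fiber P β ω (-y) (-x) = -fiber P β (-ω) x y := by
  rw [fiber, bloch_reflect, vertexX_reflect, vertexY_reflect,
    bubbleHat_reflect (bloch_isHermitian P x y) _ _ hω, fiber]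

theorem continuous_fiber (β ω : ℝ) : Continuous fun p : ℝ × ℝ => fiber P β ω p.1 p.2 :=
  continuous_bubbleHat β ω (continuous_bloch P) (fun _ => bloch_isHermitian P _ _)
    (continuous_vertexX P) (continuous_vertexY P)

theorem exp_I_mul_add_two_pi (x : ℝ) :
    Complex.exp (Complex.I * ((x + 2 * Real.pi : ℝ) : ℂ)) = Complex.exp (Complex.I * x) := by
  push_cast
  rw [mul_add, show Complex.I * (2 * (Real.pi : ℂ)) = 2 * Real.pi * Complex.I by ring,
    Complex.exp_periodic]

theorem fiber_periodic_left (β ω y : ℝ) :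
    Function.Periodic (fun x => fiber P β ω x y) (2 * Real.pi) := by
  intro x
  have e1 : blochShift P (x + 2 * Real.pi) y = blochShift P x y := by
    simp only [blochShift, show x + 2 * Real.pi - y = x - y + 2 * Real.pi by ring,
      Real.cos_add_two_pi]
  have e2 : blochMass P (x + 2 * Real.pi) y = blochMass P x y := by
    simp only [blochMass, show x + 2 * Real.pi - y = x - y + 2 * Real.pi by ring,
      Real.sin_add_two_pi]
  have e3 : latticeSum (x + 2 * Real.pi) y = latticeSum x y := by
    simp only [latticeSum, exp_I_mul_add_two_pi]
  have e4 : Real.sin (P.φ + (x + 2 * Real.pi)) = Real.sin (P.φ + x) := by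
    rw [← add_assoc, Real.sin_add_two_pi]
  have e5 : Real.sin (P.φ - (x + 2 * Real.pi)) = Real.sin (P.φ - x) := by
    rw [← sub_sub, Real.sin_sub_two_pi]
  have e6 : Real.sin (P.φ - (x + 2 * Real.pi) + y) = Real.sin (P.φ - x + y) := by
    rw [show P.φ - (x + 2 * Real.pi) + y = P.φ - x + y - 2 * Real.pi by ring, Real.sin_sub_two_pi]
  have e7 : Real.sin (P.φ + (x + 2 * Real.pi) - y) = Real.sin (P.φ + x - y) := by
    rw [show P.φ + (x + 2 * Real.pi) - y = P.φ + x - y + 2 * Real.pi by ring, Real.sin_add_two_pi]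
  simp only [fiber, bloch, vertexX, vertexY, e1, e2, e3, e4, e5, e6, e7, Complex.exp_neg,
    exp_I_mul_add_two_pi]

theorem fiber_periodic_right (β ω x : ℝ) :
    Function.Periodic (fiber P β ω x) (2 * Real.pi) := by
  intro y
  have e1 : blochShift P x (y + 2 * Real.pi) = blochShift P x y := by
    simp only [blochShift, show x - (y + 2 * Real.pi) = x - y - 2 * Real.pi by ring,
      Real.cos_sub_two_pi, Real.cos_add_two_pi]
  have e2 : blochMass P x (y + 2 * Real.pi) = blochMass P x y := by
    simp only [blochMass, show x - (y + 2 * Real.pi) = x - y - 2 * Real.pi by ring,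
      Real.sin_sub_two_pi, Real.sin_add_two_pi]
  have e3 : latticeSum x (y + 2 * Real.pi) = latticeSum x y := by
    simp only [latticeSum, exp_I_mul_add_two_pi]
  have e4 : Real.sin (P.φ + (y + 2 * Real.pi)) = Real.sin (P.φ + y) := by
    rw [← add_assoc, Real.sin_add_two_pi]
  have e5 : Real.sin (P.φ - (y + 2 * Real.pi)) = Real.sin (P.φ - y) := by
    rw [← sub_sub, Real.sin_sub_two_pi]
  have e6 : Real.sin (P.φ - x + (y + 2 * Real.pi)) = Real.sin (P.φ - x + y) := by
    rw [← add_assoc, Real.sin_add_two_pi]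
  have e7 : Real.sin (P.φ + x - (y + 2 * Real.pi)) = Real.sin (P.φ + x - y) := by
    rw [← sub_sub, Real.sin_sub_two_pi]
  simp only [fiber, bloch, vertexX, vertexY, e1, e2, e3, e4, e5, e6, e7, Complex.exp_neg,
    exp_I_mul_add_two_pi]

/-- The part of the fiber that survives the reflection symmetry. -/
noncomputable def oddFiber (β ω x y : ℝ) : ℂ := (fiber P β ω x y - fiber P β (-ω) x y) / 2

/-- By the reflection, the integrated fiber is an odd function of ω and thus equals its own odd
part. The corner of the cell is left free so that the gapless point can later be placed at the
centre. -/
theorem cellIntegral_fiber {β ω : ℝ} (hω : Complex.exp (-(Complex.I * ω * β)) = 1)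
    (a b a' b' : ℝ) :
    cellIntegral a b (fiber P β ω) = cellIntegral a' b' (oddFiber P β ω) := by
  have hc := continuous_fiber P β ω
  have hc' := continuous_fiber P β (-ω)
  have hr := cellIntegral_reflect hc (fiber_periodic_left P β ω) (fiber_periodic_right P β ω) a' b'
  simp only [fiber_reflect P hω] at hr
  rw [cellIntegral_eq (fiber_periodic_left P β ω) (fiber_periodic_right P β ω) a b a' b']
  have hi : ∀ ω x, IntervalIntegrable (fun y => fiber P β ω x y) MeasureTheory.volume b'
      (b' + 2 * Real.pi) := fun ω x =>
    ((continuous_fiber P β ω).comp (Continuous.prodMk_right x)).intervalIntegrable _ _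
  have hi2 : ∀ ω, IntervalIntegrable (fun x => ∫ y in b'..(b' + 2 * Real.pi), fiber P β ω x y)
      MeasureTheory.volume a' (a' + 2 * Real.pi) := fun ω =>
    (intervalIntegral.continuous_parametric_intervalIntegral_of_continuous'
      (continuous_fiber P β ω) _ _).intervalIntegrable _ _
  have e : cellIntegral a' b' (oddFiber P β ω)
      = (cellIntegral a' b' (fiber P β ω) - cellIntegral a' b' (fiber P β (-ω))) / 2 := by
    simp only [cellIntegral, oddFiber, intervalIntegral.integral_div,
      intervalIntegral.integral_sub (hi _ _) (hi _ _),
      intervalIntegral.integral_sub (hi2 _) (hi2 _)]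
  have e2 : cellIntegral a' b' (fun x y => -fiber P β (-ω) x y)
      = -cellIntegral a' b' (fiber P β (-ω)) := by
    simp only [cellIntegral, intervalIntegral.integral_neg]
  rw [e2] at hr
  rw [e]
  linear_combination -(1 / 2 : ℂ) * hr

/-- The thermodynamic limit. -/
theorem tendsto_correlation {β : ℝ} (hβ : 0 < β) (p₀ a b : ℝ) :
    Tendsto (fun n : ℕ => correlation P (n + 1) 0 1 β p₀) atTop
      (𝓝 (1 / (4 * (Real.pi : ℂ) ^ 2) * cellIntegral a b (oddFiber P β (matsubara β p₀)))) := by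
  rw [← cellIntegral_fiber P (matsubara_phase hβ p₀) 0 0 a b, ← cellIntegral_zero]
  have hc : Continuous fun p : ℝ × ℝ => fiber P β (matsubara β p₀) (2 * Real.pi * p.1)
      (2 * Real.pi * p.2) :=
    (continuous_fiber P β (matsubara β p₀)).comp
      (f := fun p : ℝ × ℝ => (2 * Real.pi * p.1, 2 * Real.pi * p.2)) (by fun_prop)
  refine (tendsto_riemannSum (F := fun s t => fiber P β (matsubara β p₀) (2 * Real.pi * s)
    (2 * Real.pi * t)) hc).congr fun n => ?_
  rw [correlation_eq P (n + 1) hβ]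
  congr 1
  have hper : ∀ m : ℤ, angle (n + 1) (m + (n + 1 : ℕ)) = angle (n + 1) m + 2 * Real.pi := by
    intro m
    rw [angle, angle]
    push_cast
    field_simp
  rw [Finset.sum_product]
  rw [sum_zoneIndex (n + 1) (f := fun i => ∑ j ∈ zoneIndex (n + 1),
    fiber P β (matsubara β p₀) (angle (n + 1) i) (angle (n + 1) j))]
  · refine Finset.sum_congr rfl fun i _ => ?_
    rw [sum_zoneIndex (n + 1) (f := fun j =>
      fiber P β (matsubara β p₀) (angle (n + 1) i) (angle (n + 1) j))]
    · refine Finset.sum_congr rfl fun j _ => ?_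
      simp only [angle, Int.cast_natCast, mul_div_assoc]
    · intro m
      rw [hper]
      exact fiber_periodic_right P β _ _ _
  · intro m
    rw [hper]
    exact Finset.sum_congr rfl fun j _ => fiber_periodic_left P β _ _ _

end Fiber

/-! ### Evaluation of the bubble of a two-level system -/

section TwoLevel

variable {κ : Type} [Fintype κ] [DecidableEq κ]

/-- Detailed balance: the factor e^{βd} - 1 produced by the time integral turns a product of
occupations into a difference of Fermi functions. -/
theorem fermi_mul_one_sub (β a b : ℝ) :
    fermi β a * (1 - fermi β b) * (Real.exp (β * (a - b)) - 1) = fermi β b - fermi β a := by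
  have h1 : (1 + Real.exp (β * a)) ≠ 0 := by positivity
  have h2 : (1 + Real.exp (β * b)) ≠ 0 := by positivity
  have h3 : Real.exp (β * (a - b)) = Real.exp (β * a) / Real.exp (β * b) := by
    rw [← Real.exp_sub]; ring_nf
  rw [fermi, fermi, h3]
  field_simp
  ring

theorem integral_exp_mul_exp {β ω d : ℝ} (hω : Complex.exp (-(Complex.I * ω * β)) = 1)
    (hd : (d : ℂ) - Complex.I * ω ≠ 0) :
    ∫ τ in (0 : ℝ)..β, Complex.exp (-(Complex.I * ω * τ)) * Complex.exp (τ * d)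
      = ((Real.exp (β * d) - 1 : ℝ) : ℂ) / (d - Complex.I * ω) := by
  have e : ∀ τ : ℝ, Complex.exp (-(Complex.I * ω * τ)) * Complex.exp (τ * d)
      = Complex.exp ((d - Complex.I * ω) * τ) := by
    intro τ
    rw [← Complex.exp_add]
    congr 1
    ring
  simp only [e]
  rw [integral_exp_mul_complex hd, Complex.ofReal_zero, mul_zero, Complex.exp_zero, sub_mul,
    sub_eq_add_neg ((d : ℂ) * β), Complex.exp_add, hω]
  push_cast
  rw [mul_one, mul_comm (d : ℂ)]

/-- The projection onto the upper (`s = 1`) or lower (`s = -1`) level of a traceless two-level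
Hamiltonian with square `E²`. -/
noncomputable def levelProj (X : Matrix κ κ ℂ) (E s : ℝ) : Matrix κ κ ℂ :=
  (1 / 2 : ℂ) • (1 + ((s / E : ℝ) : ℂ) • X)

variable {X : Matrix κ κ ℂ} {E : ℝ}

theorem levelProj_add (X : Matrix κ κ ℂ) (E : ℝ) : levelProj X E 1 + levelProj X E (-1) = 1 := by
  rw [levelProj, levelProj, ← smul_add, neg_div, Complex.ofReal_neg, neg_smul]
  rw [show (1 : Matrix κ κ ℂ) + ((1 / E : ℝ) : ℂ) • X + (1 + -(((1 / E : ℝ) : ℂ) • X))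
    = (2 : ℂ) • 1 by rw [two_smul]; abel, smul_smul]
  norm_num

theorem mul_levelProj (hE : E ≠ 0) (hX : X * X = ((E ^ 2 : ℝ) : ℂ) • 1) (e₀ s : ℝ) (hs : s ^ 2 = 1) :
    ((e₀ : ℂ) • 1 + X) * levelProj X E s = levelProj X E s * (((e₀ + s * E : ℝ) : ℂ) • 1) := by
  have hE' : (E : ℂ) ≠ 0 := by exact_mod_cast hE
  have hs' : (s : ℂ) ^ 2 = 1 := by exact_mod_cast hs
  have h1 : X * levelProj X E s = ((s * E : ℝ) : ℂ) • levelProj X E s := by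
    rw [levelProj, mul_smul_comm, mul_add, mul_one, mul_smul_comm, hX, smul_comm _ (1 / 2 : ℂ)]
    congr 1
    rw [smul_add, smul_smul, smul_smul, add_comm]
    have a1 : ((s / E : ℝ) : ℂ) * ((E ^ 2 : ℝ) : ℂ) = ((s * E : ℝ) : ℂ) := by
      push_cast; field_simp
    have a2 : ((s * E : ℝ) : ℂ) * ((s / E : ℝ) : ℂ) = 1 := by
      push_cast; field_simp; exact hs'
    rw [a1, a2, one_smul]
  rw [add_mul, h1, smul_mul_assoc, one_mul, mul_smul_comm, mul_one, ← add_smul]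
  push_cast
  rfl

theorem levelProj_mul_self (hE : E ≠ 0) (hX : X * X = ((E ^ 2 : ℝ) : ℂ) • 1) (s r : ℝ)
    (hs : s ^ 2 = 1) :
    levelProj X E r * levelProj X E s = (((1 + r * s) / 2 : ℝ) : ℂ) • levelProj X E s := by
  have h := mul_levelProj hE hX 0 s hs
  rw [Complex.ofReal_zero, zero_smul, zero_add, zero_add, mul_smul_comm, mul_one] at h
  have hE' : (E : ℂ) ≠ 0 := by exact_mod_cast hE
  conv_lhs => rw [levelProj]
  rw [smul_mul_assoc, add_mul, one_mul, smul_mul_assoc, h, smul_smul]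
  nth_rw 1 [← one_smul ℂ (levelProj X E s)]
  rw [← add_smul, smul_smul]
  congr 1
  push_cast
  field_simp

/-- Functional calculus for a two-level Hamiltonian. -/
theorem levelProj_combination_mul (hE : E ≠ 0) (hX : X * X = ((E ^ 2 : ℝ) : ℂ) • 1) (a b c d : ℂ) :
    (a • levelProj X E 1 + b • levelProj X E (-1)) * (c • levelProj X E 1 + d • levelProj X E (-1))
      = (a * c) • levelProj X E 1 + (b * d) • levelProj X E (-1) := by
  have hp := levelProj_mul_self hE hX
  have a1 : (((1 + (1 : ℝ) * 1) / 2 : ℝ) : ℂ) = 1 := by norm_num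
  have a2 : (((1 + (1 : ℝ) * (-1)) / 2 : ℝ) : ℂ) = 0 := by norm_num
  have a3 : (((1 + (-1 : ℝ) * 1) / 2 : ℝ) : ℂ) = 0 := by norm_num
  have a4 : (((1 + (-1 : ℝ) * (-1)) / 2 : ℝ) : ℂ) = 1 := by norm_num
  rw [add_mul, mul_add, mul_add, smul_mul_smul_comm, smul_mul_smul_comm, smul_mul_smul_comm,
    smul_mul_smul_comm, hp _ _ (by norm_num), hp _ _ (by norm_num), hp _ _ (by norm_num),
    hp _ _ (by norm_num), a1, a2, a3, a4, zero_smul, zero_smul, smul_zero, smul_zero,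
    one_smul, one_smul, add_zero, zero_add]

/-- On the range of either spectral projection the Hamiltonian acts as a scalar, and the two
projections sum to the identity. -/
theorem exp_twoLevel (hE : E ≠ 0) (hX : X * X = ((E ^ 2 : ℝ) : ℂ) • 1) (e₀ τ : ℝ) :
    NormedSpace.exp ((τ : ℂ) • ((e₀ : ℂ) • 1 + X))
      = ((Real.exp (τ * (e₀ + E)) : ℝ) : ℂ) • levelProj X E 1
        + ((Real.exp (τ * (e₀ - E)) : ℝ) : ℂ) • levelProj X E (-1) := by
  have h : ∀ s : ℝ, s ^ 2 = 1 → NormedSpace.exp ((τ : ℂ) • ((e₀ : ℂ) • 1 + X)) * levelProj X E s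
      = ((Real.exp (τ * (e₀ + s * E)) : ℝ) : ℂ) • levelProj X E s := by
    intro s hs
    have h1 : ((τ : ℂ) • ((e₀ : ℂ) • 1 + X)) * levelProj X E s
        = levelProj X E s * (((τ : ℂ) * ((e₀ + s * E : ℝ) : ℂ)) • 1) := by
      rw [smul_mul_assoc, mul_levelProj hE hX e₀ s hs, mul_smul_comm, mul_smul_comm, smul_smul]
    rw [exp_mul_of_intertwine h1, exp_smul_one, mul_smul_comm, mul_one]
    push_cast
    rfl
  have h1 := h 1 (by norm_num)
  have h2 := h (-1) (by norm_num)
  rw [one_mul] at h1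
  rw [neg_one_mul, ← sub_eq_add_neg] at h2
  rw [← h1, ← h2, ← mul_add, levelProj_add, mul_one]

theorem fermiMatrix_twoLevel (hE : E ≠ 0) (hX : X * X = ((E ^ 2 : ℝ) : ℂ) • 1) (e₀ β : ℝ) :
    fermiMatrix β ((e₀ : ℂ) • 1 + X)
      = ((fermi β (e₀ + E) : ℝ) : ℂ) • levelProj X E 1
        + ((fermi β (e₀ - E) : ℝ) : ℂ) • levelProj X E (-1) := by
  have hf : ∀ e : ℝ, (((1 : ℝ) + Real.exp (β * e) : ℝ) : ℂ) * ((fermi β e : ℝ) : ℂ) = 1 := by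
    intro e
    have : (1 + Real.exp (β * e)) ≠ 0 := by positivity
    rw [fermi]
    norm_cast
    field_simp
  rw [fermiMatrix, exp_twoLevel hE hX]
  apply inv_eq_right_inv
  rw [show (1 : Matrix κ κ ℂ) + (((Real.exp (β * (e₀ + E)) : ℝ) : ℂ) • levelProj X E 1
        + ((Real.exp (β * (e₀ - E)) : ℝ) : ℂ) • levelProj X E (-1))
      = (((1 : ℝ) + Real.exp (β * (e₀ + E)) : ℝ) : ℂ) • levelProj X E 1
        + (((1 : ℝ) + Real.exp (β * (e₀ - E)) : ℝ) : ℂ) • levelProj X E (-1) by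
    rw [← levelProj_add X E]; push_cast; rw [add_smul, add_smul, one_smul, one_smul]; abel]
  rw [levelProj_combination_mul hE hX, hf, hf, one_smul, one_smul, levelProj_add]

/-- The matrix elements of the bubble between two levels. -/
noncomputable def levelTrace (X A B : Matrix κ κ ℂ) (E s r : ℝ) : ℂ :=
  Matrix.trace (A * levelProj X E r * B * levelProj X E s)

theorem bubble_twoLevel (hE : E ≠ 0) (hX : X * X = ((E ^ 2 : ℝ) : ℂ) • 1) (A B : Matrix κ κ ℂ)
    (e₀ β τ : ℝ) :
    bubble β ((e₀ : ℂ) • 1 + X) A B τ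
      = levelTrace X A B E 1 1 * (fermi β (e₀ + E) * (1 - fermi β (e₀ + E)))
        + levelTrace X A B E (-1) (-1) * (fermi β (e₀ - E) * (1 - fermi β (e₀ - E)))
        + levelTrace X A B E 1 (-1) * (fermi β (e₀ + E) * (1 - fermi β (e₀ - E)))
          * Complex.exp (τ * (2 * E : ℝ))
        + levelTrace X A B E (-1) 1 * (fermi β (e₀ - E) * (1 - fermi β (e₀ + E)))
          * Complex.exp (τ * (-(2 * E) : ℝ)) := by
  have h1 : (1 : Matrix κ κ ℂ) - (((fermi β (e₀ + E) : ℝ) : ℂ) • levelProj X E 1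
        + ((fermi β (e₀ - E) : ℝ) : ℂ) • levelProj X E (-1))
      = ((1 - fermi β (e₀ + E) : ℝ) : ℂ) • levelProj X E 1
        + ((1 - fermi β (e₀ - E) : ℝ) : ℂ) • levelProj X E (-1) := by
    rw [← levelProj_add X E]; push_cast; rw [sub_smul, sub_smul, one_smul, one_smul]; abel
  have h3 : ∀ a b c d : ℂ, Matrix.trace (A * (a • levelProj X E 1 + b • levelProj X E (-1)) * B
      * (c • levelProj X E 1 + d • levelProj X E (-1)))
      = a * c * levelTrace X A B E 1 1 + a * d * levelTrace X A B E (-1) 1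
        + b * c * levelTrace X A B E 1 (-1) + b * d * levelTrace X A B E (-1) (-1) := by
    intro a b c d
    simp only [levelTrace, mul_add, add_mul, mul_smul_comm, smul_mul_assoc, trace_add,
      trace_smul, smul_eq_mul]
    ring
  have r1 : ((Real.exp (-τ * (e₀ + E)) : ℝ) : ℂ) * ((Real.exp (τ * (e₀ + E)) : ℝ) : ℂ) = 1 := by
    rw [← Complex.ofReal_mul, ← Real.exp_add]; simp
  have r2 : ((Real.exp (-τ * (e₀ - E)) : ℝ) : ℂ) * ((Real.exp (τ * (e₀ - E)) : ℝ) : ℂ) = 1 := by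
    rw [← Complex.ofReal_mul, ← Real.exp_add]; simp
  have r3 : Complex.exp (τ * (2 * E : ℝ))
      = ((Real.exp (-τ * (e₀ - E)) : ℝ) : ℂ) * ((Real.exp (τ * (e₀ + E)) : ℝ) : ℂ) := by
    conv_rhs => rw [← Complex.ofReal_mul, ← Real.exp_add, Complex.ofReal_exp]
    congr 1; push_cast; ring
  have r4 : Complex.exp (τ * (-(2 * E) : ℝ))
      = ((Real.exp (-τ * (e₀ + E)) : ℝ) : ℂ) * ((Real.exp (τ * (e₀ - E)) : ℝ) : ℂ) := by
    conv_rhs => rw [← Complex.ofReal_mul, ← Real.exp_add, Complex.ofReal_exp]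
    congr 1; push_cast; ring
  rw [bubble, holeProp, partProp, fermiMatrix_twoLevel hE hX, exp_twoLevel hE hX, exp_twoLevel hE hX,
    h1, levelProj_combination_mul hE hX, levelProj_combination_mul hE hX, h3, r3, r4]
  push_cast at r1 r2 ⊢
  linear_combination
    levelTrace X A B E 1 1 * (fermi β (e₀ + E) * (1 - fermi β (e₀ + E))) * r1
    + levelTrace X A B E (-1) (-1) * (fermi β (e₀ - E) * (1 - fermi β (e₀ - E))) * r2

/-- After expanding the projections, the terms of degree 0 and 2 in X are symmetric under exchange
of the levels and cancel. The terms linear in X assemble into the commutator. -/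
theorem levelTrace_sub (hE : E ≠ 0) (A B : Matrix κ κ ℂ) :
    levelTrace X A B E 1 (-1) - levelTrace X A B E (-1) 1
      = 1 / (2 * (E : ℂ)) * Matrix.trace (X * (A * B - B * A)) := by
  have t1 : Matrix.trace (A * B * X) = Matrix.trace (X * (A * B)) := trace_mul_comm _ _
  have t2 : Matrix.trace (A * X * B) = Matrix.trace (X * (B * A)) := by
    rw [mul_assoc, trace_mul_comm, mul_assoc]
  simp only [levelTrace, levelProj, mul_add, add_mul, mul_sub, mul_smul_comm, smul_mul_assoc,
    mul_one, trace_add, trace_sub, trace_smul, smul_eq_mul, smul_add, t1, t2, neg_div, Complex.ofReal_neg,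
    neg_smul, neg_mul, mul_neg, smul_neg, trace_neg]
  have hE' : (E : ℂ) ≠ 0 := by exact_mod_cast hE
  push_cast
  field_simp
  ring

/-- The intraband terms are constant in τ and integrate to zero at a nonzero Matsubara frequency;
only the two interband transitions remain. -/
theorem bubbleHat_twoLevel (hE : E ≠ 0) (hX : X * X = ((E ^ 2 : ℝ) : ℂ) • 1) (A B : Matrix κ κ ℂ)
    (e₀ : ℝ) {β ω : ℝ} (hω0 : ω ≠ 0) (hω : Complex.exp (-(Complex.I * ω * β)) = 1) :
    bubbleHat β ω ((e₀ : ℂ) • 1 + X) A B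
      = levelTrace X A B E 1 (-1) * (fermi β (e₀ - E) - fermi β (e₀ + E)) / (2 * E - Complex.I * ω)
        + levelTrace X A B E (-1) 1 * (fermi β (e₀ + E) - fermi β (e₀ - E))
          / (-(2 * E) - Complex.I * ω) := by
  have hn : ∀ d : ℝ, (d : ℂ) - Complex.I * ω ≠ 0 := by
    intro d h
    have := congrArg Complex.im h
    simp at this
    exact hω0 this
  have i0 : ∫ τ in (0 : ℝ)..β, Complex.exp (-(Complex.I * ω * τ)) = 0 := by
    have := integral_exp_mul_exp hω (hn 0)
    simpa using this
  have i1 := integral_exp_mul_exp hω (hn (2 * E))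
  have i2 := integral_exp_mul_exp hω (hn (-(2 * E)))
  have f1 := congrArg (fun r : ℝ => (r : ℂ)) (fermi_mul_one_sub β (e₀ + E) (e₀ - E))
  have f2 := congrArg (fun r : ℝ => (r : ℂ)) (fermi_mul_one_sub β (e₀ - E) (e₀ + E))
  rw [show e₀ + E - (e₀ - E) = 2 * E by ring] at f1
  rw [show e₀ - E - (e₀ + E) = -(2 * E) by ring] at f2
  simp only [Complex.ofReal_mul, Complex.ofReal_sub, Complex.ofReal_one] at f1 f2
  simp only [bubbleHat, bubble_twoLevel hE hX]
  set c1 := levelTrace X A B E 1 1 * (fermi β (e₀ + E) * (1 - fermi β (e₀ + E)))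
        + levelTrace X A B E (-1) (-1) * (fermi β (e₀ - E) * (1 - fermi β (e₀ - E))) with hc1
  set c2 := levelTrace X A B E 1 (-1) * (fermi β (e₀ + E) * (1 - fermi β (e₀ - E))) with hc2
  set c3 := levelTrace X A B E (-1) 1 * (fermi β (e₀ - E) * (1 - fermi β (e₀ + E))) with hc3
  have e : ∀ τ : ℝ, Complex.exp (-(Complex.I * ω * τ)) * (c1 + c2 * Complex.exp (τ * (2 * E : ℝ))
        + c3 * Complex.exp (τ * (-(2 * E) : ℝ)))
      = c1 * Complex.exp (-(Complex.I * ω * τ))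
        + c2 * (Complex.exp (-(Complex.I * ω * τ)) * Complex.exp (τ * (2 * E : ℝ)))
        + c3 * (Complex.exp (-(Complex.I * ω * τ)) * Complex.exp (τ * (-(2 * E) : ℝ))) := by
    intro τ; ring
  simp only [e]
  rw [intervalIntegral.integral_add, intervalIntegral.integral_add,
    intervalIntegral.integral_const_mul, intervalIntegral.integral_const_mul,
    intervalIntegral.integral_const_mul, i0, i1, i2, mul_zero, zero_add]
  · rw [hc2, hc3]
    push_cast at f1 f2 ⊢
    rw [← f1, ← f2]
    ring
  all_goals exact Continuous.intervalIntegrable (by fun_prop) _ _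

theorem bubbleHat_sub_twoLevel (hE : E ≠ 0) (hX : X * X = ((E ^ 2 : ℝ) : ℂ) • 1)
    (A B : Matrix κ κ ℂ) (e₀ : ℝ) {β ω : ℝ} (hω : Complex.exp (-(Complex.I * ω * β)) = 1) :
    bubbleHat β ω ((e₀ : ℂ) • 1 + X) A B - bubbleHat β (-ω) ((e₀ : ℂ) • 1 + X) A B
      = Matrix.trace (X * (A * B - B * A)) * (Complex.I *
        ((ω * (fermi β (e₀ - E) - fermi β (e₀ + E)) / (E * (4 * E ^ 2 + ω ^ 2)) : ℝ) : ℂ)) := by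
  -- At ω = 0, where the intraband terms need not vanish, both sides are trivially zero.
  by_cases hω0 : ω = 0
  · simp [hω0]
  have hω' : Complex.exp (-(Complex.I * (-ω : ℝ) * β)) = 1 := by
    rw [← _root_.inv_inj, ← Complex.exp_neg, inv_one, ← hω]
    congr 1
    push_cast
    ring
  have hn : ∀ d s : ℝ, s ≠ 0 → (d : ℂ) - Complex.I * s ≠ 0 := by
    intro d s hs h
    have := congrArg Complex.im h
    simp at this
    exact hs this
  have n1 := hn (2 * E) ω hω0
  have n2 := hn (-(2 * E)) ω hω0
  have n3 := hn (2 * E) (-ω) (neg_ne_zero.2 hω0)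
  have n4 := hn (-(2 * E)) (-ω) (neg_ne_zero.2 hω0)
  have hT := levelTrace_sub (X := X) hE A B
  rw [bubbleHat_twoLevel hE hX A B e₀ hω0 hω,
    bubbleHat_twoLevel hE hX A B e₀ (neg_ne_zero.2 hω0) hω']
  have hE' : (E : ℂ) ≠ 0 := by exact_mod_cast hE
  have n5 : (4 * (E : ℂ) ^ 2 + (ω : ℂ) ^ 2) ≠ 0 := by
    have : 4 * E ^ 2 + ω ^ 2 ≠ 0 := by positivity
    exact_mod_cast this
  have hT' : Matrix.trace (X * (A * B - B * A)) = 2 * E * (levelTrace X A B E 1 (-1) -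
      levelTrace X A B E (-1) 1) := by
    rw [hT]; field_simp
  rw [hT']
  generalize levelTrace X A B E 1 (-1) = T1
  generalize levelTrace X A B E (-1) 1 = T2
  push_cast at n1 n2 n3 n4 ⊢
  generalize (fermi β (e₀ - E) : ℂ) = f1
  generalize (fermi β (e₀ + E) : ℂ) = f2
  have q1 : (1 : ℂ) / (2 * E - Complex.I * ω) = (2 * E + Complex.I * ω) / (4 * E ^ 2 + ω ^ 2) := by
    rw [div_eq_div_iff n1 n5]; ring_nf; rw [Complex.I_sq]; ring
  have q2 : (1 : ℂ) / (-(2 * E) - Complex.I * ω) = (-(2 * E) + Complex.I * ω) / (4 * E ^ 2 + ω ^ 2) := by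
    rw [div_eq_div_iff n2 n5]; ring_nf; rw [Complex.I_sq]; ring
  have q3 : (1 : ℂ) / (2 * E - Complex.I * -ω) = (2 * E - Complex.I * ω) / (4 * E ^ 2 + ω ^ 2) := by
    rw [div_eq_div_iff n3 n5]; ring_nf; rw [Complex.I_sq]; ring
  have q4 : (1 : ℂ) / (-(2 * E) - Complex.I * -ω) = (-(2 * E) - Complex.I * ω) / (4 * E ^ 2 + ω ^ 2) := by
    rw [div_eq_div_iff n4 n5]; ring_nf; rw [Complex.I_sq]; ring
  rw [div_eq_mul_one_div _ (2 * (E : ℂ) - Complex.I * ω), q1,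
    div_eq_mul_one_div _ (-(2 * (E : ℂ)) - Complex.I * ω), q2,
    div_eq_mul_one_div _ (2 * (E : ℂ) - Complex.I * -ω), q3,
    div_eq_mul_one_div _ (-(2 * (E : ℂ)) - Complex.I * -ω), q4]
  field_simp
  ring

end TwoLevel

/-! ### Energy gap and Berry curvature -/

section Curvature

/-- The squared modulus of the structure factor. -/
noncomputable def latticeNormSq (x y : ℝ) : ℝ :=
  3 + 2 * (Real.cos (x - y) + Real.cos x + Real.cos y)

variable (P : Params)

/-- Half the distance between the two bands. -/
noncomputable def gap (x y : ℝ) : ℝ :=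
  √(blochMass P x y ^ 2 + P.t₁ ^ 2 * latticeNormSq x y)

/-- `Im (f̄ ∂ₓf)` for the structure factor `f`. -/
noncomputable def windX (x y : ℝ) : ℝ := 1 + Real.cos x + Real.cos (x - y)

/-- `Im (f̄ ∂_y f)` for the structure factor `f`. -/
noncomputable def windY (x y : ℝ) : ℝ := 1 + Real.cos y + Real.cos (x - y)

/-- `∂ₓ m`. -/
noncomputable def massX (x y : ℝ) : ℝ :=
  -(2 * P.t₂ * Real.sin P.φ * (Real.cos (x - y) - Real.cos x))

/-- `∂_y m`. -/
noncomputable def massY (x y : ℝ) : ℝ :=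
  -(2 * P.t₂ * Real.sin P.φ * (Real.cos y - Real.cos (x - y)))

/-- The numerator of the Berry curvature. -/
noncomputable def curvNum (x y : ℝ) : ℝ :=
  P.t₁ ^ 2 * (√3 / 2) *
    (3 * (blochMass P x y * Real.sin (x - y) + massX P x y * windY x y - massY P x y * windX x y)
      + ((massY P x y - massX P x y) * latticeNormSq x y
        + blochMass P x y * (Real.sin y - Real.sin x - 2 * Real.sin (x - y))))

theorem ofReal_cos_eq (x : ℝ) : ((Real.cos x : ℝ) : ℂ)
    = (Complex.exp (Complex.I * x) + (Complex.exp (Complex.I * x))⁻¹) / 2 := by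
  rw [Complex.ofReal_cos, Complex.cos, ← Complex.exp_neg]
  ring_nf

theorem ofReal_sin_eq (x : ℝ) : ((Real.sin x : ℝ) : ℂ)
    = -Complex.I * (Complex.exp (Complex.I * x) - (Complex.exp (Complex.I * x))⁻¹) / 2 := by
  rw [Complex.ofReal_sin, Complex.sin, ← Complex.exp_neg]
  ring_nf

theorem exp_I_mul_sub (x y : ℝ) : Complex.exp (Complex.I * ((x - y : ℝ) : ℂ))
    = Complex.exp (Complex.I * x) * (Complex.exp (Complex.I * y))⁻¹ := by
  rw [← Complex.exp_neg, ← Complex.exp_add]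
  congr 1
  push_cast
  ring

theorem latticeSum_mul_star (x y : ℝ) :
    latticeSum x y * star (latticeSum x y) = (latticeNormSq x y : ℂ) := by
  rw [star_latticeSum, latticeSum, latticeNormSq]
  simp only [Complex.ofReal_mul, Complex.ofReal_add, Complex.ofReal_ofNat]
  rw [Complex.exp_neg, Complex.exp_neg, ofReal_cos_eq, ofReal_cos_eq, ofReal_cos_eq, exp_I_mul_sub]
  have h1 := Complex.exp_ne_zero (Complex.I * x)
  have h2 := Complex.exp_ne_zero (Complex.I * y)
  field_simp
  ring

theorem latticeNormSq_eq (x y : ℝ) : latticeNormSq x y = ‖latticeSum x y‖ ^ 2 := by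
  have h := latticeSum_mul_star x y
  rw [Complex.star_def, Complex.mul_conj'] at h
  exact_mod_cast h.symm

theorem latticeNormSq_nonneg (x y : ℝ) : 0 ≤ latticeNormSq x y := by
  rw [latticeNormSq_eq]; positivity

/-- The traceless part of the Bloch Hamiltonian. -/
noncomputable def blochTraceless (x y : ℝ) : Matrix (Fin 2) (Fin 2) ℂ :=
  !![(blochMass P x y : ℂ), -P.t₁ * latticeSum x y;
    -P.t₁ * star (latticeSum x y), -(blochMass P x y : ℂ)]

theorem bloch_eq (x y : ℝ) :
    bloch P x y = (blochShift P x y : ℂ) • 1 + blochTraceless P x y := by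
  ext i j
  fin_cases i <;> fin_cases j <;> simp [bloch, blochTraceless]
  ring

theorem gap_sq (x y : ℝ) :
    gap P x y ^ 2 = blochMass P x y ^ 2 + P.t₁ ^ 2 * latticeNormSq x y :=
  Real.sq_sqrt (add_nonneg (sq_nonneg _) (mul_nonneg (sq_nonneg _) (latticeNormSq_nonneg x y)))

theorem gap_nonneg (x y : ℝ) : 0 ≤ gap P x y := Real.sqrt_nonneg _

theorem blochTraceless_mul_self (x y : ℝ) :
    blochTraceless P x y * blochTraceless P x y = ((gap P x y ^ 2 : ℝ) : ℂ) • 1 := by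
  have h := latticeSum_mul_star x y
  rw [gap_sq]
  ext i j
  fin_cases i <;> fin_cases j <;>
    simp only [blochTraceless, Matrix.mul_apply, Fin.sum_univ_two] <;> simp
  · simp only [Complex.star_def] at h
    linear_combination (P.t₁ : ℂ) ^ 2 * h
  · ring
  · ring
  · simp only [Complex.star_def] at h
    linear_combination (P.t₁ : ℂ) ^ 2 * h

/-- Multiples of the identity drop out of a commutator, so only the differences of the diagonal
entries matter. -/
theorem trace_mul_commutator_two (m b c p p' g g' r r' k k' : ℂ) :
    Matrix.trace (!![m, b; c, -m] * (!![p, g; g', p'] * !![r, k; k', r']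
      - !![r, k; k', r'] * !![p, g; g', p']))
      = 2 * m * (g * k' - k * g') + (r - r') * (b * g' - c * g) - (p - p') * (b * k' - c * k) := by
  simp [Matrix.trace_fin_two]
  ring

/-- The vertices contain, besides the momentum derivatives of the Bloch Hamiltonian, the
displacement δ₁ inside the unit cell. That displacement is the origin of the second group of terms
in `curvNum`. -/
theorem trace_blochTraceless_commutator (x y : ℝ) :
    Matrix.trace (blochTraceless P x y * (vertexX P x y * vertexY P x y
      - vertexY P x y * vertexX P x y)) = 4 * Complex.I * (curvNum P x y : ℂ) := by
  rw [blochTraceless, vertexX, vertexY, trace_mul_commutator_two]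
  have d1 : (3 * P.t₂ * (Real.sin (P.φ - y) - Real.sin (P.φ + x)))
      - (-(3 * P.t₂ * (Real.sin (P.φ + y) - Real.sin (P.φ - x))))
      = 6 * P.t₂ * Real.sin P.φ * (Real.cos y - Real.cos x) := by
    rw [Real.sin_sub, Real.sin_sub, Real.sin_add, Real.sin_add]; ring
  have d2 : (√3 * P.t₂ * (-2 * Real.sin (P.φ - x + y) + Real.sin (P.φ - y) + Real.sin (P.φ + x)))
      - (-(√3 * P.t₂ * (-2 * Real.sin (P.φ + x - y) + Real.sin (P.φ + y) + Real.sin (P.φ - x))))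
      = 2 * √3 * P.t₂ * Real.sin P.φ * (Real.cos y + Real.cos x - 2 * Real.cos (x - y)) := by
    rw [show P.φ - x + y = P.φ - (x - y) by ring, show P.φ + x - y = P.φ + (x - y) by ring,
      Real.sin_sub P.φ, Real.sin_sub P.φ, Real.sin_sub P.φ, Real.sin_add, Real.sin_add, Real.sin_add]
    ring
  rw [← Complex.ofReal_sub, d2, ← Complex.ofReal_sub, d1, star_latticeSum, latticeSum, curvNum,
    massX, massY, windX, windY, latticeNormSq]
  generalize blochMass P x y = m
  simp only [Complex.ofReal_mul, Complex.ofReal_add, Complex.ofReal_sub, Complex.ofReal_div,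
    Complex.ofReal_pow, Complex.ofReal_neg, Complex.ofReal_ofNat, Complex.ofReal_one]
  have hI : Complex.I ^ 2 = -1 := Complex.I_sq
  rw [Complex.exp_neg, Complex.exp_neg, ofReal_cos_eq x, ofReal_cos_eq y, ofReal_sin_eq x, ofReal_sin_eq y,
    ofReal_cos_eq (x - y), ofReal_sin_eq (x - y), exp_I_mul_sub]
  have h1 := Complex.exp_ne_zero (Complex.I * x)
  have h2 := Complex.exp_ne_zero (Complex.I * y)
  -- What remains is a rational identity in z1 = e^{ix} and z2 = e^{iy}.
  generalize Complex.exp (Complex.I * x) = z1 at *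
  generalize Complex.exp (Complex.I * y) = z2 at *
  generalize ((Real.sin P.φ : ℝ) : ℂ) = sφ
  field_simp
  ring

theorem oddFiber_eq {β ω : ℝ} (hω : Complex.exp (-(Complex.I * ω * β)) = 1) {x y : ℝ}
    (hE : gap P x y ≠ 0) :
    oddFiber P β ω x y = ((-2 * curvNum P x y * (ω *
      (fermi β (blochShift P x y - gap P x y) - fermi β (blochShift P x y + gap P x y)) /
        (gap P x y * (4 * gap P x y ^ 2 + ω ^ 2))) : ℝ) : ℂ) := by
  rw [oddFiber, fiber, fiber, bloch_eq,
    bubbleHat_sub_twoLevel hE (blochTraceless_mul_self P x y) _ _ _ hω,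
    trace_blochTraceless_commutator, Complex.ofReal_mul (-2 * curvNum P x y)]
  generalize ((ω * _ / _ : ℝ) : ℂ) = r
  have hI : Complex.I ^ 2 = -1 := Complex.I_sq
  push_cast
  linear_combination (2 * (curvNum P x y : ℂ) * r) * hI

end Curvature

/-! ### Bounds near the gapless Fermi point -/

section Bounds

/-- A function of the displacement `(u, v)` from the gapless Fermi point, comparable to the squared
distance. -/
noncomputable def cosDefect (u v : ℝ) : ℝ := 3 - Real.cos u - Real.cos v - Real.cos (u - v)

/-- The cubic correction to `cosDefect` in the expansion of the structure factor. -/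
noncomputable def sinDefect (u v : ℝ) : ℝ := Real.sin (u - v) + Real.sin v - Real.sin u

theorem cos_two_pi_div_three : Real.cos (2 * Real.pi / 3) = -1 / 2 := by
  rw [show 2 * Real.pi / 3 = Real.pi - Real.pi / 3 by ring, Real.cos_pi_sub, Real.cos_pi_div_three]
  norm_num

theorem sin_two_pi_div_three : Real.sin (2 * Real.pi / 3) = √3 / 2 := by
  rw [show 2 * Real.pi / 3 = Real.pi - Real.pi / 3 by ring, Real.sin_pi_sub, Real.sin_pi_div_three]

theorem cos_four_pi_div_three : Real.cos (4 * Real.pi / 3) = -1 / 2 := by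
  rw [show 4 * Real.pi / 3 = Real.pi / 3 + Real.pi by ring, Real.cos_add_pi, Real.cos_pi_div_three]
  norm_num

theorem sin_four_pi_div_three : Real.sin (4 * Real.pi / 3) = -(√3 / 2) := by
  rw [show 4 * Real.pi / 3 = Real.pi / 3 + Real.pi by ring, Real.sin_add_pi, Real.sin_pi_div_three]

theorem chart_sub (u v : ℝ) :
    (4 * Real.pi / 3 + u) - (2 * Real.pi / 3 + v) = 2 * Real.pi / 3 + (u - v) := by ring

theorem latticeNormSq_chart (u v : ℝ) :
    latticeNormSq (4 * Real.pi / 3 + u) (2 * Real.pi / 3 + v)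
      = cosDefect u v - √3 * sinDefect u v := by
  rw [latticeNormSq, chart_sub, Real.cos_add, Real.cos_add, Real.cos_add, cos_two_pi_div_three,
    sin_two_pi_div_three, cos_four_pi_div_three, sin_four_pi_div_three, cosDefect, sinDefect]
  ring

theorem cosDefect_eq (u v : ℝ) : cosDefect u v
    = 2 * (Real.sin (u / 2) ^ 2 + Real.sin (v / 2) ^ 2 + Real.sin ((u - v) / 2) ^ 2) := by
  have h : ∀ t : ℝ, Real.cos t = 1 - 2 * Real.sin (t / 2) ^ 2 := by
    intro t
    have := Real.cos_two_mul (t / 2)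
    rw [mul_div_cancel₀ t two_ne_zero] at this
    rw [this, Real.sin_sq]; ring
  rw [cosDefect, h u, h v, h (u - v)]
  ring

/-- The three arguments u - v, v, -u sum to zero, so the sum of sines factors. The product form
shows that the term is cubic near the gapless point. -/
theorem sinDefect_eq (u v : ℝ) : sinDefect u v
    = 4 * Real.sin ((u - v) / 2) * Real.sin (v / 2) * Real.sin (u / 2) := by
  have h2 : ∀ t : ℝ, Real.sin t = 2 * Real.sin (t / 2) * Real.cos (t / 2) := by
    intro t
    rw [← Real.sin_two_mul, mul_div_cancel₀ t two_ne_zero]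
  have e : (u - v) / 2 = u / 2 - v / 2 := by ring
  rw [sinDefect, h2 (u - v), h2 v, h2 u, e, Real.sin_sub, Real.cos_sub]
  have a := Real.sin_sq_add_cos_sq (u / 2)
  have b := Real.sin_sq_add_cos_sq (v / 2)
  generalize Real.sin (u / 2) = su at *
  generalize Real.cos (u / 2) = cu at *
  generalize Real.sin (v / 2) = sv at *
  generalize Real.cos (v / 2) = cv at *
  linear_combination (-2 * sv * cv) * a + (2 * su * cu) * b

theorem abs_sinDefect_le (u v : ℝ) : |sinDefect u v| ≤ cosDefect u v * |Real.sin (v / 2)| := by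
  rw [sinDefect_eq, cosDefect_eq]
  have h1 : |4 * Real.sin ((u - v) / 2) * Real.sin (v / 2) * Real.sin (u / 2)|
      = (4 * (|Real.sin ((u - v) / 2)| * |Real.sin (u / 2)|)) * |Real.sin (v / 2)| := by
    rw [abs_mul, abs_mul, abs_mul, abs_of_pos (by norm_num : (0 : ℝ) < 4)]; ring
  rw [h1]
  refine mul_le_mul_of_nonneg_right ?_ (abs_nonneg _)
  have := sq_nonneg (|Real.sin ((u - v) / 2)| - |Real.sin (u / 2)|)
  have e1 := sq_abs (Real.sin ((u - v) / 2))
  have e2 := sq_abs (Real.sin (u / 2))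
  nlinarith [sq_nonneg (Real.sin (v / 2))]

theorem cosDefect_nonneg (u v : ℝ) : 0 ≤ cosDefect u v := by
  rw [cosDefect_eq]; positivity

theorem abs_sinDefect_le_cosDefect (u v : ℝ) : |sinDefect u v| ≤ cosDefect u v :=
  (abs_sinDefect_le u v).trans (mul_le_of_le_one_right (cosDefect_nonneg u v)
    (Real.abs_sin_le_one _))

theorem sin_half_sq_le_cosDefect (u v : ℝ) : 2 * Real.sin (v / 2) ^ 2 ≤ cosDefect u v := by
  rw [cosDefect_eq]
  nlinarith [sq_nonneg (Real.sin (u / 2)), sq_nonneg (Real.sin ((u - v) / 2))]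

/-- The correction √3 · `sinDefect` is at most `cosDefect` times √3 |sin(v/2)|, and the hypothesis
says exactly that the latter factor is at most 1/2. Only v is restricted: the estimate holds along
entire horizontal lines, as the winding integrals require. -/
theorem latticeNormSq_chart_ge {u v : ℝ} (hv : 12 * Real.sin (v / 2) ^ 2 ≤ 1) :
    cosDefect u v / 2 ≤ latticeNormSq (4 * Real.pi / 3 + u) (2 * Real.pi / 3 + v) := by
  rw [latticeNormSq_chart]
  have h3 : √3 ^ 2 = 3 := Real.sq_sqrt (by norm_num)
  have h4 : √3 * |Real.sin (v / 2)| ≤ 1 / 2 := by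
    refine (sq_le_sq₀ (by positivity) (by norm_num)).1 ?_
    rw [mul_pow, h3, sq_abs]
    linarith
  have h5 := abs_sinDefect_le u v
  have h6 := le_abs_self (sinDefect u v)
  have h7 := cosDefect_nonneg u v
  have h8 : √3 * sinDefect u v ≤ cosDefect u v * (√3 * |Real.sin (v / 2)|) := by
    calc √3 * sinDefect u v ≤ √3 * (cosDefect u v * |Real.sin (v / 2)|) := by
          gcongr; exact h6.trans h5
      _ = _ := by ring
  nlinarith

theorem abs_sin_half_ge {t : ℝ} (ht : |t| ≤ Real.pi) : |t| / Real.pi ≤ |Real.sin (t / 2)| := by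
  have h1 := Real.mul_abs_le_abs_sin (x := t / 2) (by rw [abs_div, abs_two]; linarith)
  rw [abs_div, abs_two] at h1
  calc |t| / Real.pi = 2 / Real.pi * (|t| / 2) := by ring
    _ ≤ _ := h1

/-- A bound by the product |u||v|, weaker than one by u² + v², is chosen so that the majorant of the
inverse gap factorizes. -/
theorem cosDefect_ge {u v : ℝ} (hu : |u| ≤ Real.pi) (hv : |v| ≤ Real.pi) :
    4 / Real.pi ^ 2 * (|u| * |v|) ≤ cosDefect u v := by
  have h1 := abs_sin_half_ge hu
  have h2 := abs_sin_half_ge hv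
  have h3 : |u| / Real.pi * (|v| / Real.pi) ≤ |Real.sin (u / 2)| * |Real.sin (v / 2)| := by gcongr
  have h4 : 4 / Real.pi ^ 2 * (|u| * |v|) = 4 * (|u| / Real.pi * (|v| / Real.pi)) := by
    field_simp
  rw [h4, cosDefect_eq]
  have e1 := sq_abs (Real.sin (v / 2))
  have e2 := sq_abs (Real.sin (u / 2))
  nlinarith [sq_nonneg (|Real.sin (u / 2)| - |Real.sin (v / 2)|), sq_nonneg (Real.sin ((u - v) / 2))]

theorem latticeNormSq_le (x y : ℝ) : latticeNormSq x y ≤ 9 := by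
  rw [latticeNormSq]
  linarith [Real.cos_le_one x, Real.cos_le_one y, Real.cos_le_one (x - y)]

theorem windX_sq_add (x y : ℝ) :
    windX x y ^ 2 + (Real.sin x + Real.sin (x - y)) ^ 2 = latticeNormSq x y := by
  have h : Real.cos y = Real.cos x * Real.cos (x - y) + Real.sin x * Real.sin (x - y) := by
    rw [← Real.cos_sub]; congr 1; ring
  rw [windX, latticeNormSq, h]
  linear_combination Real.sin_sq_add_cos_sq x + Real.sin_sq_add_cos_sq (x - y)

theorem windY_sq_add (x y : ℝ) :
    windY x y ^ 2 + (Real.sin y - Real.sin (x - y)) ^ 2 = latticeNormSq x y := by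
  have h : Real.cos x = Real.cos y * Real.cos (x - y) - Real.sin y * Real.sin (x - y) := by
    rw [← Real.cos_add]; congr 1; ring
  rw [windY, latticeNormSq, h]
  linear_combination Real.sin_sq_add_cos_sq y + Real.sin_sq_add_cos_sq (x - y)

variable {P : Params}

theorem blochMass_chart (hW : P.W = 3 * √3 * P.t₂ * Real.sin P.φ) (u v : ℝ) :
    blochMass P (4 * Real.pi / 3 + u) (2 * Real.pi / 3 + v)
      = P.t₂ * Real.sin P.φ * (√3 * cosDefect u v + sinDefect u v) := by
  rw [blochMass, hW, chart_sub, Real.sin_add, Real.sin_add, Real.sin_add, cos_two_pi_div_three,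
    sin_two_pi_div_three, cos_four_pi_div_three, sin_four_pi_div_three, cosDefect, sinDefect]
  ring

/-- The mass is proportional to √3 · `cosDefect` + `sinDefect`, and the second term never exceeds
`cosDefect` in size. Nonnegativity on the whole torus ensures that E + m vanishes only where E does,
so the Berry connection is singular at the gapless point alone. -/
theorem blochMass_chart_nonneg (hW : P.W = 3 * √3 * P.t₂ * Real.sin P.φ)
    (hτ : 0 < P.t₂ * Real.sin P.φ) (u v : ℝ) :
    0 ≤ blochMass P (4 * Real.pi / 3 + u) (2 * Real.pi / 3 + v) := by
  rw [blochMass_chart hW]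
  have h1 := neg_le_of_abs_le (abs_sinDefect_le_cosDefect u v)
  have h2 := cosDefect_nonneg u v
  have h3 : 1 ≤ √3 := Real.one_le_sqrt.2 (by norm_num)
  refine mul_nonneg hτ.le ?_
  nlinarith

theorem sqrt_three_le_two : √3 ≤ 2 := by
  rw [Real.sqrt_le_left (by norm_num)]; norm_num

theorem blochMass_chart_le (hW : P.W = 3 * √3 * P.t₂ * Real.sin P.φ)
    (hτ : 0 < P.t₂ * Real.sin P.φ) (u v : ℝ) :
    blochMass P (4 * Real.pi / 3 + u) (2 * Real.pi / 3 + v)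
      ≤ 3 * (P.t₂ * Real.sin P.φ) * cosDefect u v := by
  rw [blochMass_chart hW]
  have h1 := le_of_abs_le (abs_sinDefect_le_cosDefect u v)
  have h2 := cosDefect_nonneg u v
  have h3 := sqrt_three_le_two
  have h4 : √3 * cosDefect u v + sinDefect u v ≤ 3 * cosDefect u v := by nlinarith
  calc _ ≤ P.t₂ * Real.sin P.φ * (3 * cosDefect u v) := by gcongr
    _ = _ := by ring

/-- The gap is bounded below by the distance from the gapless point. -/
theorem gap_chart_sq_ge (hW : P.W = 3 * √3 * P.t₂ * Real.sin P.φ)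
    (hτ : 0 < P.t₂ * Real.sin P.φ) (u v : ℝ) :
    min (P.t₁ ^ 2 / 2) ((P.t₂ * Real.sin P.φ) ^ 2 / 6) * cosDefect u v
      ≤ gap P (4 * Real.pi / 3 + u) (2 * Real.pi / 3 + v) ^ 2 := by
  rw [gap_sq]
  have h0 := cosDefect_nonneg u v
  set N := latticeNormSq (4 * Real.pi / 3 + u) (2 * Real.pi / 3 + v) with hN
  have hN0 : 0 ≤ N := latticeNormSq_nonneg _ _
  -- Either the structure factor controls the gap, or the point is far from the gapless one
  -- (possibly near the other zero of f) and the mass controls it.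
  by_cases h : cosDefect u v / 2 ≤ N
  · calc _ ≤ P.t₁ ^ 2 / 2 * cosDefect u v := by gcongr; exact min_le_left _ _
      _ = P.t₁ ^ 2 * (cosDefect u v / 2) := by ring
      _ ≤ P.t₁ ^ 2 * N := by gcongr
      _ ≤ _ := le_add_of_nonneg_left (sq_nonneg _)
  -- If `cosDefect` were at most 1/6, then 2 sin²(v/2) ≤ 1/6, and the preceding lower bound on |f|²
  -- would apply.
  · have hC : 1 / 6 < cosDefect u v := by
      by_contra hc
      refine h (latticeNormSq_chart_ge ?_)
      have := sin_half_sq_le_cosDefect u v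
      linarith [not_lt.1 hc]
    rw [hN, latticeNormSq_chart] at h
    have h3 : √3 ^ 2 = 3 := Real.sq_sqrt (by norm_num)
    have h3p : 0 < √3 := by positivity
    -- Failure of the first case means √3 · `sinDefect` > `cosDefect` / 2, so the correction helps
    -- the mass here.
    have hm : cosDefect u v ≤ √3 * cosDefect u v + sinDefect u v := by
      have h5 : √3 * (√3 * cosDefect u v + sinDefect u v) ≥ √3 * cosDefect u v := by
        have := sqrt_three_le_two
        nlinarith
      exact le_of_mul_le_mul_left h5 h3p
    have hτ2 : 0 ≤ (P.t₂ * Real.sin P.φ) ^ 2 := sq_nonneg _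
    calc _ ≤ (P.t₂ * Real.sin P.φ) ^ 2 / 6 * cosDefect u v := by
          gcongr; exact min_le_right _ _
      _ ≤ (P.t₂ * Real.sin P.φ * cosDefect u v) ^ 2 := by
          nlinarith [mul_nonneg hτ2 (mul_nonneg h0 (sub_nonneg.2 hC.le))]
      _ ≤ blochMass P (4 * Real.pi / 3 + u) (2 * Real.pi / 3 + v) ^ 2 := by
          rw [blochMass_chart hW]
          gcongr
      _ ≤ _ := le_add_of_nonneg_right (by positivity)

theorem massX_chart (u v : ℝ) : massX P (4 * Real.pi / 3 + u) (2 * Real.pi / 3 + v)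
    = P.t₂ * Real.sin P.φ * (Real.cos (u - v) - Real.cos u
      + √3 * (Real.sin (u - v) + Real.sin u)) := by
  rw [massX, chart_sub, Real.cos_add, Real.cos_add, cos_two_pi_div_three, sin_two_pi_div_three,
    cos_four_pi_div_three, sin_four_pi_div_three]
  ring

theorem massY_chart (u v : ℝ) : massY P (4 * Real.pi / 3 + u) (2 * Real.pi / 3 + v)
    = P.t₂ * Real.sin P.φ * (Real.cos v - Real.cos (u - v)
      + √3 * (Real.sin v - Real.sin (u - v))) := by
  rw [massY, chart_sub, Real.cos_add, Real.cos_add, cos_two_pi_div_three, sin_two_pi_div_three]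
  ring

theorem sin_sq_le_sin_half_sq (t : ℝ) : Real.sin t ^ 2 ≤ 4 * Real.sin (t / 2) ^ 2 := by
  have h : Real.sin t = 2 * Real.sin (t / 2) * Real.cos (t / 2) := by
    rw [← Real.sin_two_mul, mul_div_cancel₀ t two_ne_zero]
  rw [h]
  nlinarith [Real.sin_sq_add_cos_sq (t / 2), sq_nonneg (Real.sin (t / 2)),
    mul_nonneg (sq_nonneg (Real.sin (t / 2))) (sq_nonneg (Real.sin (t / 2)))]

theorem one_sub_cos_sq_le_sin_half_sq (t : ℝ) :
    (1 - Real.cos t) ^ 2 ≤ 4 * Real.sin (t / 2) ^ 2 := by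
  have h : 1 - Real.cos t = 2 * Real.sin (t / 2) ^ 2 := by
    have := Real.cos_two_mul (t / 2)
    rw [mul_div_cancel₀ t two_ne_zero] at this
    rw [this, Real.cos_sq']; ring
  have h1 := Real.neg_one_le_cos t
  have h2 := Real.cos_le_one t
  nlinarith

theorem sq_add_sqrt_three_mul_le (a b c d : ℝ) :
    (a - b + √3 * (c + d)) ^ 2 ≤ 8 * (a ^ 2 + b ^ 2 + c ^ 2 + d ^ 2) := by
  have h3 : √3 ^ 2 = 3 := Real.sq_sqrt (by norm_num)
  -- A sum-of-squares certificate, valid modulo √3² = 3.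
  have e : 8 * (a ^ 2 + b ^ 2 + c ^ 2 + d ^ 2) - (a - b + √3 * (c + d)) ^ 2
      = (a + b) ^ 2 + (√3 * a - c) ^ 2 + (√3 * a - d) ^ 2 + (√3 * b + c) ^ 2 + (√3 * b + d) ^ 2
        + (√3 * (c - d)) ^ 2 := by
    linear_combination (-2 * a ^ 2 - 2 * b ^ 2 - 2 * c ^ 2 - 2 * d ^ 2) * h3
  nlinarith [sq_nonneg (a + b), sq_nonneg (√3 * a - c), sq_nonneg (√3 * a - d),
    sq_nonneg (√3 * b + c), sq_nonneg (√3 * b + d), sq_nonneg (√3 * (c - d))]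

theorem massX_chart_sq_le (u v : ℝ) : massX P (4 * Real.pi / 3 + u) (2 * Real.pi / 3 + v) ^ 2
    ≤ 64 * (P.t₂ * Real.sin P.φ) ^ 2 * cosDefect u v := by
  rw [massX_chart, mul_pow, mul_comm (64 : ℝ), mul_assoc]
  refine mul_le_mul_of_nonneg_left ?_ (sq_nonneg _)
  have h := sq_add_sqrt_three_mul_le (1 - Real.cos u) (1 - Real.cos (u - v)) (Real.sin (u - v))
    (Real.sin u)
  rw [sub_sub_sub_cancel_left] at h
  rw [cosDefect_eq]
  linarith [sin_sq_le_sin_half_sq u, sin_sq_le_sin_half_sq (u - v),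
    one_sub_cos_sq_le_sin_half_sq u, one_sub_cos_sq_le_sin_half_sq (u - v),
    sq_nonneg (Real.sin (v / 2)), sq_nonneg (Real.sin (u / 2)), sq_nonneg (Real.sin ((u - v) / 2))]

theorem massY_chart_sq_le (u v : ℝ) : massY P (4 * Real.pi / 3 + u) (2 * Real.pi / 3 + v) ^ 2
    ≤ 64 * (P.t₂ * Real.sin P.φ) ^ 2 * cosDefect u v := by
  rw [massY_chart, mul_pow, mul_comm (64 : ℝ), mul_assoc]
  refine mul_le_mul_of_nonneg_left ?_ (sq_nonneg _)
  have h := sq_add_sqrt_three_mul_le (1 - Real.cos (u - v)) (1 - Real.cos v) (Real.sin v)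
    (-Real.sin (u - v))
  rw [sub_sub_sub_cancel_left, ← sub_eq_add_neg, neg_sq] at h
  rw [cosDefect_eq]
  linarith [sin_sq_le_sin_half_sq v, sin_sq_le_sin_half_sq (u - v),
    one_sub_cos_sq_le_sin_half_sq v, one_sub_cos_sq_le_sin_half_sq (u - v),
    sq_nonneg (Real.sin (v / 2)), sq_nonneg (Real.sin (u / 2)), sq_nonneg (Real.sin ((u - v) / 2))]

/-- The constant in `gap_chart_sq_ge`. -/
noncomputable def gapConst (P : Params) : ℝ :=
  min (P.t₁ ^ 2 / 2) ((P.t₂ * Real.sin P.φ) ^ 2 / 6)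

theorem gapConst_pos (ht₁ : 0 < P.t₁) (hτ : 0 < P.t₂ * Real.sin P.φ) : 0 < gapConst P :=
  lt_min (by positivity) (by positivity)

theorem t₁_mul_sqrt_le_gap (x y : ℝ) : P.t₁ * √(latticeNormSq x y) ≤ gap P x y := by
  refine Real.le_sqrt_of_sq_le ?_
  rw [mul_pow, Real.sq_sqrt (latticeNormSq_nonneg x y)]
  exact le_add_of_nonneg_left (sq_nonneg _)

theorem abs_windX_le (x y : ℝ) : |windX x y| ≤ √(latticeNormSq x y) :=
  Real.abs_le_sqrt (by linarith [windX_sq_add x y, sq_nonneg (Real.sin x + Real.sin (x - y))])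

theorem abs_windY_le (x y : ℝ) : |windY x y| ≤ √(latticeNormSq x y) :=
  Real.abs_le_sqrt (by linarith [windY_sq_add x y, sq_nonneg (Real.sin y - Real.sin (x - y))])

theorem latticeNormSq_le_sqrt (x y : ℝ) : latticeNormSq x y ≤ 3 * √(latticeNormSq x y) := by
  have h := latticeNormSq_nonneg x y
  have h3 : √(latticeNormSq x y) ≤ 3 :=
    Real.sqrt_le_iff.2 ⟨by norm_num, by linarith [latticeNormSq_le x y]⟩
  nlinarith [Real.sq_sqrt h, Real.sqrt_nonneg (latticeNormSq x y)]

/-- Each term of the numerator carries either the mass, which is quadratically small, or a mass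
derivative times a winding term or |f|², each of which contributes at least one factor of E. -/
theorem abs_curvNum_le_aux {m s s' X Y a b r n N : ℝ} (hm : 0 ≤ m) (hs : |s| ≤ 1) (hs' : |s'| ≤ 4)
    (hX : |X| ≤ n) (hY : |Y| ≤ n) (ha : |a| ≤ r) (hb : |b| ≤ r) (hN0 : 0 ≤ N) (hN : N ≤ 3 * n) :
    |√3 / 2 * (3 * (m * s + a * Y - b * X) + ((b - a) * N + m * s'))| ≤ 7 * m + 12 * (r * n) := by
  have h2 : √3 / 2 ≤ 1 := by linarith [sqrt_three_le_two]
  rw [abs_mul, abs_of_nonneg (by positivity : 0 ≤ √3 / 2)]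
  refine (mul_le_of_le_one_left (abs_nonneg _) h2).trans ?_
  have hr : 0 ≤ r := (abs_nonneg _).trans ha
  have e1 : |m * s| ≤ m := by
    rw [abs_mul, abs_of_nonneg hm]; exact mul_le_of_le_one_right hm hs
  have e2 : |m * s'| ≤ m * 4 := by
    rw [abs_mul, abs_of_nonneg hm]; gcongr
  have e3 : |a * Y| ≤ r * n := by rw [abs_mul]; gcongr
  have e4 : |b * X| ≤ r * n := by rw [abs_mul]; gcongr
  have e5 : |(b - a) * N| ≤ (r + r) * (3 * n) := by
    rw [abs_mul, abs_of_nonneg hN0]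
    gcongr
    exact (abs_sub _ _).trans (add_le_add hb ha)
  rw [abs_le] at *
  constructor <;> linarith [e1.1, e1.2, e2.1, e2.2, e3.1, e3.2, e4.1, e4.2, e5.1, e5.2]

/-- The numerator of the Berry curvature vanishes quadratically at the gapless point. -/
theorem exists_abs_curvNum_le (ht₁ : 0 < P.t₁) (hW : P.W = 3 * √3 * P.t₂ * Real.sin P.φ)
    (hτ : 0 < P.t₂ * Real.sin P.φ) : ∃ K : ℝ, 0 ≤ K ∧ ∀ u v : ℝ,
      |curvNum P (4 * Real.pi / 3 + u) (2 * Real.pi / 3 + v)|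
        ≤ K * gap P (4 * Real.pi / 3 + u) (2 * Real.pi / 3 + v) ^ 2 := by
  have hκ := gapConst_pos ht₁ hτ
  set τ := P.t₂ * Real.sin P.φ with hτd
  set κ := gapConst P with hκd
  -- 21 = 7 · 3 comes from m ≤ 3τ · `cosDefect`, and 96 = 12 · 8 from the bound 8τE/√κ on the mass
  -- derivatives together with |f| ≤ E/t₁.
  refine ⟨P.t₁ ^ 2 * (21 * τ / κ + 96 * τ / (√κ * P.t₁)), by positivity, fun u v => ?_⟩
  have hC := gap_chart_sq_ge (P := P) hW hτ u v
  have hm0 := blochMass_chart_nonneg hW hτ u v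
  have hm := blochMass_chart_le hW hτ u v
  have hX := massX_chart_sq_le (P := P) u v
  have hY := massY_chart_sq_le (P := P) u v
  have hC0 := cosDefect_nonneg u v
  rw [← hτd] at hm hX hY
  change κ * cosDefect u v ≤ _ at hC
  set x := 4 * Real.pi / 3 + u
  set y := 2 * Real.pi / 3 + v
  have hE := gap_nonneg P x y
  have hn : √(latticeNormSq x y) ≤ gap P x y / P.t₁ := by
    rw [le_div_iff₀' ht₁]; exact t₁_mul_sqrt_le_gap x y
  have hCE : cosDefect u v ≤ gap P x y ^ 2 / κ := by rw [le_div_iff₀' hκ]; exact hC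
  have hr : √(64 * τ ^ 2 * cosDefect u v) ≤ 8 * τ * (gap P x y / √κ) := by
    refine Real.sqrt_le_iff.2 ⟨by positivity, ?_⟩
    calc _ ≤ 64 * τ ^ 2 * (gap P x y ^ 2 / κ) := by gcongr
      _ = 64 * τ ^ 2 * (gap P x y ^ 2 / √κ ^ 2) := by rw [Real.sq_sqrt hκ.le]
      _ = _ := by ring
  have hs4 : |Real.sin y - Real.sin x - 2 * Real.sin (x - y)| ≤ 4 := by
    rw [abs_le]
    constructor <;> linarith [Real.neg_one_le_sin x, Real.neg_one_le_sin y,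
      Real.neg_one_le_sin (x - y), Real.sin_le_one x, Real.sin_le_one y, Real.sin_le_one (x - y)]
  have main := abs_curvNum_le_aux hm0 (Real.abs_sin_le_one (x - y)) hs4 (abs_windX_le x y)
    (abs_windY_le x y) (Real.abs_le_sqrt hX) (Real.abs_le_sqrt hY) (latticeNormSq_nonneg x y)
    (latticeNormSq_le_sqrt x y)
  rw [curvNum, mul_assoc, abs_mul, abs_of_nonneg (sq_nonneg P.t₁), mul_assoc]
  refine mul_le_mul_of_nonneg_left (main.trans ?_) (sq_nonneg _)
  calc _ ≤ 7 * (3 * τ * (gap P x y ^ 2 / κ))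
        + 12 * (8 * τ * (gap P x y / √κ) * (gap P x y / P.t₁)) := by
        gcongr
        exact hm.trans (by gcongr)
    _ = _ := by
      field_simp
      ring

theorem gap_chart_pos (ht₁ : 0 < P.t₁) (hW : P.W = 3 * √3 * P.t₂ * Real.sin P.φ)
    (hτ : 0 < P.t₂ * Real.sin P.φ) {u v : ℝ} (h : 0 < cosDefect u v) :
    0 < gap P (4 * Real.pi / 3 + u) (2 * Real.pi / 3 + v) := by
  have h1 := gap_chart_sq_ge (P := P) hW hτ u v
  have h2 := mul_pos (gapConst_pos ht₁ hτ) h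
  exact (gap_nonneg P _ _).lt_of_ne fun h0 => by
    rw [← h0] at h1
    change gapConst P * _ ≤ _ at h1
    linarith

theorem cosDefect_pos_of_right {u v : ℝ} (hv : |v| ≤ Real.pi) (h : v ≠ 0) : 0 < cosDefect u v := by
  have h1 := abs_sin_half_ge hv
  have h2 : 0 < |v| / Real.pi := div_pos (abs_pos.2 h) Real.pi_pos
  have h3 := sin_half_sq_le_cosDefect u v
  have h4 : 0 < Real.sin (v / 2) ^ 2 := by
    rw [← sq_abs]; exact pow_pos (h2.trans_le h1) 2
  linarith

theorem cosDefect_pos_of_left {u v : ℝ} (hu : |u| ≤ Real.pi) (h : u ≠ 0) : 0 < cosDefect u v := by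
  have h1 := cosDefect_pos_of_right (u := v) hu h
  rw [cosDefect] at h1 ⊢
  rw [← Real.cos_neg (u - v), neg_sub]
  linarith

/-- An integrable majorant of the inverse gap. -/
theorem exists_inv_gap_le (ht₁ : 0 < P.t₁) (hW : P.W = 3 * √3 * P.t₂ * Real.sin P.φ)
    (hτ : 0 < P.t₂ * Real.sin P.φ) : ∃ K : ℝ, 0 ≤ K ∧ ∀ u v : ℝ, |u| ≤ Real.pi → |v| ≤ Real.pi →
      u ≠ 0 → v ≠ 0 → (gap P (4 * Real.pi / 3 + u) (2 * Real.pi / 3 + v))⁻¹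
        ≤ K * (|u| ^ (-(1 / 2) : ℝ) * |v| ^ (-(1 / 2) : ℝ)) := by
  have hκ := gapConst_pos ht₁ hτ
  refine ⟨(√(gapConst P * (4 / Real.pi ^ 2)))⁻¹, by positivity, fun u v hu hv hu0 hv0 => ?_⟩
  have h1 := gap_chart_sq_ge (P := P) hW hτ u v
  change gapConst P * _ ≤ _ at h1
  have h2 : gapConst P * (4 / Real.pi ^ 2) * (|u| * |v|)
      ≤ gap P (4 * Real.pi / 3 + u) (2 * Real.pi / 3 + v) ^ 2 := by
    rw [mul_assoc]
    exact (mul_le_mul_of_nonneg_left (cosDefect_ge hu hv) hκ.le).trans h1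
  have hu' := abs_pos.2 hu0
  have hv' := abs_pos.2 hv0
  have h3 := Real.sqrt_le_sqrt h2
  rw [Real.sqrt_sq (gap_nonneg P _ _), Real.sqrt_mul (by positivity), Real.sqrt_mul hu'.le] at h3
  rw [Real.rpow_neg hu'.le, Real.rpow_neg hv'.le, ← Real.sqrt_eq_rpow, ← Real.sqrt_eq_rpow,
    ← mul_inv, ← mul_inv]
  refine inv_anti₀ ?_ h3
  have := Real.sqrt_pos.2 hu'
  have := Real.sqrt_pos.2 hv'
  have : 0 < √(gapConst P * (4 / Real.pi ^ 2)) := Real.sqrt_pos.2 (by positivity)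
  positivity

theorem integrableOn_abs_rpow :
    MeasureTheory.IntegrableOn (fun u : ℝ => |u| ^ (-(1 / 2) : ℝ)) (Set.Ioc (-Real.pi) Real.pi) := by
  have h0 : IntervalIntegrable (fun u : ℝ => |u| ^ (-(1 / 2) : ℝ)) MeasureTheory.volume 0 Real.pi := by
    refine (intervalIntegral.intervalIntegrable_rpow' (a := 0) (b := Real.pi)
      (r := -(1 / 2)) (by norm_num)).congr ?_
    intro u hu
    rw [Set.uIoc_of_le Real.pi_pos.le] at hu
    simp only [abs_of_pos hu.1]
  have h1 : IntervalIntegrable (fun u : ℝ => |u| ^ (-(1 / 2) : ℝ)) MeasureTheory.volume (-Real.pi) 0 := by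
    have h2 := (IntervalIntegrable.iff_comp_neg enorm_ne_top).1 h0.symm
    simpa only [abs_neg, neg_zero] using h2
  exact (intervalIntegrable_iff_integrableOn_Ioc_of_le (by linarith [Real.pi_pos])).1 (h1.trans h0)

end Bounds

/-! ### Berry connection -/

section Connection

variable (P : Params)

/-- `∂ₓ E` for the gap `E`. -/
noncomputable def gapX (x y : ℝ) : ℝ :=
  (blochMass P x y * massX P x y - P.t₁ ^ 2 * (Real.sin x + Real.sin (x - y))) / gap P x y

/-- `∂_y E` for the gap `E`. -/
noncomputable def gapY (x y : ℝ) : ℝ :=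
  (blochMass P x y * massY P x y - P.t₁ ^ 2 * (Real.sin y - Real.sin (x - y))) / gap P x y

/-- The winding coefficient of the Berry connection. -/
noncomputable def connCoeff (x y : ℝ) : ℝ :=
  -P.t₁ ^ 2 / (gap P x y * (gap P x y + blochMass P x y))

/-- The component of the flux whose `x` derivative contributes to the Berry curvature. -/
noncomputable def fluxX (x y : ℝ) : ℝ :=
  3 * √3 / 2 * (connCoeff P x y * windY x y) - √3 / 2 * (blochMass P x y / gap P x y)

/-- The component of the flux whose `y` derivative contributes to the Berry curvature. -/
noncomputable def fluxY (x y : ℝ) : ℝ :=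
  -(3 * √3 / 2 * (connCoeff P x y * windX x y)) + √3 / 2 * (blochMass P x y / gap P x y)

variable {P} {x y : ℝ}

theorem hasDerivAt_sub_left (x y : ℝ) : HasDerivAt (fun t => t - y) 1 x :=
  (hasDerivAt_id x).sub_const y

theorem hasDerivAt_sub_right (x y : ℝ) : HasDerivAt (fun t => x - t) (-1) y := by
  simpa using (hasDerivAt_id y).const_sub x

theorem hasDerivAt_blochMass_left : HasDerivAt (fun t => blochMass P t y) (massX P x y) x := by
  have h1 := (hasDerivAt_sub_left x y).sin
  have h := (((h1.add_const (Real.sin y)).sub (Real.hasDerivAt_sin x)).const_mul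
    (2 * P.t₂ * Real.sin P.φ)).const_sub P.W
  refine h.congr_deriv ?_
  rw [massX]
  ring

theorem hasDerivAt_blochMass_right : HasDerivAt (fun t => blochMass P x t) (massY P x y) y := by
  have h1 := (hasDerivAt_sub_right x y).sin
  have h := (((h1.add (Real.hasDerivAt_sin y)).sub_const (Real.sin x)).const_mul
    (2 * P.t₂ * Real.sin P.φ)).const_sub P.W
  refine h.congr_deriv ?_
  rw [massY]
  ring

theorem hasDerivAt_latticeNormSq_left :
    HasDerivAt (fun t => latticeNormSq t y) (-2 * (Real.sin x + Real.sin (x - y))) x := by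
  have h1 := (hasDerivAt_sub_left x y).cos
  have h := ((((h1.add (Real.hasDerivAt_cos x)).add_const (Real.cos y)).const_mul 2).const_add 3)
  refine h.congr_deriv ?_
  ring

theorem hasDerivAt_latticeNormSq_right :
    HasDerivAt (fun t => latticeNormSq x t) (-2 * (Real.sin y - Real.sin (x - y))) y := by
  have h1 := (hasDerivAt_sub_right x y).cos
  have h := ((((h1.add_const (Real.cos x)).add (Real.hasDerivAt_cos y)).const_mul 2).const_add 3)
  refine h.congr_deriv ?_
  ring

theorem hasDerivAt_windY_left : HasDerivAt (fun t => windY t y) (-Real.sin (x - y)) x := by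
  refine HasDerivAt.congr_deriv ((hasDerivAt_sub_left x y).cos.const_add (1 + Real.cos y)) ?_
  ring

theorem hasDerivAt_windX_right : HasDerivAt (fun t => windX x t) (Real.sin (x - y)) y := by
  refine HasDerivAt.congr_deriv ((hasDerivAt_sub_right x y).cos.const_add (1 + Real.cos x)) ?_
  ring

theorem hasDerivAt_gap_left (hE : 0 < gap P x y) : HasDerivAt (fun t => gap P t y) (gapX P x y) x := by
  have h := ((hasDerivAt_blochMass_left (P := P) (x := x) (y := y)).pow 2).add
    ((hasDerivAt_latticeNormSq_left (x := x) (y := y)).const_mul (P.t₁ ^ 2))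
  have h2 := h.sqrt (Real.sqrt_pos.1 hE).ne'
  refine h2.congr_deriv ?_
  rw [gapX]
  change _ / (2 * gap P x y) = _
  have := hE.ne'
  field_simp
  ring

theorem hasDerivAt_gap_right (hE : 0 < gap P x y) : HasDerivAt (fun t => gap P x t) (gapY P x y) y := by
  have h := ((hasDerivAt_blochMass_right (P := P) (x := x) (y := y)).pow 2).add
    ((hasDerivAt_latticeNormSq_right (x := x) (y := y)).const_mul (P.t₁ ^ 2))
  have h2 := h.sqrt (Real.sqrt_pos.1 hE).ne'
  refine h2.congr_deriv ?_
  rw [gapY]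
  change _ / (2 * gap P x y) = _
  have := hE.ne'
  field_simp
  ring

theorem hasDerivAt_fluxX (hE : 0 < gap P x y) (hm : 0 ≤ blochMass P x y) :
    HasDerivAt (fun t => fluxX P t y)
      (3 * √3 / 2 * (P.t₁ ^ 2 * ((2 * gap P x y + blochMass P x y) * gapX P x y
          + gap P x y * massX P x y) / (gap P x y * (gap P x y + blochMass P x y)) ^ 2 * windY x y
          - connCoeff P x y * Real.sin (x - y))
        - √3 / 2 * ((massX P x y * gap P x y - blochMass P x y * gapX P x y) / gap P x y ^ 2)) x := by
  have hE' := hasDerivAt_gap_left hE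
  have hm' := hasDerivAt_blochMass_left (P := P) (x := x) (y := y)
  have hne : gap P x y * (gap P x y + blochMass P x y) ≠ 0 := by positivity
  have h1 := ((hasDerivAt_const x (-P.t₁ ^ 2)).div (hE'.mul (hE'.add hm')) hne).mul
    (hasDerivAt_windY_left (x := x) (y := y))
  have h2 := hm'.div hE' hE.ne'
  refine HasDerivAt.congr_deriv ((h1.const_mul (3 * √3 / 2)).sub (h2.const_mul (√3 / 2))) ?_
  simp only [connCoeff, Pi.mul_apply, Pi.add_apply, Pi.div_apply]
  ring

theorem hasDerivAt_fluxY (hE : 0 < gap P x y) (hm : 0 ≤ blochMass P x y) :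
    HasDerivAt (fun t => fluxY P x t)
      (-(3 * √3 / 2 * (P.t₁ ^ 2 * ((2 * gap P x y + blochMass P x y) * gapY P x y
          + gap P x y * massY P x y) / (gap P x y * (gap P x y + blochMass P x y)) ^ 2 * windX x y
          + connCoeff P x y * Real.sin (x - y)))
        + √3 / 2 * ((massY P x y * gap P x y - blochMass P x y * gapY P x y) / gap P x y ^ 2)) y := by
  have hE' := hasDerivAt_gap_right hE
  have hm' := hasDerivAt_blochMass_right (P := P) (x := x) (y := y)
  have hne : gap P x y * (gap P x y + blochMass P x y) ≠ 0 := by positivity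
  have h1 := ((hasDerivAt_const y (-P.t₁ ^ 2)).div (hE'.mul (hE'.add hm')) hne).mul
    (hasDerivAt_windX_right (x := x) (y := y))
  have h2 := hm'.div hE' hE.ne'
  refine HasDerivAt.congr_deriv ((h1.const_mul (3 * √3 / 2)).neg.add (h2.const_mul (√3 / 2))) ?_
  simp only [connCoeff, Pi.mul_apply, Pi.add_apply, Pi.div_apply]
  ring

/-- In terms of f this is Re(f̄∂ₓf) Im(f̄∂_yf) - Re(f̄∂_yf) Im(f̄∂ₓf) = |f|² Im(conj(∂ₓf) ∂_yf),
with all signs reversed; the last factor on the right is sin(y - x). -/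
theorem windY_mul_sub_windX_mul (x y : ℝ) :
    (Real.sin x + Real.sin (x - y)) * windY x y - (Real.sin y - Real.sin (x - y)) * windX x y
      = latticeNormSq x y * Real.sin (x - y) := by
  rw [windX, windY, latticeNormSq, Real.sin_sub, Real.cos_sub]
  have a := Real.sin_sq_add_cos_sq x
  have b := Real.sin_sq_add_cos_sq y
  generalize Real.sin x = sx at *
  generalize Real.cos x = cx at *
  generalize Real.sin y = sy at *
  generalize Real.cos y = cy at *
  linear_combination sy * a - sx * b

/-- The Berry curvature is the divergence of the flux. -/
theorem curvNum_div_gap_cube_aux {t E m mX mY X Y bX bY s s' N : ℝ} (hE : 0 < E) (hm : 0 ≤ m)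
    (hE2 : E ^ 2 = m ^ 2 + t ^ 2 * N) (hN : bX * Y - bY * X = N * s) (hb : bY - bX = s') :
    (3 * √3 / 2 * (t ^ 2 * ((2 * E + m) * ((m * mX - t ^ 2 * bX) / E) + E * mX) / (E * (E + m)) ^ 2 * Y
          - (-t ^ 2 / (E * (E + m))) * s)
        - √3 / 2 * ((mX * E - m * ((m * mX - t ^ 2 * bX) / E)) / E ^ 2))
      + (-(3 * √3 / 2 * (t ^ 2 * ((2 * E + m) * ((m * mY - t ^ 2 * bY) / E) + E * mY) / (E * (E + m)) ^ 2 * X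
          + (-t ^ 2 / (E * (E + m))) * s))
        + √3 / 2 * ((mY * E - m * ((m * mY - t ^ 2 * bY) / E)) / E ^ 2))
      = t ^ 2 * (√3 / 2) * (3 * (m * s + mX * Y - mY * X) + ((mY - mX) * N + m * s')) / E ^ 3 := by
  have hEm : 0 < E + m := by positivity
  -- This is E² times (∂_y - ∂ₓ)(m/E); it accounts for the second group of terms of the curvature
  -- numerator.
  have e1 : (mY * E - m * ((m * mY - t ^ 2 * bY) / E)) - (mX * E - m * ((m * mX - t ^ 2 * bX) / E))
      = t ^ 2 * ((mY - mX) * N + m * s') / E := by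
    field_simp
    linear_combination (mY - mX) * hE2 + t ^ 2 * m * hb
  -- This is the curl of the winding part of the connection. The factor (E + m)² cancels the
  -- gauge-dependent denominator.
  have e2 : ((2 * E + m) * ((m * mX - t ^ 2 * bX) / E) + E * mX) * Y
      - ((2 * E + m) * ((m * mY - t ^ 2 * bY) / E) + E * mY) * X + 2 * (E * (E + m)) * s
      = (E + m) ^ 2 / E * (m * s + mX * Y - mY * X) := by
    field_simp
    linear_combination (-t ^ 2 * (2 * E + m)) * hN + (2 * E + m) * s * hE2
  calc _ = 3 * √3 / 2 * (t ^ 2 * (((2 * E + m) * ((m * mX - t ^ 2 * bX) / E) + E * mX) * Y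
      - ((2 * E + m) * ((m * mY - t ^ 2 * bY) / E) + E * mY) * X + 2 * (E * (E + m)) * s)
        / (E * (E + m)) ^ 2)
      + √3 / 2 * (((mY * E - m * ((m * mY - t ^ 2 * bY) / E))
        - (mX * E - m * ((m * mX - t ^ 2 * bX) / E))) / E ^ 2) := by
        field_simp
        ring
    _ = _ := by
        rw [e1, e2]
        field_simp

theorem curvNum_div_gap_cube (hE : 0 < gap P x y) (hm : 0 ≤ blochMass P x y) :
    deriv (fun t => fluxX P t y) x + deriv (fun t => fluxY P x t) y
      = curvNum P x y / gap P x y ^ 3 := by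
  rw [(hasDerivAt_fluxX hE hm).deriv, (hasDerivAt_fluxY hE hm).deriv, curvNum]
  exact curvNum_div_gap_cube_aux hE hm (gap_sq P x y) (windY_mul_sub_windX_mul x y) (by ring)

theorem differentiable_blochMass : Differentiable ℝ fun p : ℝ × ℝ => blochMass P p.1 p.2 := by
  unfold blochMass; fun_prop

theorem differentiable_latticeNormSq : Differentiable ℝ fun p : ℝ × ℝ => latticeNormSq p.1 p.2 := by
  unfold latticeNormSq; fun_prop

theorem differentiable_windX : Differentiable ℝ fun p : ℝ × ℝ => windX p.1 p.2 := by
  unfold windX; fun_prop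

theorem differentiable_windY : Differentiable ℝ fun p : ℝ × ℝ => windY p.1 p.2 := by
  unfold windY; fun_prop

theorem differentiableAt_gap {p : ℝ × ℝ} (hE : 0 < gap P p.1 p.2) :
    DifferentiableAt ℝ (fun p : ℝ × ℝ => gap P p.1 p.2) p :=
  (((differentiable_blochMass (P := P)).differentiableAt.pow 2).add
    (differentiable_latticeNormSq.differentiableAt.const_mul (P.t₁ ^ 2))).sqrt (Real.sqrt_pos.1 hE).ne'

theorem differentiableAt_connCoeff {p : ℝ × ℝ} (hE : 0 < gap P p.1 p.2)
    (hm : 0 ≤ blochMass P p.1 p.2) :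
    DifferentiableAt ℝ (fun p : ℝ × ℝ => connCoeff P p.1 p.2) p := by
  have h1 := differentiableAt_gap hE
  have h2 := (differentiable_blochMass (P := P)).differentiableAt (x := p)
  have hne : gap P p.1 p.2 * (gap P p.1 p.2 + blochMass P p.1 p.2) ≠ 0 := by positivity
  unfold connCoeff
  have h3 := h1.fun_mul (h1.fun_add h2)
  simp only [div_eq_mul_inv]
  exact (h3.fun_inv hne).const_mul _

theorem differentiableAt_mass_div_gap {p : ℝ × ℝ} (hE : 0 < gap P p.1 p.2) :
    DifferentiableAt ℝ (fun p : ℝ × ℝ => blochMass P p.1 p.2 / gap P p.1 p.2) p := by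
  have h2 := (differentiable_blochMass (P := P)).differentiableAt (x := p)
  have h1 := differentiableAt_gap hE
  simp only [div_eq_mul_inv]
  exact h2.fun_mul (h1.fun_inv hE.ne')

theorem differentiableAt_fluxX {p : ℝ × ℝ} (hE : 0 < gap P p.1 p.2) (hm : 0 ≤ blochMass P p.1 p.2) :
    DifferentiableAt ℝ (fun p : ℝ × ℝ => fluxX P p.1 p.2) p := by
  have h3 := differentiable_windY.differentiableAt (x := p)
  exact (((differentiableAt_connCoeff hE hm).fun_mul h3).const_mul _).fun_sub
    ((differentiableAt_mass_div_gap hE).const_mul _)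

theorem differentiableAt_fluxY {p : ℝ × ℝ} (hE : 0 < gap P p.1 p.2) (hm : 0 ≤ blochMass P p.1 p.2) :
    DifferentiableAt ℝ (fun p : ℝ × ℝ => fluxY P p.1 p.2) p := by
  have h3 := differentiable_windX.differentiableAt (x := p)
  exact (((differentiableAt_connCoeff hE hm).fun_mul h3).const_mul _).fun_neg.fun_add
    ((differentiableAt_mass_div_gap hE).const_mul _)

theorem continuous_gap : Continuous fun p : ℝ × ℝ => gap P p.1 p.2 := by
  unfold gap
  exact (((differentiable_blochMass (P := P)).continuous.pow 2).add
    (continuous_const.mul differentiable_latticeNormSq.continuous)).sqrt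

theorem continuous_curvNum : Continuous fun p : ℝ × ℝ => curvNum P p.1 p.2 := by
  unfold curvNum blochMass massX massY windX windY latticeNormSq
  fun_prop

theorem fderiv_apply_one_zero {f : ℝ × ℝ → ℝ} (hf : DifferentiableAt ℝ f (x, y)) :
    fderiv ℝ f (x, y) (1, 0) = deriv (fun t => f (t, y)) x :=
  (hf.hasFDerivAt.comp_hasDerivAt x ((hasDerivAt_id x).prodMk (hasDerivAt_const x y))).deriv.symm

theorem fderiv_apply_zero_one {f : ℝ × ℝ → ℝ} (hf : DifferentiableAt ℝ f (x, y)) :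
    fderiv ℝ f (x, y) (0, 1) = deriv (fun t => f (x, t)) y :=
  (hf.hasFDerivAt.comp_hasDerivAt y ((hasDerivAt_const y x).prodMk (hasDerivAt_id y))).deriv.symm

theorem cos_add_two_pi_sub (x y : ℝ) : Real.cos (x + 2 * Real.pi - y) = Real.cos (x - y) := by
  rw [show x + 2 * Real.pi - y = x - y + 2 * Real.pi by ring, Real.cos_add_two_pi]

theorem sin_add_two_pi_sub (x y : ℝ) : Real.sin (x + 2 * Real.pi - y) = Real.sin (x - y) := by
  rw [show x + 2 * Real.pi - y = x - y + 2 * Real.pi by ring, Real.sin_add_two_pi]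

theorem cos_sub_add_two_pi (x y : ℝ) : Real.cos (x - (y + 2 * Real.pi)) = Real.cos (x - y) := by
  rw [show x - (y + 2 * Real.pi) = x - y - 2 * Real.pi by ring, Real.cos_sub_two_pi]

theorem sin_sub_add_two_pi (x y : ℝ) : Real.sin (x - (y + 2 * Real.pi)) = Real.sin (x - y) := by
  rw [show x - (y + 2 * Real.pi) = x - y - 2 * Real.pi by ring, Real.sin_sub_two_pi]

theorem fluxX_add_two_pi_left (x y : ℝ) : fluxX P (x + 2 * Real.pi) y = fluxX P x y := by
  simp only [fluxX, connCoeff, gap, blochMass, latticeNormSq, windY, Real.cos_add_two_pi,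
    Real.sin_add_two_pi, cos_add_two_pi_sub, sin_add_two_pi_sub]

theorem fluxY_add_two_pi_right (x y : ℝ) : fluxY P x (y + 2 * Real.pi) = fluxY P x y := by
  simp only [fluxY, connCoeff, gap, blochMass, latticeNormSq, windX, Real.cos_add_two_pi,
    Real.sin_add_two_pi, cos_sub_add_two_pi, sin_sub_add_two_pi]

/-- Stokes' theorem for the Berry curvature on a strip away from the gapless points. -/
theorem integral_curvature_strip (a c d : ℝ) (hE : ∀ x, ∀ y ∈ Set.uIcc c d, 0 < gap P x y)
    (hm : ∀ x y, 0 ≤ blochMass P x y) :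
    ∫ x in a..(a + 2 * Real.pi), ∫ y in c..d, curvNum P x y / gap P x y ^ 3
      = (∫ x in a..(a + 2 * Real.pi), fluxY P x d) - ∫ x in a..(a + 2 * Real.pi), fluxY P x c := by
  set b := a + 2 * Real.pi with hb
  have hdX : ∀ p ∈ Set.uIcc a b ×ˢ Set.uIcc c d,
      DifferentiableAt ℝ (fun p : ℝ × ℝ => fluxX P p.1 p.2) p := fun p hp =>
    differentiableAt_fluxX (hE _ _ hp.2) (hm _ _)
  have hdY : ∀ p ∈ Set.uIcc a b ×ˢ Set.uIcc c d,
      DifferentiableAt ℝ (fun p : ℝ × ℝ => fluxY P p.1 p.2) p := fun p hp =>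
    differentiableAt_fluxY (hE _ _ hp.2) (hm _ _)
  have hsub : Set.Ioo (min a b) (max a b) ×ˢ Set.Ioo (min c d) (max c d)
      ⊆ Set.uIcc a b ×ˢ Set.uIcc c d :=
    Set.prod_mono Set.Ioo_subset_Icc_self Set.Ioo_subset_Icc_self
  have heq : ∀ p ∈ Set.uIcc a b ×ˢ Set.uIcc c d,
      fderiv ℝ (fun p : ℝ × ℝ => fluxX P p.1 p.2) p (1, 0)
        + fderiv ℝ (fun p : ℝ × ℝ => fluxY P p.1 p.2) p (0, 1)
        = curvNum P p.1 p.2 / gap P p.1 p.2 ^ 3 := by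
    rintro ⟨x, y⟩ hp
    rw [fderiv_apply_one_zero (hdX _ hp), fderiv_apply_zero_one (hdY _ hp)]
    exact curvNum_div_gap_cube (hE _ _ hp.2) (hm _ _)
  have hcont : ContinuousOn (fun p : ℝ × ℝ => curvNum P p.1 p.2 / gap P p.1 p.2 ^ 3)
      (Set.uIcc a b ×ˢ Set.uIcc c d) :=
    continuous_curvNum.continuousOn.div (continuous_gap.continuousOn.pow 3)
      fun p hp => (pow_pos (hE _ _ hp.2) 3).ne'
  have hint := hcont.integrableOn_compact (μ := MeasureTheory.volume)
    (isCompact_uIcc.prod isCompact_uIcc)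
  have key := MeasureTheory.integral2_divergence_prod_of_hasFDerivAt
    (fun p : ℝ × ℝ => fluxX P p.1 p.2) (fun p : ℝ × ℝ => fluxY P p.1 p.2)
    (fderiv ℝ fun p : ℝ × ℝ => fluxX P p.1 p.2) (fderiv ℝ fun p : ℝ × ℝ => fluxY P p.1 p.2)
    a c b d (fun p hp => (hdX p hp).continuousAt.continuousWithinAt)
    (fun p hp => (hdY p hp).continuousAt.continuousWithinAt)
    (fun p hp => (hdX p (hsub hp)).hasFDerivAt) (fun p hp => (hdY p (hsub hp)).hasFDerivAt)
    (hint.congr_fun (fun p hp => (heq p hp).symm) (measurableSet_uIcc.prod measurableSet_uIcc))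
  have hL : ∫ x in a..b, ∫ y in c..d, fderiv ℝ (fun p : ℝ × ℝ => fluxX P p.1 p.2) (x, y) (1, 0)
        + fderiv ℝ (fun p : ℝ × ℝ => fluxY P p.1 p.2) (x, y) (0, 1)
      = ∫ x in a..b, ∫ y in c..d, curvNum P x y / gap P x y ^ 3 :=
    intervalIntegral.integral_congr fun x hx => intervalIntegral.integral_congr fun y hy =>
      heq (x, y) ⟨hx, hy⟩
  rw [← hL, key]
  -- The fluxes through the two vertical edges cancel by periodicity in x.
  simp only [hb, fluxX_add_two_pi_left]
  ring

end Connection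

/-! ### The winding of the structure factor -/

section Winding

theorem exp_add_ne_zero {c : ℂ} (hc : ‖c‖ ≠ 1) (x : ℝ) : Complex.exp (x * Complex.I) + c ≠ 0 := by
  intro h
  apply hc
  rw [← norm_neg, ← eq_neg_of_add_eq_zero_left h, Complex.norm_exp_ofReal_mul_I]

theorem continuous_exp_div_exp_add {c : ℂ} (hc : ‖c‖ ≠ 1) :
    Continuous fun x : ℝ => Complex.exp (x * Complex.I) / (Complex.exp (x * Complex.I) + c) :=
  Continuous.div (by fun_prop) (by fun_prop) (exp_add_ne_zero hc)

/-- With z = e^{ix} this is -i∮ dz/(z + c); it counts whether the zero -c of z + c lies inside the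
unit circle. For c = 1 + e^{iy} the real part is the change of arg f along a horizontal loop. -/
theorem integral_exp_div_exp_add (c : ℂ) :
    ∫ x in (0 : ℝ)..2 * Real.pi, Complex.exp (x * Complex.I) / (Complex.exp (x * Complex.I) + c)
      = -Complex.I * ∮ z in C(0, 1), (z - -c)⁻¹ := by
  rw [circleIntegral, ← intervalIntegral.integral_const_mul]
  refine intervalIntegral.integral_congr fun x _ => ?_
  simp only [deriv_circleMap, circleMap, Complex.ofReal_one, one_mul, zero_add, smul_eq_mul,
    sub_neg_eq_add, div_eq_mul_inv]
  linear_combination (Complex.exp (x * Complex.I) * (Complex.exp (x * Complex.I) + c)⁻¹) * Complex.I_sq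

theorem integral_exp_div_exp_add_of_lt {c : ℂ} (hc : ‖c‖ < 1) :
    ∫ x in (0 : ℝ)..2 * Real.pi, Complex.exp (x * Complex.I) / (Complex.exp (x * Complex.I) + c)
      = 2 * Real.pi := by
  rw [integral_exp_div_exp_add, circleIntegral.integral_sub_inv_of_mem_ball (by simpa using hc)]
  linear_combination (-2 * Real.pi : ℂ) * Complex.I_sq

theorem integral_exp_div_exp_add_of_gt {c : ℂ} (hc : 1 < ‖c‖) :
    ∫ x in (0 : ℝ)..2 * Real.pi, Complex.exp (x * Complex.I) / (Complex.exp (x * Complex.I) + c)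
      = 0 := by
  have hne : ∀ z ∈ Metric.closedBall (0 : ℂ) 1, z - -c ≠ 0 := by
    intro z hz h
    rw [mem_closedBall_zero_iff, sub_eq_zero.1 h, norm_neg] at hz
    linarith
  rw [integral_exp_div_exp_add, DiffContOnCl.circleIntegral_eq_zero zero_le_one, mul_zero]
  refine DifferentiableOn.diffContOnCl ?_
  rw [closure_ball _ one_ne_zero]
  intro z hz
  have h : DifferentiableAt ℂ (fun z : ℂ => z - -c) z := differentiableAt_id.sub_const _
  exact (h.fun_inv (hne z hz)).differentiableWithinAt

theorem norm_one_add_exp_sq (y : ℝ) : ‖1 + Complex.exp (y * Complex.I)‖ ^ 2 = 2 + 2 * Real.cos y := by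
  rw [← Complex.normSq_eq_norm_sq, Complex.normSq_apply]
  simp only [Complex.add_re, Complex.add_im, Complex.one_re, Complex.one_im,
    Complex.exp_ofReal_mul_I_re, Complex.exp_ofReal_mul_I_im]
  linear_combination Real.sin_sq_add_cos_sq y

theorem re_exp_div (x y : ℝ) :
    (Complex.exp (x * Complex.I) / (Complex.exp (x * Complex.I)
      + (1 + Complex.exp (y * Complex.I)))).re = windX x y / latticeNormSq x y := by
  rw [Complex.div_re, ← add_div, Complex.normSq_apply]
  simp only [Complex.add_re, Complex.add_im, Complex.one_re, Complex.one_im,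
    Complex.exp_ofReal_mul_I_re, Complex.exp_ofReal_mul_I_im]
  have a := Real.sin_sq_add_cos_sq x
  have b := Real.sin_sq_add_cos_sq y
  congr 1
  · rw [windX, Real.cos_sub]; linear_combination a
  · rw [latticeNormSq, Real.cos_sub]; linear_combination a + b

theorem integral_windX_div (a y : ℝ) (hy : 2 + 2 * Real.cos y ≠ 1) :
    ∫ x in a..(a + 2 * Real.pi), windX x y / latticeNormSq x y
      = (∫ x in (0 : ℝ)..2 * Real.pi, Complex.exp (x * Complex.I) / (Complex.exp (x * Complex.I)
      + (1 + Complex.exp (y * Complex.I)))).re := by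
  have hc : ‖1 + Complex.exp (y * Complex.I)‖ ≠ 1 := by
    intro h
    apply hy
    rw [← norm_one_add_exp_sq, h, one_pow]
  have hper : Function.Periodic (fun x : ℝ => windX x y / latticeNormSq x y) (2 * Real.pi) := by
    intro x
    simp only [windX, latticeNormSq, Real.cos_add_two_pi, cos_add_two_pi_sub]
  rw [hper.intervalIntegral_add_eq a 0, zero_add]
  have := Complex.reCLM.intervalIntegral_comp_comm
    ((continuous_exp_div_exp_add hc).intervalIntegrable (μ := MeasureTheory.volume) 0 (2 * Real.pi))
  rw [← Complex.reCLM_apply, ← this]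
  refine intervalIntegral.integral_congr fun x _ => ?_
  exact (re_exp_div x y).symm

theorem integral_windX_div_of_lt (a : ℝ) {y : ℝ} (hy : Real.cos y < -1 / 2) :
    ∫ x in a..(a + 2 * Real.pi), windX x y / latticeNormSq x y = 2 * Real.pi := by
  rw [integral_windX_div a y (by linarith), integral_exp_div_exp_add_of_lt]
  · simp
  · have h := norm_one_add_exp_sq y
    nlinarith [norm_nonneg (1 + Complex.exp (y * Complex.I))]

theorem integral_windX_div_of_gt (a : ℝ) {y : ℝ} (hy : -1 / 2 < Real.cos y) :
    ∫ x in a..(a + 2 * Real.pi), windX x y / latticeNormSq x y = 0 := by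
  rw [integral_windX_div a y (by linarith), integral_exp_div_exp_add_of_gt]
  · simp
  · have h := norm_one_add_exp_sq y
    nlinarith [norm_nonneg (1 + Complex.exp (y * Complex.I))]

variable {P : Params}

/-- The part of `fluxY` that is continuous at the gapless point, after integration. -/
noncomputable def fluxRegular (P : Params) (x y : ℝ) : ℝ :=
  blochMass P x y / gap P x y * (√3 / 2 - 3 * √3 / 2 * (windX x y / latticeNormSq x y))

/-- From t₁²|f|² = (E - m)(E + m) the connection coefficient is -(1 - m/E)/|f|². The flux thus
splits into the topological term ∂ₓ arg f and a remainder proportional to m/E. -/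
theorem fluxY_eq {x y : ℝ} (ht₁ : 0 < P.t₁) (hN : 0 < latticeNormSq x y) (hm : 0 ≤ blochMass P x y) :
    fluxY P x y = 3 * √3 / 2 * (windX x y / latticeNormSq x y) + fluxRegular P x y := by
  have hE : 0 < gap P x y := Real.sqrt_pos.2 (by positivity)
  have h := gap_sq P x y
  have hEm : 0 < gap P x y + blochMass P x y := by positivity
  have hc : connCoeff P x y
      = (blochMass P x y / gap P x y - 1) / latticeNormSq x y := by
    rw [connCoeff]
    field_simp
    linear_combination h
  rw [fluxY, hc, fluxRegular]
  ring

theorem latticeNormSq_chart_pos {u v : ℝ} (hu : |u| ≤ Real.pi) (hu0 : u ≠ 0)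
    (hv : 12 * Real.sin (v / 2) ^ 2 ≤ 1) :
    0 < latticeNormSq (4 * Real.pi / 3 + u) (2 * Real.pi / 3 + v) :=
  (half_pos (cosDefect_pos_of_left hu hu0)).trans_le (latticeNormSq_chart_ge hv)

/-- Although ∂ₓ arg f blows up like 1/|f|, the factor m/E compensates: m = O(`cosDefect`), E ≥ t₁|f|
and `cosDefect` ≤ 2|f|². In the constant, √3 is replaced by 2. -/
theorem abs_fluxRegular_le (ht₁ : 0 < P.t₁) (hW : P.W = 3 * √3 * P.t₂ * Real.sin P.φ)
    (hτ : 0 < P.t₂ * Real.sin P.φ) {u v : ℝ} (hu : |u| ≤ Real.pi) (hu0 : u ≠ 0)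
    (hv : 12 * Real.sin (v / 2) ^ 2 ≤ 1) :
    |fluxRegular P (4 * Real.pi / 3 + u) (2 * Real.pi / 3 + v)|
      ≤ 1 + 18 * (P.t₂ * Real.sin P.φ) / P.t₁ := by
  have hC := cosDefect_pos_of_left (v := v) hu hu0
  have hN' := latticeNormSq_chart_ge (u := u) hv
  have hm0 := blochMass_chart_nonneg hW hτ u v
  have hm := blochMass_chart_le hW hτ u v
  have hN := latticeNormSq_chart_pos hu hu0 hv
  rw [fluxRegular]
  set x := 4 * Real.pi / 3 + u
  set y := 2 * Real.pi / 3 + v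
  set τ := P.t₂ * Real.sin P.φ
  have hE : 0 < gap P x y := Real.sqrt_pos.2 (by positivity)
  have h1 : blochMass P x y / gap P x y ≤ 1 := by
    rw [div_le_one hE]
    exact Real.le_sqrt_of_sq_le (le_add_of_nonneg_right (by positivity))
  have h2 := t₁_mul_sqrt_le_gap (P := P) x y
  have h3 := abs_windX_le x y
  have hs := Real.sqrt_pos.2 hN
  have h4 : |blochMass P x y / gap P x y * (windX x y / latticeNormSq x y)| ≤ 6 * τ / P.t₁ := by
    rw [abs_mul, abs_div, abs_div, abs_of_nonneg hm0, abs_of_pos hE, abs_of_pos hN]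
    calc _ ≤ 3 * τ * cosDefect u v / (P.t₁ * √(latticeNormSq x y))
          * (√(latticeNormSq x y) / latticeNormSq x y) := by gcongr
      _ = 3 * τ * cosDefect u v / P.t₁ * (1 / latticeNormSq x y) := by field_simp
      _ ≤ 3 * τ * cosDefect u v / P.t₁ * (1 / (cosDefect u v / 2)) := by gcongr
      _ = _ := by field_simp; ring
  have h5 := sqrt_three_le_two
  have h50 : 0 ≤ √3 := by positivity
  have h6 : |blochMass P x y / gap P x y| ≤ 1 := by rw [abs_of_nonneg (by positivity)]; exact h1
  calc _ = |√3 / 2 * (blochMass P x y / gap P x y)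
        - 3 * √3 / 2 * (blochMass P x y / gap P x y * (windX x y / latticeNormSq x y))| := by
        congr 1; ring
    _ ≤ |√3 / 2 * (blochMass P x y / gap P x y)|
        + |3 * √3 / 2 * (blochMass P x y / gap P x y * (windX x y / latticeNormSq x y))| := abs_sub _ _
    _ = √3 / 2 * |blochMass P x y / gap P x y|
        + 3 * √3 / 2 * |blochMass P x y / gap P x y * (windX x y / latticeNormSq x y)| := by
        rw [abs_mul, abs_mul, abs_of_nonneg (by positivity : 0 ≤ √3 / 2),
          abs_of_nonneg (by positivity : 0 ≤ 3 * √3 / 2)]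
    _ ≤ 2 / 2 * 1 + 3 * 2 / 2 * (6 * τ / P.t₁) := by gcongr
    _ = _ := by ring

theorem continuousAt_fluxRegular (ht₁ : 0 < P.t₁) {x y : ℝ} (hN : 0 < latticeNormSq x y) :
    ContinuousAt (fun t => fluxRegular P x t) y := by
  have hE : 0 < gap P x y := Real.sqrt_pos.2 (by positivity)
  have h1 : Continuous fun t => blochMass P x t := by unfold blochMass; fun_prop
  have h2 : Continuous fun t => gap P x t := by unfold gap blochMass latticeNormSq; fun_prop
  have h3 : Continuous fun t => windX x t := by unfold windX; fun_prop
  have h4 : Continuous fun t => latticeNormSq x t := by unfold latticeNormSq; fun_prop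
  have h5 : ContinuousAt (fun t => (gap P x t)⁻¹) y := h2.continuousAt.inv₀ hE.ne'
  have h6 : ContinuousAt (fun t => (latticeNormSq x t)⁻¹) y := h4.continuousAt.inv₀ hN.ne'
  have h7 : ContinuousAt (fun t => blochMass P x t * (gap P x t)⁻¹
      * (√3 / 2 - 3 * √3 / 2 * (windX x t * (latticeNormSq x t)⁻¹))) y := by
    fun_prop
  simpa only [fluxRegular, div_eq_mul_inv] using h7

theorem measurable_fluxRegular : Measurable fun p : ℝ × ℝ => fluxRegular P p.1 p.2 :=
  ((differentiable_blochMass (P := P)).continuous.measurable.div continuous_gap.measurable).mul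
    (measurable_const.sub (measurable_const.mul
      (differentiable_windX.continuous.measurable.div differentiable_latticeNormSq.continuous.measurable)))

theorem eventually_sin_half_sq_le : ∀ᶠ v : ℝ in 𝓝 0, 12 * Real.sin (v / 2) ^ 2 ≤ 1 := by
  have h : ContinuousAt (fun v : ℝ => 12 * Real.sin (v / 2) ^ 2) 0 := by fun_prop
  have := h.eventually_lt_const (u := 1) (by norm_num)
  exact this.mono fun _ h => h.le

theorem ae_chart : ∀ᵐ u : ℝ, u ∈ Set.uIoc (-Real.pi) Real.pi → |u| ≤ Real.pi ∧ u ≠ 0 := by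
  have h : ∀ᵐ u : ℝ, u ≠ 0 := by simp [MeasureTheory.ae_iff]
  filter_upwards [h] with u hu0 hu
  rw [Set.uIoc_of_le (by linarith [Real.pi_pos])] at hu
  exact ⟨abs_le.2 ⟨hu.1.le, hu.2⟩, hu0⟩

/-- The remainder is uniformly bounded and, for every u ≠ 0, continuous in v at 0. Hence it has the
same limit from both sides and contributes nothing to the jump. -/
theorem tendsto_integral_fluxRegular (ht₁ : 0 < P.t₁) (hW : P.W = 3 * √3 * P.t₂ * Real.sin P.φ)
    (hτ : 0 < P.t₂ * Real.sin P.φ) :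
    Tendsto (fun v => ∫ u in -Real.pi..Real.pi,
        fluxRegular P (4 * Real.pi / 3 + u) (2 * Real.pi / 3 + v)) (𝓝 0)
      (𝓝 (∫ u in -Real.pi..Real.pi, fluxRegular P (4 * Real.pi / 3 + u) (2 * Real.pi / 3 + 0))) := by
  refine intervalIntegral.tendsto_integral_filter_of_dominated_convergence
    (fun _ => 1 + 18 * (P.t₂ * Real.sin P.φ) / P.t₁) ?_ ?_ intervalIntegrable_const ?_
  · refine Eventually.of_forall fun v => ?_
    exact (measurable_fluxRegular.comp (f := fun u : ℝ => (4 * Real.pi / 3 + u, 2 * Real.pi / 3 + v))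
      (by fun_prop)).aestronglyMeasurable
  · filter_upwards [eventually_sin_half_sq_le] with v hv
    filter_upwards [ae_chart] with u hu hmem
    exact abs_fluxRegular_le ht₁ hW hτ (hu hmem).1 (hu hmem).2 hv
  · filter_upwards [ae_chart] with u hu hmem
    have hN := latticeNormSq_chart_pos (v := 0) (hu hmem).1 (hu hmem).2 (by norm_num)
    have h := continuousAt_fluxRegular (P := P) ht₁ hN
    exact h.tendsto.comp ((continuous_const.add continuous_id).tendsto (0 : ℝ))

theorem intervalIntegrable_fluxRegular (ht₁ : 0 < P.t₁) (hW : P.W = 3 * √3 * P.t₂ * Real.sin P.φ)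
    (hτ : 0 < P.t₂ * Real.sin P.φ) {v : ℝ} (hv : 12 * Real.sin (v / 2) ^ 2 ≤ 1) :
    IntervalIntegrable (fun u => fluxRegular P (4 * Real.pi / 3 + u) (2 * Real.pi / 3 + v))
      MeasureTheory.volume (-Real.pi) Real.pi := by
  refine (intervalIntegrable_const (c := 1 + 18 * (P.t₂ * Real.sin P.φ) / P.t₁)).mono_fun
    (measurable_fluxRegular.comp (f := fun u : ℝ => (4 * Real.pi / 3 + u, 2 * Real.pi / 3 + v))
      (by fun_prop)).aestronglyMeasurable ?_
  refine (MeasureTheory.ae_restrict_iff' measurableSet_uIoc).2 ?_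
  filter_upwards [ae_chart] with u hu hmem
  exact (abs_fluxRegular_le ht₁ hW hτ (hu hmem).1 (hu hmem).2 hv).trans (le_abs_self _)

theorem integral_fluxY_eq (ht₁ : 0 < P.t₁) (hW : P.W = 3 * √3 * P.t₂ * Real.sin P.φ)
    (hτ : 0 < P.t₂ * Real.sin P.φ) {v : ℝ} (hv : 12 * Real.sin (v / 2) ^ 2 ≤ 1)
    (hy : Real.cos (2 * Real.pi / 3 + v) ≠ -1 / 2) :
    ∫ u in -Real.pi..Real.pi, fluxY P (4 * Real.pi / 3 + u) (2 * Real.pi / 3 + v)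
      = 3 * √3 / 2 * (∫ x in (4 * Real.pi / 3 - Real.pi)..(4 * Real.pi / 3 - Real.pi + 2 * Real.pi),
          windX x (2 * Real.pi / 3 + v) / latticeNormSq x (2 * Real.pi / 3 + v))
        + ∫ u in -Real.pi..Real.pi, fluxRegular P (4 * Real.pi / 3 + u) (2 * Real.pi / 3 + v) := by
  have e : ∫ x in (4 * Real.pi / 3 - Real.pi)..(4 * Real.pi / 3 - Real.pi + 2 * Real.pi),
        windX x (2 * Real.pi / 3 + v) / latticeNormSq x (2 * Real.pi / 3 + v)
      = ∫ u in -Real.pi..Real.pi, windX (4 * Real.pi / 3 + u) (2 * Real.pi / 3 + v)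
          / latticeNormSq (4 * Real.pi / 3 + u) (2 * Real.pi / 3 + v) := by
    rw [intervalIntegral.integral_comp_add_left (fun x => windX x (2 * Real.pi / 3 + v)
      / latticeNormSq x (2 * Real.pi / 3 + v))]
    congr 1
    ring
  have hc : ‖1 + Complex.exp ((2 * Real.pi / 3 + v : ℝ) * Complex.I)‖ ≠ 1 := by
    intro h
    have h2 := norm_one_add_exp_sq (2 * Real.pi / 3 + v)
    rw [h] at h2
    exact hy (by linarith)
  have hcont : Continuous fun u : ℝ => windX (4 * Real.pi / 3 + u) (2 * Real.pi / 3 + v)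
          / latticeNormSq (4 * Real.pi / 3 + u) (2 * Real.pi / 3 + v) := by
    simp only [← re_exp_div]
    exact Complex.continuous_re.comp ((continuous_exp_div_exp_add hc).comp (by fun_prop))
  rw [e, ← intervalIntegral.integral_const_mul, ← intervalIntegral.integral_add
    ((hcont.intervalIntegrable _ _).const_mul _) (intervalIntegrable_fluxRegular ht₁ hW hτ hv)]
  refine intervalIntegral.integral_congr_ae ?_
  filter_upwards [ae_chart] with u hu hmem
  exact fluxY_eq ht₁ (latticeNormSq_chart_pos (hu hmem).1 (hu hmem).2 hv)
    (blochMass_chart_nonneg hW hτ u v)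

theorem cos_chart_lt {v : ℝ} (h0 : 0 < v) (h1 : v < Real.pi / 3) :
    Real.cos (2 * Real.pi / 3 + v) < -1 / 2 := by
  rw [← cos_two_pi_div_three]
  exact Real.cos_lt_cos_of_nonneg_of_le_pi (by positivity) (by linarith) (by linarith)

theorem cos_chart_gt {v : ℝ} (h0 : v < 0) (h1 : -(Real.pi / 3) < v) :
    -1 / 2 < Real.cos (2 * Real.pi / 3 + v) := by
  rw [← cos_two_pi_div_three]
  exact Real.cos_lt_cos_of_nonneg_of_le_pi (by linarith) (by linarith [Real.pi_pos]) (by linarith)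

/-- The jump of the integrated flux across the gapless point. -/
theorem tendsto_integral_fluxY_sub (ht₁ : 0 < P.t₁) (hW : P.W = 3 * √3 * P.t₂ * Real.sin P.φ)
    (hτ : 0 < P.t₂ * Real.sin P.φ) :
    Tendsto (fun v => (∫ u in -Real.pi..Real.pi, fluxY P (4 * Real.pi / 3 + u) (2 * Real.pi / 3 + -v))
        - ∫ u in -Real.pi..Real.pi, fluxY P (4 * Real.pi / 3 + u) (2 * Real.pi / 3 + v))
      (𝓝[>] 0) (𝓝 (-(3 * √3 * Real.pi))) := by
  have h1 := tendsto_integral_fluxRegular ht₁ hW hτ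
  have h2 : Tendsto (fun v : ℝ => -v) (𝓝 0) (𝓝 0) := by
    simpa using (continuous_neg (G := ℝ)).tendsto 0
  have h3 := ((h1.comp h2).sub h1).sub_const (3 * √3 * Real.pi)
  rw [sub_self, zero_sub] at h3
  refine (h3.mono_left nhdsWithin_le_nhds).congr' ?_
  have hpi : (0 : ℝ) < Real.pi / 3 := by positivity
  filter_upwards [nhdsWithin_le_nhds eventually_sin_half_sq_le,
    nhdsWithin_le_nhds (h2.eventually eventually_sin_half_sq_le),
    nhdsWithin_le_nhds (Iio_mem_nhds hpi), self_mem_nhdsWithin] with v hv hv' hvp hv0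
  have c1 := cos_chart_lt hv0 hvp
  have c2 := cos_chart_gt (v := -v) (neg_lt_zero.2 hv0) (neg_lt_neg hvp)
  -- Above the gapless point the winding integral is 2π and below it is 0, so the difference of
  -- topological terms is -(3√3/2) · 2π.
  rw [integral_fluxY_eq ht₁ hW hτ hv c1.ne, integral_fluxY_eq ht₁ hW hτ hv' c2.ne',
    integral_windX_div_of_lt _ c1, integral_windX_div_of_gt _ c2]
  simp only [Function.comp]
  ring

end Winding

/-! ### The Berry flux through the Brillouin zone -/

section Flux

/-- Lebesgue measure on the cell `(-π, π]²`. -/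
noncomputable def cellMeasure : MeasureTheory.Measure (ℝ × ℝ) :=
  (MeasureTheory.volume.restrict (Set.Ioc (-Real.pi) Real.pi)).prod
    (MeasureTheory.volume.restrict (Set.Ioc (-Real.pi) Real.pi))

theorem cellMeasure_eq : cellMeasure = MeasureTheory.volume.restrict
    (Set.Ioc (-Real.pi) Real.pi ×ˢ Set.Ioc (-Real.pi) Real.pi) := by
  rw [cellMeasure, MeasureTheory.Measure.prod_restrict, MeasureTheory.Measure.volume_eq_prod]

variable (P : Params)

/-- The gap in the chart centred at the gapless point. -/
noncomputable def chartGap (p : ℝ × ℝ) : ℝ := gap P (4 * Real.pi / 3 + p.1) (2 * Real.pi / 3 + p.2)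

/-- The curvature numerator in the chart centred at the gapless point. -/
noncomputable def chartNum (p : ℝ × ℝ) : ℝ :=
  curvNum P (4 * Real.pi / 3 + p.1) (2 * Real.pi / 3 + p.2)

theorem continuous_chartGap : Continuous (chartGap P) := by
  unfold chartGap gap blochMass latticeNormSq; fun_prop

theorem continuous_chartNum : Continuous (chartNum P) := by
  unfold chartNum curvNum blochMass massX massY windX windY latticeNormSq; fun_prop

variable {P}

theorem ae_cellMeasure : ∀ᵐ p ∂cellMeasure,
    (|p.1| ≤ Real.pi ∧ p.1 ≠ 0) ∧ (|p.2| ≤ Real.pi ∧ p.2 ≠ 0) := by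
  have h : ∀ᵐ u ∂MeasureTheory.volume.restrict (Set.Ioc (-Real.pi) Real.pi),
      |u| ≤ Real.pi ∧ u ≠ 0 := by
    rw [MeasureTheory.ae_restrict_iff' measurableSet_Ioc]
    filter_upwards [ae_chart] with u hu hmem
    exact hu (by rwa [Set.uIoc_of_le (by linarith [Real.pi_pos])])
  exact (MeasureTheory.Measure.quasiMeasurePreserving_fst.ae h).and
    (MeasureTheory.Measure.quasiMeasurePreserving_snd.ae h)

/-- The numerator is O(E²), so the curvature is O(1/E), and the inverse gap has a majorant that is a
product of two integrable one-dimensional singularities. -/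
theorem exists_curvature_majorant (ht₁ : 0 < P.t₁) (hW : P.W = 3 * √3 * P.t₂ * Real.sin P.φ)
    (hτ : 0 < P.t₂ * Real.sin P.φ) : ∃ g : ℝ × ℝ → ℝ, MeasureTheory.Integrable g cellMeasure ∧
      ∀ᵐ p ∂cellMeasure, 0 < chartGap P p ∧ |chartNum P p| / chartGap P p ^ 3 ≤ g p := by
  obtain ⟨K, hK, hq⟩ := exists_abs_curvNum_le ht₁ hW hτ
  obtain ⟨K', hK', hE⟩ := exists_inv_gap_le ht₁ hW hτ
  refine ⟨fun p => K * K' * (|p.1| ^ (-(1 / 2) : ℝ) * |p.2| ^ (-(1 / 2) : ℝ)),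
    (integrableOn_abs_rpow.mul_prod integrableOn_abs_rpow).const_mul _, ?_⟩
  filter_upwards [ae_cellMeasure] with p hp
  have h0 : 0 < chartGap P p := gap_chart_pos ht₁ hW hτ (cosDefect_pos_of_left hp.1.1 hp.1.2)
  refine ⟨h0, ?_⟩
  calc |chartNum P p| / chartGap P p ^ 3 ≤ K * chartGap P p ^ 2 / chartGap P p ^ 3 := by
        gcongr
        exact hq p.1 p.2
    _ = K * (chartGap P p)⁻¹ := by field_simp
    _ ≤ K * (K' * (|p.1| ^ (-(1 / 2) : ℝ) * |p.2| ^ (-(1 / 2) : ℝ))) := by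
        gcongr
        exact hE p.1 p.2 hp.1.1 hp.2.1 hp.1.2 hp.2.2
    _ = _ := by ring

theorem integrable_curvature (ht₁ : 0 < P.t₁) (hW : P.W = 3 * √3 * P.t₂ * Real.sin P.φ)
    (hτ : 0 < P.t₂ * Real.sin P.φ) :
    MeasureTheory.Integrable (fun p => chartNum P p / chartGap P p ^ 3) cellMeasure := by
  obtain ⟨g, hg, hb⟩ := exists_curvature_majorant ht₁ hW hτ
  refine hg.mono' ((continuous_chartNum P).measurable.div
    ((continuous_chartGap P).measurable.pow_const 3)).aestronglyMeasurable ?_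
  filter_upwards [hb] with p hp
  rw [Real.norm_eq_abs, abs_div, abs_of_pos (pow_pos hp.1 3)]
  exact hp.2

/-- For v ≠ 0 with |v| ≤ π the gap is positive whatever u is, so Stokes' theorem applies to any
horizontal strip avoiding v = 0, including strips through the other zero of f. -/
theorem integral_curvature_chart_strip (ht₁ : 0 < P.t₁) (hW : P.W = 3 * √3 * P.t₂ * Real.sin P.φ)
    (hτ : 0 < P.t₂ * Real.sin P.φ) {c d : ℝ} (hc : -Real.pi ≤ c) (hcd : c ≤ d) (hd : d ≤ Real.pi)
    (h0 : 0 ∉ Set.Icc c d) :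
    ∫ v in c..d, ∫ u in -Real.pi..Real.pi, chartNum P (u, v) / chartGap P (u, v) ^ 3
      = (∫ u in -Real.pi..Real.pi, fluxY P (4 * Real.pi / 3 + u) (2 * Real.pi / 3 + d))
        - ∫ u in -Real.pi..Real.pi, fluxY P (4 * Real.pi / 3 + u) (2 * Real.pi / 3 + c) := by
  have hpi : -Real.pi ≤ Real.pi := by linarith [Real.pi_pos]
  have hint := integrable_curvature ht₁ hW hτ
  rw [cellMeasure_eq] at hint
  rw [← MeasureTheory.intervalIntegral_intervalIntegral_swap
    (F := fun u v => chartNum P (u, v) / chartGap P (u, v) ^ 3)]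
  · have hE : ∀ x, ∀ y ∈ Set.uIcc (2 * Real.pi / 3 + c) (2 * Real.pi / 3 + d), 0 < gap P x y := by
      intro x y hy
      rw [Set.uIcc_of_le (by linarith)] at hy
      have hv : y - 2 * Real.pi / 3 ∈ Set.Icc c d := ⟨by linarith [hy.1], by linarith [hy.2]⟩
      have h := gap_chart_pos (P := P) ht₁ hW hτ (cosDefect_pos_of_right (u := x - 4 * Real.pi / 3)
        (v := y - 2 * Real.pi / 3) (abs_le.2 ⟨by linarith [hv.1], by linarith [hv.2]⟩)
        (fun h => h0 (h ▸ hv)))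
      rwa [add_sub_cancel, add_sub_cancel] at h
    have hm : ∀ x y, 0 ≤ blochMass P x y := by
      intro x y
      have h := blochMass_chart_nonneg hW hτ (x - 4 * Real.pi / 3) (y - 2 * Real.pi / 3)
      rwa [add_sub_cancel, add_sub_cancel] at h
    have key := integral_curvature_strip (4 * Real.pi / 3 + -Real.pi) _ _ hE hm
    rw [show 4 * Real.pi / 3 + -Real.pi + 2 * Real.pi = 4 * Real.pi / 3 + Real.pi by ring,
      ← intervalIntegral.integral_comp_add_left, ← intervalIntegral.integral_comp_add_left,
      ← intervalIntegral.integral_comp_add_left] at key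
    simp only [← intervalIntegral.integral_comp_add_left (fun y => curvNum P _ y / gap P _ y ^ 3)] at key
    exact key
  · refine MeasureTheory.IntegrableOn.mono_set hint ?_
    rw [Set.uIoc_of_le hpi, Set.uIoc_of_le hcd]
    exact Set.prod_mono le_rfl (Set.Ioc_subset_Ioc hc hd)

/-- The Berry flux through the Brillouin zone on the critical line. -/
theorem integral_curvature (ht₁ : 0 < P.t₁) (hW : P.W = 3 * √3 * P.t₂ * Real.sin P.φ)
    (hτ : 0 < P.t₂ * Real.sin P.φ) :
    ∫ p, chartNum P p / chartGap P p ^ 3 ∂cellMeasure = -(3 * √3 * Real.pi) := by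
  have hpi := Real.pi_pos
  have hpi' : -Real.pi ≤ Real.pi := by linarith
  have hint := integrable_curvature ht₁ hW hτ
  set f : ℝ × ℝ → ℝ := fun p => chartNum P p / chartGap P p ^ 3 with hf
  set Φ : ℝ → ℝ := fun v => ∫ u in -Real.pi..Real.pi, f (u, v) with hΦ
  set J : ℝ → ℝ := fun v => ∫ u in -Real.pi..Real.pi,
    fluxY P (4 * Real.pi / 3 + u) (2 * Real.pi / 3 + v) with hJ
  have hΦi : IntervalIntegrable Φ MeasureTheory.volume (-Real.pi) Real.pi := by
    rw [intervalIntegrable_iff_integrableOn_Ioc_of_le hpi']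
    simp only [hΦ, intervalIntegral.integral_of_le hpi']
    exact hint.integral_prod_right
  have hfub : ∫ p, f p ∂cellMeasure = ∫ v in -Real.pi..Real.pi, Φ v := by
    rw [cellMeasure, MeasureTheory.integral_prod_symm _ hint, intervalIntegral.integral_of_le hpi']
    simp only [hΦ, intervalIntegral.integral_of_le hpi']
  have hstrip : ∀ {c d : ℝ}, -Real.pi ≤ c → c ≤ d → d ≤ Real.pi → 0 ∉ Set.Icc c d →
      ∫ v in c..d, Φ v = J d - J c := fun hc hcd hd h0 =>
    integral_curvature_chart_strip ht₁ hW hτ hc hcd hd h0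
  -- The outer edges v = ±π are identified on the torus and will cancel.
  have hJp : J Real.pi = J (-Real.pi) := by
    refine intervalIntegral.integral_congr fun u _ => ?_
    rw [← fluxY_add_two_pi_right _ (2 * Real.pi / 3 + -Real.pi)]
    congr 1
    ring
  have hsub : ∀ {c d : ℝ}, c ∈ Set.Icc (-Real.pi) Real.pi → d ∈ Set.Icc (-Real.pi) Real.pi →
      IntervalIntegrable Φ MeasureTheory.volume c d := fun hc hd => by
    rw [← Set.uIcc_of_le hpi'] at hc hd
    exact hΦi.mono_set (Set.uIcc_subset_uIcc hc hd)
  have hmem0 : (0 : ℝ) ∈ Set.Icc (-Real.pi) Real.pi := ⟨by linarith, hpi.le⟩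
  -- Integrability of the curvature makes the contribution of the excised strip vanish as its width
  -- tends to 0.
  have hF : Tendsto (fun v => ∫ t in (0 : ℝ)..v, Φ t) (𝓝 0) (𝓝 0) := by
    have h := intervalIntegral.continuousOn_primitive_interval' hΦi (a := 0)
      (by rwa [Set.uIcc_of_le hpi'])
    rw [Set.uIcc_of_le hpi'] at h
    have h2 := (h.continuousAt (x := 0) (Icc_mem_nhds (by linarith) hpi)).tendsto
    rwa [intervalIntegral.integral_same] at h2
  have hneg : Tendsto (fun v : ℝ => -v) (𝓝 0) (𝓝 0) := by
    simpa using (continuous_neg (G := ℝ)).tendsto 0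
  have hlim : Tendsto (fun v => (∫ t in -Real.pi..Real.pi, Φ t)
      - ((∫ t in (0 : ℝ)..v, Φ t) - ∫ t in (0 : ℝ)..(-v), Φ t)) (𝓝[>] 0)
      (𝓝 (∫ t in -Real.pi..Real.pi, Φ t)) := by
    have h := ((hF.sub (hF.comp hneg)).const_sub (∫ t in -Real.pi..Real.pi, Φ t)).mono_left
      (nhdsWithin_le_nhds (s := Set.Ioi 0))
    simpa using h
  rw [hfub]
  refine tendsto_nhds_unique hlim ((tendsto_integral_fluxY_sub ht₁ hW hτ).congr' ?_)
  filter_upwards [Ioo_mem_nhdsGT hpi] with v hv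
  have m1 : v ∈ Set.Icc (-Real.pi) Real.pi := ⟨by linarith [hv.1], hv.2.le⟩
  have m2 : -v ∈ Set.Icc (-Real.pi) Real.pi := ⟨by linarith [hv.2], by linarith [hv.1]⟩
  have mp : Real.pi ∈ Set.Icc (-Real.pi) Real.pi := ⟨hpi', le_rfl⟩
  have mn : -Real.pi ∈ Set.Icc (-Real.pi) Real.pi := ⟨le_rfl, hpi'⟩
  have s1 := hstrip (c := v) (d := Real.pi) m1.1 m1.2 le_rfl (fun h => by linarith [h.1, hv.1])
  have s2 := hstrip (c := -Real.pi) (d := -v) le_rfl m2.1 m2.2 (fun h => by linarith [h.2, hv.1])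
  have a1 := intervalIntegral.integral_add_adjacent_intervals (hsub mn m2) (hsub m2 hmem0)
  have a2 := intervalIntegral.integral_add_adjacent_intervals (hsub mn hmem0) (hsub hmem0 m1)
  have a3 := intervalIntegral.integral_add_adjacent_intervals (hsub mn m1) (hsub m1 mp)
  have a4 := intervalIntegral.integral_symm (f := Φ) (μ := MeasureTheory.volume) 0 (-v)
  change J (-v) - J v = _
  linarith

end Flux

/-! ### Zero temperature and the Kubo conductivity -/

section Kubo

theorem fermi_mem_Icc (β e : ℝ) : fermi β e ∈ Set.Icc (0 : ℝ) 1 := by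
  rw [fermi]
  have := Real.exp_pos (β * e)
  exact ⟨by positivity, by rw [div_le_one (by positivity)]; linarith⟩

theorem continuous_fermi (β : ℝ) : Continuous (fermi β) := by
  unfold fermi
  exact continuous_const.div (by fun_prop) fun e => by positivity

theorem tendsto_fermi_of_pos {e : ℝ} (he : 0 < e) : Tendsto (fun β => fermi β e) atTop (𝓝 0) := by
  unfold fermi
  simp only [one_div]
  exact tendsto_inv_atTop_zero.comp (tendsto_atTop_add_const_left _ _
    (Real.tendsto_exp_atTop.comp (tendsto_id.atTop_mul_const he)))

theorem tendsto_fermi_of_neg {e : ℝ} (he : e < 0) : Tendsto (fun β => fermi β e) atTop (𝓝 1) := by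
  unfold fermi
  have h := ((Real.tendsto_exp_atBot.comp
    ((tendsto_id (α := ℝ)).atTop_mul_const_of_neg he)).const_add 1).inv₀ (by norm_num)
  simpa using h

theorem tendsto_matsubara (p₀ : ℝ) : Tendsto (fun β => matsubara β p₀) atTop (𝓝 p₀) := by
  have h1 : Tendsto (fun β : ℝ => p₀ - 2 * Real.pi / β) atTop (𝓝 p₀) := by
    simpa using (tendsto_const_nhds (x := 2 * Real.pi)).div_atTop tendsto_id |>.const_sub p₀
  refine tendsto_of_tendsto_of_tendsto_of_le_of_le' h1 tendsto_const_nhds ?_ ?_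
  · filter_upwards [eventually_gt_atTop 0] with β hβ
    have hc : 0 < 2 * Real.pi / β := by positivity
    have h := Int.sub_one_lt_floor (β * p₀ / (2 * Real.pi))
    calc p₀ - 2 * Real.pi / β = 2 * Real.pi / β * (β * p₀ / (2 * Real.pi) - 1) := by field_simp
      _ ≤ _ := by rw [matsubara]; gcongr
  · filter_upwards [eventually_gt_atTop 0] with β hβ
    have hc : 0 < 2 * Real.pi / β := by positivity
    have h := Int.floor_le (β * p₀ / (2 * Real.pi))
    calc matsubara β p₀ ≤ 2 * Real.pi / β * (β * p₀ / (2 * Real.pi)) := by rw [matsubara]; gcongr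
      _ = p₀ := by field_simp

variable (P : Params)

/-- The chemical potential is chosen so that the band-symmetric energy is a multiple of |f|², and in
particular vanishes at the Fermi points. -/
theorem blochShift_eq (x y : ℝ) :
    blochShift P x y = -(P.t₂ * Real.cos P.φ * latticeNormSq x y) := by
  rw [blochShift, latticeNormSq, chemPot]; ring

variable {P}

/-- Since |f| ≤ 3, one has |e₀| ≤ t₂|f|² ≤ 3t₂|f| < t₁|f| ≤ E unless f = 0, and then e₀ = 0. Thus
zero energy separates the bands, and the Fermi functions become 1 and 0 in the ground state. -/
theorem abs_blochShift_lt_gap (ht₁ : 0 < P.t₁) (ht₂ : 0 < P.t₂) (ht : P.t₂ / P.t₁ < 1 / 3) {x y : ℝ}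
    (hE : 0 < gap P x y) : |blochShift P x y| < gap P x y := by
  have hN := latticeNormSq_nonneg x y
  have ht' : 3 * P.t₂ < P.t₁ := by
    rw [div_lt_iff₀ ht₁] at ht; linarith
  have h1 : |blochShift P x y| ≤ P.t₂ * latticeNormSq x y := by
    rw [blochShift_eq, abs_neg, abs_mul, abs_mul, abs_of_pos ht₂, abs_of_nonneg hN]
    refine mul_le_mul_of_nonneg_right ?_ hN
    exact mul_le_of_le_one_right ht₂.le (Real.abs_cos_le_one _)
  rcases hN.eq_or_lt with h0 | h0
  · rw [← h0, mul_zero] at h1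
    exact h1.trans_lt hE
  · have hs := Real.sqrt_pos.2 h0
    calc |blochShift P x y| ≤ P.t₂ * (3 * √(latticeNormSq x y)) :=
          h1.trans (mul_le_mul_of_nonneg_left (latticeNormSq_le_sqrt x y) ht₂.le)
      _ = 3 * P.t₂ * √(latticeNormSq x y) := by ring
      _ < P.t₁ * √(latticeNormSq x y) := by gcongr
      _ ≤ _ := t₁_mul_sqrt_le_gap x y

variable (P)

/-- The band-symmetric energy in the chart centred at the gapless point. -/
noncomputable def chartShift (p : ℝ × ℝ) : ℝ :=
  blochShift P (4 * Real.pi / 3 + p.1) (2 * Real.pi / 3 + p.2)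

theorem continuous_chartShift : Continuous (chartShift P) := by
  unfold chartShift blochShift; fun_prop

/-- The response of the mode with momentum `p` at frequency `ω` and inverse temperature `β`. -/
noncomputable def thermalResponse (β ω : ℝ) (p : ℝ × ℝ) : ℝ :=
  -2 * chartNum P p * (ω * (fermi β (chartShift P p - chartGap P p)
    - fermi β (chartShift P p + chartGap P p)) / (chartGap P p * (4 * chartGap P p ^ 2 + ω ^ 2)))

/-- The response of the mode with momentum `p` at frequency `ω` in the ground state. -/
noncomputable def groundResponse (ω : ℝ) (p : ℝ × ℝ) : ℝ :=
  -2 * chartNum P p * (ω / (chartGap P p * (4 * chartGap P p ^ 2 + ω ^ 2)))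

variable {P}

theorem measurable_thermalResponse (β ω : ℝ) : Measurable (thermalResponse P β ω) := by
  have h1 := (continuous_chartNum P).measurable
  have h2 := (continuous_chartGap P).measurable
  have h3 := ((continuous_fermi β).comp
    ((continuous_chartShift P).sub (continuous_chartGap P))).measurable
  have h4 := ((continuous_fermi β).comp
    ((continuous_chartShift P).add (continuous_chartGap P))).measurable
  exact (h1.const_mul _).mul (((h3.sub h4).const_mul _).div
    (h2.mul (((h2.pow_const 2).const_mul 4).add_const _)))

/-- Dropping ω² from the denominator gives a bound linear in |ω|, uniform in the temperature and
still uniform after division by ω. -/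
theorem abs_response_le {q E ω s : ℝ} (hE : 0 < E) (hs : |s| ≤ 1) :
    |-2 * q * (ω * s / (E * (4 * E ^ 2 + ω ^ 2)))| ≤ |ω| * (|q| / E ^ 3) := by
  have hD : 0 < E * (4 * E ^ 2 + ω ^ 2) := by positivity
  rw [abs_mul, abs_mul, abs_div, abs_mul, abs_of_pos hD, abs_neg, abs_two]
  have h : |ω| * |s| / (E * (4 * E ^ 2 + ω ^ 2)) ≤ |ω| * 1 / (E * (4 * E ^ 2)) := by
    gcongr
    exact le_add_of_nonneg_right (sq_nonneg _)
  calc _ ≤ 2 * |q| * (|ω| * 1 / (E * (4 * E ^ 2))) := by gcongr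
    _ = 1 / 2 * (|ω| * (|q| / E ^ 3)) := by field_simp; ring
    _ ≤ _ := by
      have : 0 ≤ |ω| * (|q| / E ^ 3) := by positivity
      linarith

theorem abs_fermi_sub_le_one (β a b : ℝ) : |fermi β a - fermi β b| ≤ 1 := by
  have h1 := fermi_mem_Icc β a
  have h2 := fermi_mem_Icc β b
  exact abs_le.2 ⟨by linarith [h1.1, h2.2], by linarith [h1.2, h2.1]⟩

theorem tendsto_integral_thermalResponse (ht₁ : 0 < P.t₁) (ht₂ : 0 < P.t₂)
    (ht : P.t₂ / P.t₁ < 1 / 3) (hW : P.W = 3 * √3 * P.t₂ * Real.sin P.φ)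
    (hτ : 0 < P.t₂ * Real.sin P.φ) (p₀ : ℝ) :
    Tendsto (fun β => ∫ p, thermalResponse P β (matsubara β p₀) p ∂cellMeasure) atTop
      (𝓝 (∫ p, groundResponse P p₀ p ∂cellMeasure)) := by
  obtain ⟨g, hg, hb⟩ := exists_curvature_majorant ht₁ hW hτ
  refine MeasureTheory.tendsto_integral_filter_of_dominated_convergence
    (fun p => (|p₀| + 1) * g p) ?_ ?_ (hg.const_mul _) ?_
  · exact Eventually.of_forall fun β => (measurable_thermalResponse β _).aestronglyMeasurable
  · have h := (tendsto_matsubara p₀).abs.eventually_lt_const (lt_add_one |p₀|)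
    filter_upwards [h] with β hβ
    filter_upwards [hb] with p hp
    refine (abs_response_le hp.1 (abs_fermi_sub_le_one β _ _)).trans ?_
    have : 0 ≤ |chartNum P p| / chartGap P p ^ 3 := by
      have := hp.1
      positivity
    exact mul_le_mul hβ.le hp.2 this (by positivity)
  · filter_upwards [hb] with p hp
    have hs := abs_lt.1 (abs_blochShift_lt_gap ht₁ ht₂ ht hp.1)
    have h1 : Tendsto (fun β => fermi β (chartShift P p - chartGap P p)) atTop (𝓝 1) :=
      tendsto_fermi_of_neg (sub_neg.2 hs.2)
    have h2 : Tendsto (fun β => fermi β (chartShift P p + chartGap P p)) atTop (𝓝 0) :=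
      tendsto_fermi_of_pos (by linarith [hs.1] : 0 < blochShift P _ _ + gap P _ _)
    have h3 := tendsto_matsubara p₀
    have hne : chartGap P p * (4 * chartGap P p ^ 2 + p₀ ^ 2) ≠ 0 := by
      have := hp.1
      positivity
    have h4 := ((h3.mul (h1.sub h2)).div (((h3.pow 2).const_add (4 * chartGap P p ^ 2)).const_mul
      (chartGap P p)) hne).const_mul (-2 * chartNum P p)
    rw [sub_zero, mul_one] at h4
    exact h4

/-- Pointwise, the quotient tends to -q/(2E³), and the curvature majorant dominates it for every ω <
0. The limit is therefore -1/2 times the Berry flux. -/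
theorem tendsto_integral_groundResponse_div (ht₁ : 0 < P.t₁)
    (hW : P.W = 3 * √3 * P.t₂ * Real.sin P.φ) (hτ : 0 < P.t₂ * Real.sin P.φ) :
    Tendsto (fun p₀ => (∫ p, groundResponse P p₀ p ∂cellMeasure) / p₀) (𝓝[<] 0)
      (𝓝 (3 * √3 * Real.pi / 2)) := by
  obtain ⟨g, hg, hb⟩ := exists_curvature_majorant ht₁ hW hτ
  have e : 3 * √3 * Real.pi / 2
      = ∫ p, -(1 / 2) * (chartNum P p / chartGap P p ^ 3) ∂cellMeasure := by
    rw [MeasureTheory.integral_const_mul, integral_curvature ht₁ hW hτ]; ring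
  rw [e]
  simp only [← MeasureTheory.integral_div]
  refine MeasureTheory.tendsto_integral_filter_of_dominated_convergence g ?_ ?_ hg ?_
  · have h1 := (continuous_chartNum P).measurable
    have h2 := (continuous_chartGap P).measurable
    exact Eventually.of_forall fun ω => (((h1.const_mul _).mul (measurable_const.div
      (h2.mul (((h2.pow_const 2).const_mul 4).add_const _)))).div_const _).aestronglyMeasurable
  · filter_upwards [self_mem_nhdsWithin] with ω hω
    filter_upwards [hb] with p hp
    have hω' : 0 < |ω| := abs_pos.2 (ne_of_lt hω)
    have h := abs_response_le (q := chartNum P p) (ω := ω) hp.1 (abs_one (α := ℝ)).le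
    rw [mul_one] at h
    rw [Real.norm_eq_abs, abs_div, div_le_iff₀' hω']
    exact h.trans (mul_le_mul_of_nonneg_left hp.2 hω'.le)
  · filter_upwards [hb] with p hp
    have hE := hp.1
    have hc : ContinuousAt (fun ω : ℝ => -2 * chartNum P p
        / (chartGap P p * (4 * chartGap P p ^ 2 + ω ^ 2))) 0 := by
      have hne : chartGap P p * (4 * chartGap P p ^ 2 + (0 : ℝ) ^ 2) ≠ 0 := by positivity
      fun_prop (disch := exact hne)
    have h := hc.tendsto.mono_left (nhdsWithin_le_nhds (s := Set.Iio 0))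
    have e2 : -2 * chartNum P p / (chartGap P p * (4 * chartGap P p ^ 2 + (0 : ℝ) ^ 2))
        = -(1 / 2) * (chartNum P p / chartGap P p ^ 3) := by
      field_simp
      ring
    rw [e2] at h
    refine h.congr' ?_
    filter_upwards [self_mem_nhdsWithin] with ω hω
    have hω' : ω ≠ 0 := ne_of_lt hω
    have : 0 < 4 * chartGap P p ^ 2 + ω ^ 2 := by positivity
    rw [groundResponse]
    field_simp

theorem cellIntegral_chart {f : ℝ → ℝ → ℂ} (hf : Continuous fun p : ℝ × ℝ => f p.1 p.2) :
    cellIntegral (4 * Real.pi / 3 + -Real.pi) (2 * Real.pi / 3 + -Real.pi) f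
      = ∫ p, f (4 * Real.pi / 3 + p.1) (2 * Real.pi / 3 + p.2) ∂cellMeasure := by
  have hpi : -Real.pi ≤ Real.pi := by linarith [Real.pi_pos]
  have hc : Continuous fun p : ℝ × ℝ => f (4 * Real.pi / 3 + p.1) (2 * Real.pi / 3 + p.2) :=
    hf.comp (by fun_prop : Continuous fun p : ℝ × ℝ =>
      (4 * Real.pi / 3 + p.1, 2 * Real.pi / 3 + p.2))
  have hint := integrableOn_uIoc_prod_uIoc hc (-Real.pi) Real.pi (-Real.pi) Real.pi
  rw [Set.uIoc_of_le hpi, MeasureTheory.IntegrableOn, ← cellMeasure_eq] at hint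
  rw [cellMeasure] at hint ⊢
  rw [MeasureTheory.integral_prod _ hint, cellIntegral,
    show 4 * Real.pi / 3 + -Real.pi + 2 * Real.pi = 4 * Real.pi / 3 + Real.pi by ring,
    show 2 * Real.pi / 3 + -Real.pi + 2 * Real.pi = 2 * Real.pi / 3 + Real.pi by ring,
    ← intervalIntegral.integral_comp_add_left]
  simp only [← intervalIntegral.integral_comp_add_left (fun y => f _ y),
    intervalIntegral.integral_of_le hpi]

theorem cellIntegral_oddFiber (ht₁ : 0 < P.t₁) (hW : P.W = 3 * √3 * P.t₂ * Real.sin P.φ)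
    (hτ : 0 < P.t₂ * Real.sin P.φ) {β ω : ℝ} (hω : Complex.exp (-(Complex.I * ω * β)) = 1) :
    cellIntegral (4 * Real.pi / 3 + -Real.pi) (2 * Real.pi / 3 + -Real.pi) (oddFiber P β ω)
      = ((∫ p, thermalResponse P β ω p ∂cellMeasure : ℝ) : ℂ) := by
  obtain ⟨g, -, hb⟩ := exists_curvature_majorant ht₁ hW hτ
  rw [cellIntegral_chart, ← integral_complex_ofReal]
  · refine MeasureTheory.integral_congr_ae ?_
    filter_upwards [hb] with p hp
    exact oddFiber_eq P hω hp.1.ne'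
  · exact ((continuous_fiber P β ω).sub (continuous_fiber P β (-ω))).div_const 2

theorem isLimitCorrelation (ht₁ : 0 < P.t₁) (ht₂ : 0 < P.t₂)
    (ht : P.t₂ / P.t₁ < 1 / 3) (hW : P.W = 3 * √3 * P.t₂ * Real.sin P.φ)
    (hτ : 0 < P.t₂ * Real.sin P.φ) :
    IsLimitCorrelation P 0 1 fun p₀ =>
      1 / (4 * (Real.pi : ℂ) ^ 2) * ((∫ p, groundResponse P p₀ p ∂cellMeasure : ℝ) : ℂ) := by
  refine ⟨fun β p₀ => 1 / (4 * (Real.pi : ℂ) ^ 2) *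
    ((∫ p, thermalResponse P β (matsubara β p₀) p ∂cellMeasure : ℝ) : ℂ), fun β hβ p₀ => ?_,
    fun p₀ => ?_⟩
  · beta_reduce
    rw [← cellIntegral_oddFiber ht₁ hW hτ (matsubara_phase hβ p₀)]
    exact tendsto_correlation P hβ p₀ _ _
  · exact ((Complex.continuous_ofReal.tendsto _).comp
      (tendsto_integral_thermalResponse ht₁ ht₂ ht hW hτ p₀)).const_mul _

theorem hasKuboConductivity (ht₁ : 0 < P.t₁) (ht₂ : 0 < P.t₂)
    (ht : P.t₂ / P.t₁ < 1 / 3) (hW : P.W = 3 * √3 * P.t₂ * Real.sin P.φ)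
    (hτ : 0 < P.t₂ * Real.sin P.φ) : HasKuboConductivity P 0 1 (1 / (4 * (Real.pi : ℂ))) := by
  refine ⟨_, isLimitCorrelation ht₁ ht₂ ht hW hτ, ?_⟩
  have h0 : ∫ p, groundResponse P 0 p ∂cellMeasure = 0 := by
    simp [groundResponse]
  have h := ((Complex.continuous_ofReal.tendsto _).comp
    (tendsto_integral_groundResponse_div ht₁ hW hτ)).const_mul
      (1 / (cellArea : ℂ) * (1 / (4 * (Real.pi : ℂ) ^ 2)))
  -- The cell area 3√3/2 cancels the geometric factor of the flux.
  have e : 1 / (cellArea : ℂ) * (1 / (4 * (Real.pi : ℂ) ^ 2)) * ((3 * √3 * Real.pi / 2 : ℝ) : ℂ)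
      = 1 / (4 * (Real.pi : ℂ)) := by
    have h3 : ((√3 : ℝ) : ℂ) ≠ 0 := Complex.ofReal_ne_zero.2 (by positivity)
    have hpi : (Real.pi : ℂ) ≠ 0 := Complex.ofReal_ne_zero.2 Real.pi_ne_zero
    rw [cellArea_eq]
    push_cast
    field_simp
  rw [e] at h
  refine h.congr fun p₀ => ?_
  simp only [Function.comp, h0, Complex.ofReal_zero, mul_zero, sub_zero, Complex.ofReal_div]
  ring

end Kubo

end Haldane

theorem mainTheorem3 (P : Haldane.Params)
    (ht₁ : 0 < P.t₁) (ht₂ : 0 < P.t₂) (ht : P.t₂ / P.t₁ < 1 / 3)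
    (hφ : P.φ ∈ Set.Ioo 0 Real.pi) (hm : Haldane.massMinus P = 0) :
    Haldane.HasKuboConductivity P 0 1 (1 / (4 * (Real.pi : ℂ))) := by
  have hs : 0 < Real.sin P.φ := Real.sin_pos_of_pos_of_lt_pi hφ.1 hφ.2
  rw [Haldane.massMinus_eq] at hm
  -- The condition m₋ = 0 is W = 3√3 t₂ sin φ, and φ ∈ (0, π) makes the mass scale t₂ sin φ
  -- positive.
  exact Haldane.hasKuboConductivity ht₁ ht₂ ht (sub_eq_zero.1 hm) (mul_pos ht₂ hs)
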